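/- A real projective variety is a complex projective variety $X\subset\mathbb{P}^n$ that is stable under the real structure $\sigma\colon(x_0:\ldots:x_n)\mapsto(\overline{x_0}:\ldots:\overline{x_n})$; its real points are the points fixed by $\sigma$, and isomorphisms and automorphisms of real varieties are biregular maps that commute with the real structures. $\operatorname{Aut}_\circ(X)$ denotes the identity component of the Lie group $\operatorname{Aut}(X)$ of automorphisms of the real variety $X$. Let $\mathbb{S}^n\subset\mathbb{P}^{n+1}$ be the quadric $-x_0^2+x_1^2+\cdots+x_{n+1}^2=0$. A double Segre surface is a real variety $X\subset\mathbb{P}^8$ for which there is a complex biregular isomorphism $\mathbb{P}^1\times\mathbb{P}^1\to X$ whose components form a basis of the vector space of forms of bidegree $(2,2)$. For $X\subset Q\subset\mathbb{P}^8$, the inclusion $\operatorname{Aut}_\circ(X)\subset\operatorname{Aut}_\circ(Q)$ is one of groups of real projective transformations of $\mathbb{P}^8$: every element of $\operatorname{Aut}_\circ(X)$ is the restriction to $X$ of a real projective transformation of $\mathbb{P}^8$ that restricts to an element of $\operatorname{Aut}_\circ(Q)$. Corollary. Let $Q\subset\mathbb{P}^8$ be a quadric hypersurface defined by a real quadratic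 form of signature $(4,5)$, respectively $(3,6)$. (i) If the signature is $(4,5)$, then there is a double Segre surface $X\subset Q$ with $\operatorname{Aut}_\circ(X)\subset\operatorname{Aut}_\circ(Q)$ and $X\cong\mathbb{S}^1\times\mathbb{S}^1$, and every double Segre surface $X'\subset Q$ with $\operatorname{Aut}_\circ(X')\subset\operatorname{Aut}_\circ(Q)$ is the image of $X$ under a real projective transformation of $\mathbb{P}^8$ that maps $Q$ onto $Q$. (ii) If the signature is $(3,6)$, then there is a double Segre surface $X\subset Q$ with a real point, with $\operatorname{Aut}_\circ(X)\subset\operatorname{Aut}_\circ(Q)$ and $X\cong\mathbb{S}^2$, and every double Segre surface $X'\subset Q$ that has a real point and satisfies $\operatorname{Aut}_\circ(X')\subset\operatorname{Aut}_\circ(Q)$ is the image of $X$ under a real projective transformation of $\mathbb{P}^8$ that maps $Q$ onto $Q$. -/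

import Mathlib

open scoped LinearAlgebra.Projectivization

/-- Complex projective space `ℙⁿ`. -/
abbrev CP (n : ℕ) : Type := ℙ ℂ (Fin (n + 1) → ℂ)

namespace CP

/-- The Euclidean topology of `ℙⁿ`, i.e. the quotient topology of `ℂⁿ⁺¹ ∖ {0}`. -/
noncomputable instance instTopologicalSpace (n : ℕ) : TopologicalSpace (CP n) :=
  TopologicalSpace.coinduced
    (fun v : {v : Fin (n + 1) → ℂ // v ≠ 0} => Projectivization.mk ℂ v.1 v.2) inferInstance

/-- Coordinatewise complex conjugation of `ℂⁿ⁺¹`. -/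
def conjVec (n : ℕ) : (Fin (n + 1) → ℂ) →ₛₗ[starRingEnd ℂ] (Fin (n + 1) → ℂ) where
  toFun v := star v
  map_add' v w := star_add v w
  map_smul' c v := by ext i; simp

theorem conjVec_injective (n : ℕ) : Function.Injective (conjVec n) :=
  fun _ _ h => star_injective h

/-- The standard real structure `(x₀ : … : xₙ) ↦ (x̄₀ : … : x̄ₙ)` of `ℙⁿ`. -/
noncomputable def conj {n : ℕ} (p : CP n) : CP n :=
  Projectivization.map (conjVec n) (conjVec_injective n) p

/-- A subset of `ℙⁿ` that is stable under the standard real structure. -/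
def IsReal {n : ℕ} (X : Set (CP n)) : Prop := ∀ p ∈ X, conj p ∈ X

/-- `X` has a real point. -/
def HasRealPoint {n : ℕ} (X : Set (CP n)) : Prop := ∃ p ∈ X, conj p = p

/-- The projective transformation of `ℙⁿ` given by an invertible real matrix. These are the
automorphisms of the real variety `ℙⁿ`. -/
noncomputable def transf {n : ℕ} (M : GL (Fin (n + 1)) ℝ) (p : CP n) : CP n :=
  Matrix.GeneralLinearGroup.map Complex.ofRealHom M • p

end CP

/-- The point `p ∈ ℙⁿ` has homogeneous coordinates `(v₀ : … : vₙ)`. -/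
def HasCoords {n : ℕ} (p : CP n) (v : Fin (n + 1) → ℂ) : Prop :=
  ∃ h : v ≠ 0, p = Projectivization.mk ℂ v h

/-! ### Morphisms -/

/-- The values at (a representative of) `p ∈ ℙᵐ` of a tuple of polynomials. -/
noncomputable def evalAt {m k : ℕ} (F : Fin k → MvPolynomial (Fin (m + 1)) ℂ) (p : CP m) :
    Fin k → ℂ :=
  fun i => MvPolynomial.eval p.rep (F i)

/-- A map from a subset `A` of `ℙᵐ` to `ℙᵏ` is regular if, locally in the Zariski topology of `A`,
it is given by homogeneous polynomials of a common degree. -/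
def IsRegularMap {m k : ℕ} (A : Set (CP m)) (f : A → CP k) : Prop :=
  ∀ a : A, ∃ (d : ℕ) (F : Fin (k + 1) → MvPolynomial (Fin (m + 1)) ℂ),
    (∀ i, (F i).IsHomogeneous d) ∧ evalAt F a.1 ≠ 0 ∧
      ∀ b : A, evalAt F b.1 ≠ 0 → HasCoords (f b) (evalAt F b.1)

/-- The vector space of forms of bidegree `d` on `ℙᵃ × ℙᵇ`. -/
noncomputable def bidegreeForms (a b : ℕ) (d : ℕ × ℕ) :
    Submodule ℂ (MvPolynomial (Fin (a + 1) ⊕ Fin (b + 1)) ℂ) :=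
  MvPolynomial.weightedHomogeneousSubmodule ℂ
    (Sum.elim (fun _ => (1, 0)) (fun _ => (0, 1)) : Fin (a + 1) ⊕ Fin (b + 1) → ℕ × ℕ) d

/-- The values at (representatives of) `(p, q) ∈ ℙᵃ × ℙᵇ` of a tuple of polynomials. -/
noncomputable def evalAtProd {a b k : ℕ}
    (F : Fin k → MvPolynomial (Fin (a + 1) ⊕ Fin (b + 1)) ℂ) (p : CP a × CP b) : Fin k → ℂ :=
  fun i => MvPolynomial.eval (Sum.elim p.1.rep p.2.rep) (F i)

/-- A map from a subset `A` of `ℙᵃ × ℙᵇ` to `ℙᵏ` is regular if, locally in the Zariski topology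
of `A`, it is given by bihomogeneous polynomials of a common bidegree. -/
def IsRegularMapProd {a b k : ℕ} (A : Set (CP a × CP b)) (f : A → CP k) : Prop :=
  ∀ x : A, ∃ (d : ℕ × ℕ) (F : Fin (k + 1) → MvPolynomial (Fin (a + 1) ⊕ Fin (b + 1)) ℂ),
    (∀ i, F i ∈ bidegreeForms a b d) ∧ evalAtProd F x.1 ≠ 0 ∧
      ∀ y : A, evalAtProd F y.1 ≠ 0 → HasCoords (f y) (evalAtProd F y.1)

/-- Biregular isomorphisms between subvarieties of projective spaces. -/
def IsBiregular {m k : ℕ} {A : Set (CP m)} {B : Set (CP k)} (e : A ≃ B) : Prop :=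
  IsRegularMap A (fun x => (e x).1) ∧ IsRegularMap B (fun y => (e.symm y).1)

/-- Biregular isomorphisms from a subvariety of `ℙᵃ × ℙᵇ` to a subvariety of `ℙᵏ`. -/
def IsBiregularProd {a b k : ℕ} {A : Set (CP a × CP b)} {B : Set (CP k)} (e : A ≃ B) : Prop :=
  IsRegularMapProd A (fun x => (e x).1) ∧
    IsRegularMap B (fun y => (e.symm y).1.1) ∧ IsRegularMap B (fun y => (e.symm y).1.2)

/-- Compatibility of a map with the real structures. -/
def CommutesWithConj {m k : ℕ} {A : Set (CP m)} {B : Set (CP k)} (f : A → B) : Prop :=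
  ∀ x x' : A, x'.1 = CP.conj x.1 → (f x').1 = CP.conj (f x).1

/-- Compatibility of a map with the real structures, the real structure of `ℙᵃ × ℙᵇ` being the
product of the standard ones. -/
def CommutesWithConjProd {a b k : ℕ} {A : Set (CP a × CP b)} {B : Set (CP k)} (f : A → B) : Prop :=
  ∀ x x' : A, x'.1 = (CP.conj x.1.1, CP.conj x.1.2) → (f x').1 = CP.conj (f x).1

/-- Isomorphism of real varieties. -/
def RealIsomorphic {m k : ℕ} (A : Set (CP m)) (B : Set (CP k)) : Prop :=
  ∃ e : A ≃ B, IsBiregular e ∧ CommutesWithConj e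

/-- Isomorphism of real varieties, the first of which lies in `ℙᵃ × ℙᵇ`. -/
def RealIsomorphicProd {a b k : ℕ} (A : Set (CP a × CP b)) (B : Set (CP k)) : Prop :=
  ∃ e : A ≃ B, IsBiregularProd e ∧ CommutesWithConjProd e

/-! ### Quadrics and double Segre surfaces -/

/-- The quadric hypersurface `xᵀ A x = 0` in `ℙⁿ`. -/
def quadric {n : ℕ} (A : Matrix (Fin (n + 1)) (Fin (n + 1)) ℝ) : Set (CP n) :=
  {p | p.rep ⬝ᵥ ((A.map Complex.ofReal).mulVec p.rep) = 0}

/-- The real symmetric matrix `A` has signature `(r, s)`: the quadratic form `xᵀ A x` has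
positive index `r` and negative index `s`, and it is nondegenerate. -/
def HasSignature {n : ℕ} (A : Matrix (Fin n) (Fin n) ℝ) (r s : ℕ) : Prop :=
  A.IsSymm ∧ r + s = n ∧ sigPos A.toQuadraticForm' = r ∧
    sigNeg A.toQuadraticForm' = s

/-- The Möbius quadric `𝕊ⁿ : -x₀² + x₁² + ⋯ + xₙ₊₁² = 0` in `ℙⁿ⁺¹`. -/
def moebiusQuadric (n : ℕ) : Set (CP (n + 1)) :=
  quadric (Matrix.diagonal (Fin.cons (-1) (fun _ : Fin (n + 1) => 1)))

/-- A double Segre surface: a real subvariety `X` of `ℙ⁸` with a biregular isomorphism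
`ℙ¹ × ℙ¹ → X` over `ℂ` whose components form a basis of the vector space of forms of
bidegree `(2,2)`. Its real structure is the one induced from `ℙ⁸`. -/
def IsDoubleSegre (X : Set (CP 8)) : Prop :=
  CP.IsReal X ∧
    ∃ F : Fin (8 + 1) → MvPolynomial (Fin (1 + 1) ⊕ Fin (1 + 1)) ℂ,
      LinearIndependent ℂ F ∧ Submodule.span ℂ (Set.range F) = bidegreeForms 1 1 (2, 2) ∧
        ∃ e : (Set.univ : Set (CP 1 × CP 1)) ≃ X, IsBiregularProd e ∧
          ∀ x, HasCoords (e x).1 (evalAtProd F x.1)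

/-! ### Automorphism groups -/

/-- `Aut X`: the biregular automorphisms of the real variety `X`, as a subspace of the space of
continuous self-maps of `X` with the compact-open topology. -/
def realAut {n : ℕ} (X : Set (CP n)) : Set C(X, X) :=
  {f | ∃ e : X ≃ X, IsBiregular e ∧ CommutesWithConj e ∧ ∀ x, f x = e x}

/-- `Aut_∘ X`: the identity component of `Aut X`. -/
def realAutZero {n : ℕ} (X : Set (CP n)) : Set C(X, X) :=
  connectedComponentIn (realAut X) (ContinuousMap.id X)

/-- `Aut_∘ X ⊆ Aut_∘ Q` as groups of projective transformations of `ℙⁿ`: every element of `Aut_∘ X`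
is the restriction of a real projective transformation whose restriction to `Q` is an element of
`Aut_∘ Q`. -/
def AutZeroSubset {n : ℕ} (X Q : Set (CP n)) : Prop :=
  ∀ φ ∈ realAutZero X, ∃ M : GL (Fin (n + 1)) ℝ, ∃ ψ ∈ realAutZero Q,
    (∀ x : X, (φ x).1 = CP.transf M x.1) ∧ (∀ y : Q, (ψ y).1 = CP.transf M y.1)

/-- `X` and `X'` are equal up to a real projective transformation that preserves `Q`. -/
def EquivalentIn {n : ℕ} (Q X X' : Set (CP n)) : Prop :=
  ∃ M : GL (Fin (n + 1)) ℝ, CP.transf M '' Q = Q ∧ CP.transf M '' X = X'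

open Filter Topology

/-! ### Homogeneous coordinates -/

namespace HasCoords

/-! The forms of bidegree (2,2) on ℙ¹ × ℙ¹ are the linear forms in the products of the coordinates
of two conics. Hence a double Segre surface is the image of the rank one matrices `segre u w` under
a linear isomorphism `P` from `Mat3` to ℂ⁹ (`IsParam`), and all questions move to `Mat3`. As a
representation of GL₂ × GL₂ this space is Sym² ⊗ Sym²; it carries the form `segreForm`, the tensor
product of two copies of the equation of the conic.

Real structures: a regular map ℙ¹ × ℙ¹ → ℙ¹ is given globally by two coprime forms of one bidegree.
For an automorphism the bidegrees form a matrix that is invertible over ℕ, hence a permutation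
matrix, so automorphisms are pairs of projectivities, possibly with the factors exchanged. Complex
conjugation of X therefore becomes an antilinear map of `Mat3` built from two matrices, and a
Hilbert 90 argument normalizes it to `twistedConj 1 1`, `twistedConj quat 1`, `twistedConj quat
quat` or `swapConj` (`IsParam.exists_normal_form`).

Invariant quadrics: automorphisms of X extend to linear maps that scale `segreForm`, and the
extension is continuous because a projective transformation depends continuously on the images of
ten points; this gives the inclusion of identity components (`IsParam.autZeroSubset`). Conversely,
suppose that the identity component of Aut X preserves an indefinite quadric. One-parameter families
then scale its equation, since a form vanishing on the quadric is a multiple of that equation.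
Taking first-order terms and complexifying makes the equation semi-invariant under all pairs of
matrices; commutators remove the scalar, and a computation in coordinates leaves only real multiples
of `segreForm` (`IsParam.exists_cform_eq`).

Signatures: in the four cases `segreForm` has signature (5,4), (3,6), (9,0), (6,3) on the real
points of `Mat3`, and the multiple may have either sign. So (4,5) leaves only the first case, while
(3,6) leaves the second and the fourth, of which the second has no real points. If X and X' have the
same normal form, then P' ∘ P⁻¹ is the required real transformation. For existence, an orthogonal
basis of ℝ⁹ for A is matched with an orthogonal real basis of `Mat3`. The surface is a product of
circles in the first case because its points are products of two points of a conic, and a sphere in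
the fourth because exchange with conjugation is the Hermitian adjoint on 2 × 2 matrices of rank one.
-/

theorem rep {n : ℕ} (p : CP n) : HasCoords p p.rep := ⟨p.rep_nonzero, p.mk_rep.symm⟩

theorem ne_zero {n : ℕ} {p : CP n} {v : Fin (n + 1) → ℂ} (h : HasCoords p v) : v ≠ 0 := h.1

theorem mk {n : ℕ} {v : Fin (n + 1) → ℂ} (hv : v ≠ 0) :
    HasCoords (Projectivization.mk ℂ v hv) v := ⟨hv, rfl⟩

theorem smul {n : ℕ} {p : CP n} {v : Fin (n + 1) → ℂ} (h : HasCoords p v) {c : ℂ} (hc : c ≠ 0) :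
    HasCoords p (c • v) := by
  obtain ⟨hv, rfl⟩ := h
  refine ⟨smul_ne_zero hc hv, ?_⟩
  rw [Projectivization.mk_eq_mk_iff']
  exact ⟨c⁻¹, by rw [smul_smul, inv_mul_cancel₀ hc, one_smul]⟩

theorem exists_smul {n : ℕ} {p : CP n} {v w : Fin (n + 1) → ℂ} (h : HasCoords p v)
    (h' : HasCoords p w) : ∃ c : ℂ, c ≠ 0 ∧ w = c • v := by
  obtain ⟨hv, rfl⟩ := h
  obtain ⟨hw, e⟩ := h'
  rw [eq_comm, Projectivization.mk_eq_mk_iff'] at e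
  obtain ⟨c, hc⟩ := e
  exact ⟨c, by rintro rfl; exact hw (by simpa using hc.symm), hc.symm⟩

theorem eq {n : ℕ} {p q : CP n} {v : Fin (n + 1) → ℂ} (h : HasCoords p v) (h' : HasCoords q v) :
    p = q := by
  obtain ⟨_, rfl⟩ := h
  obtain ⟨_, rfl⟩ := h'
  rfl

theorem of_smul {n : ℕ} {p : CP n} {v : Fin (n + 1) → ℂ} {c : ℂ} (h : HasCoords p (c • v)) :
    HasCoords p v := by
  have hc : c ≠ 0 := by rintro rfl; exact h.ne_zero (zero_smul _ _)
  simpa [smul_smul, hc] using h.smul (inv_ne_zero hc)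

theorem conj {n : ℕ} {p : CP n} {v : Fin (n + 1) → ℂ} (h : HasCoords p v) :
    HasCoords (CP.conj p) (star v) := by
  obtain ⟨hv, rfl⟩ := h
  exact ⟨star_ne_zero.2 hv, rfl⟩

theorem transf {n : ℕ} {p : CP n} {v : Fin (n + 1) → ℂ} (h : HasCoords p v)
    (M : GL (Fin (n + 1)) ℝ) :
    HasCoords (CP.transf M p) ((M.1.map Complex.ofReal).mulVec v) := by
  obtain ⟨hv, rfl⟩ := h
  unfold CP.transf
  rw [Projectivization.smul_mk]
  exact ⟨_, rfl⟩

end HasCoords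

namespace CP

theorem conj_conj {n : ℕ} (p : CP n) : conj (conj p) = p := by
  have h := (HasCoords.rep p).conj.conj
  rw [star_star] at h
  exact h.eq (HasCoords.rep p)

theorem mem_quadric {n : ℕ} {A : Matrix (Fin (n + 1)) (Fin (n + 1)) ℝ} {p : CP n}
    {v : Fin (n + 1) → ℂ} (h : HasCoords p v) :
    p ∈ quadric A ↔ v ⬝ᵥ ((A.map Complex.ofReal).mulVec v) = 0 := by
  obtain ⟨c, hc, e⟩ := h.exists_smul (HasCoords.rep p)
  simp only [quadric, Set.mem_ofPred_eq, e, Matrix.mulVec_smul, smul_dotProduct, dotProduct_smul,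
    smul_eq_mul, mul_eq_zero, hc, false_or]

/-! ### Topology of projective space -/

/-- The saturation of an open set of nonzero vectors is the union of its rescalings by units, and
each of these is open. -/
theorem isOpenQuotientMap_mk (n : ℕ) : IsOpenQuotientMap
    (fun v : {v : Fin (n + 1) → ℂ // v ≠ 0} => (Projectivization.mk ℂ v.1 v.2 : CP n)) := by
  refine ⟨fun p => ⟨⟨p.rep, p.rep_nonzero⟩, p.mk_rep⟩, continuous_coinduced_rng, fun U hU => ?_⟩
  rw [isOpen_coinduced]
  have : (fun v : {v : Fin (n + 1) → ℂ // v ≠ 0} => (Projectivization.mk ℂ v.1 v.2 : CP n)) ⁻¹'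
      ((fun v : {v : Fin (n + 1) → ℂ // v ≠ 0} => (Projectivization.mk ℂ v.1 v.2 : CP n)) '' U)
      = ⋃ c : ℂˣ, (fun v => ⟨(c : ℂ) • v.1, smul_ne_zero c.ne_zero v.2⟩) ⁻¹' U := by
    ext v
    simp only [Set.mem_preimage, Set.mem_image, Set.mem_iUnion]
    constructor
    · rintro ⟨w, hw, e⟩
      rw [Projectivization.mk_eq_mk_iff] at e
      obtain ⟨c, hc⟩ := e
      refine ⟨c, ?_⟩
      convert! hw using 1
      exact Subtype.ext hc
    · rintro ⟨c, hc⟩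
      refine ⟨_, hc, ?_⟩
      exact (Projectivization.mk_eq_mk_iff _ _ _ _ _).2 ⟨c, rfl⟩
  rw [this]
  refine isOpen_iUnion fun c => hU.preimage ?_
  exact Continuous.subtype_mk (continuous_subtype_val.const_smul (c : ℂ)) _

/-- Near `p₀` some coordinate does not vanish, and dividing a representative by it is independent of
the representative. This makes the lift continuous although `rep` itself is an arbitrary choice. -/
theorem exists_lift {n : ℕ} (p₀ : CP n) : ∃ σ : CP n → Fin (n + 1) → ℂ,
    ContinuousAt σ p₀ ∧ ∀ᶠ p in 𝓝 p₀, HasCoords p (σ p) := by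
  obtain ⟨i, hi⟩ := Function.ne_iff.1 p₀.rep_nonzero
  have hq := isOpenQuotientMap_mk n
  have hp : (fun v : {v : Fin (n + 1) → ℂ // v ≠ 0} => (Projectivization.mk ℂ v.1 v.2 : CP n))
    ⟨p₀.rep, p₀.rep_nonzero⟩ = p₀ := p₀.mk_rep
  have hev : ∀ᶠ v : {v : Fin (n + 1) → ℂ // v ≠ 0} in 𝓝 ⟨p₀.rep, p₀.rep_nonzero⟩, v.1 i ≠ 0 :=
    ((continuous_apply i).comp continuous_subtype_val).continuousAt.eventually_ne hi
  have key : ∀ v : {v : Fin (n + 1) → ℂ // v ≠ 0}, v.1 i ≠ 0 →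
      (Projectivization.mk ℂ v.1 v.2 : CP n).rep i ≠ 0 ∧
      ((Projectivization.mk ℂ v.1 v.2 : CP n).rep i)⁻¹ •
        (Projectivization.mk ℂ v.1 v.2 : CP n).rep = (v.1 i)⁻¹ • v.1 := by
    intro v hv
    obtain ⟨c, hc, e⟩ := (HasCoords.mk v.2).exists_smul (HasCoords.rep _)
    rw [e]
    refine ⟨by simp [hc, hv], ?_⟩
    rw [smul_smul]
    congr 1
    simp only [Pi.smul_apply, smul_eq_mul]
    field_simp
  refine ⟨fun p => (p.rep i)⁻¹ • p.rep, ?_, ?_⟩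
  · rw [← hp, ← hq.continuousAt_comp_iff]
    have : ContinuousAt (fun v : {v : Fin (n + 1) → ℂ // v ≠ 0} => (v.1 i)⁻¹ • v.1)
        ⟨p₀.rep, p₀.rep_nonzero⟩ := by
      have hc : ContinuousAt (fun v : {v : Fin (n + 1) → ℂ // v ≠ 0} => v.1 i)
          ⟨p₀.rep, p₀.rep_nonzero⟩ :=
        ((continuous_apply i).comp continuous_subtype_val).continuousAt
      exact (hc.inv₀ hi).smul continuous_subtype_val.continuousAt
    refine this.congr ?_
    filter_upwards [hev] with v hv
    exact (key v hv).2.symm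
  · rw [← hp, ← hq.isOpenMap.map_nhds_eq hq.continuous.continuousAt, eventually_map]
    filter_upwards [hev] with v hv
    exact (HasCoords.rep _).smul (inv_ne_zero (key v hv).1)

theorem continuousAt_of_hasCoords {n : ℕ} {T : Type*} [TopologicalSpace T] {f : T → CP n}
    {v : T → Fin (n + 1) → ℂ} {t : T} (hv : ContinuousAt v t)
    (h : ∀ᶠ s in 𝓝 t, HasCoords (f s) (v s)) : ContinuousAt f t := by
  have h0 : v t ≠ 0 := h.self_of_nhds.ne_zero
  have hev : ∀ᶠ s in 𝓝 t, v s ≠ 0 := hv.eventually_ne h0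
  classical
  set w : T → {v : Fin (n + 1) → ℂ // v ≠ 0} := fun s => if hs : v s ≠ 0 then ⟨v s, hs⟩
    else ⟨v t, h0⟩ with hw
  have hwc : ContinuousAt w t := by
    have hi : Topology.IsInducing
        (Subtype.val : {v : Fin (n + 1) → ℂ // v ≠ 0} → Fin (n + 1) → ℂ) := ⟨rfl⟩
    rw [hi.continuousAt_iff]
    refine hv.congr ?_
    filter_upwards [hev] with s hs
    simp [hw, hs]
  have hwt : w t = ⟨v t, h0⟩ := by simp [hw]
  refine ((isOpenQuotientMap_mk n).continuous.continuousAt.comp hwc).congr ?_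
  filter_upwards [hev, h] with s hs hs'
  obtain ⟨_, e⟩ := hs'
  simp [hw, hs, e]

/-- A map to projective space that is given in homogeneous coordinates by a jointly continuous
function of a parameter and of the coordinates of a point is continuous. -/
theorem continuous_of_coords {n m : ℕ} {T : Type*} [TopologicalSpace T] {p : T → CP n}
    (hp : Continuous p) {G : T → (Fin (n + 1) → ℂ) → Fin (m + 1) → ℂ}
    (hG : Continuous (Function.uncurry G)) {f : T → CP m}
    (h : ∀ t v, HasCoords (p t) v → HasCoords (f t) (G t v)) : Continuous f := by
  rw [continuous_iff_continuousAt]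
  intro t
  obtain ⟨σ, hσ, hσ'⟩ := exists_lift (p t)
  refine continuousAt_of_hasCoords (v := fun s => G s (σ (p s))) ?_ ?_
  · have : ContinuousAt (fun s => (s, σ (p s))) t :=
      continuousAt_id.prodMk (ContinuousAt.comp (f := p) hσ hp.continuousAt)
    exact ContinuousAt.comp (g := Function.uncurry G) hG.continuousAt this
  · filter_upwards [hp.continuousAt.eventually hσ'] with s hs
    exact h s _ hs

end CP

/-! ### Bihomogeneous polynomials -/

namespace MvPolynomial

variable {σ τ R : Type*} [CommRing R]

/-- Substituting weighted homogeneous polynomials into a weighted homogeneous polynomial. -/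
theorem IsWeightedHomogeneous.bind₁ {M N : Type*} [AddCommMonoid M] [AddCommMonoid N]
    {w : σ → M} {w' : τ → N} (φ : M →+ N) {G : σ → MvPolynomial τ R}
    (hG : ∀ i, IsWeightedHomogeneous w' (G i) (φ (w i))) {F : MvPolynomial σ R} {n : M}
    (hF : IsWeightedHomogeneous w F n) :
    IsWeightedHomogeneous w' (MvPolynomial.bind₁ G F) (φ n) := by
  rw [F.as_sum, map_sum]
  refine IsWeightedHomogeneous.sum _ _ _ fun d hd => ?_
  rw [bind₁_monomial]
  refine IsWeightedHomogeneous.C_mul ?_ _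
  have hw : Finsupp.weight w d = n := hF (mem_support_iff.1 hd)
  have : φ n = ∑ i ∈ d.support, d i • φ (w i) := by
    rw [← hw, Finsupp.weight_apply, Finsupp.sum, map_sum]
    simp
  rw [this]
  exact IsWeightedHomogeneous.prod _ _ _ fun i _ => (hG i).pow _

/-- The ring homomorphism `p ↦ ∑ pₖ tᵏ`, where `pₖ` is the weighted homogeneous component of
weight `k`. -/
noncomputable def gradingHom (w : σ → ℕ) : MvPolynomial σ R →ₐ[R] Polynomial (MvPolynomial σ R) :=
  aeval fun i => Polynomial.C (X i) * Polynomial.X ^ w i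

theorem gradingHom_monomial (w : σ → ℕ) (d : σ →₀ ℕ) (r : R) :
    gradingHom w (monomial d r) =
      Polynomial.C (monomial d r) * Polynomial.X ^ Finsupp.weight w d := by
  rw [gradingHom, aeval_monomial, monomial_eq, map_mul, Finsupp.weight_apply, Finsupp.prod,
    Finsupp.prod, Finsupp.sum, ← Finset.prod_pow_eq_pow_sum, map_prod, mul_assoc,
    ← Finset.prod_mul_distrib]
  congr 1
  refine Finset.prod_congr rfl fun i _ => ?_
  rw [mul_pow, map_pow, ← pow_mul, smul_eq_mul, mul_comm (w i)]

theorem gradingHom_coeff (w : σ → ℕ) (p : MvPolynomial σ R) (k : ℕ) (d : σ →₀ ℕ) :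
    ((gradingHom w p).coeff k).coeff d = if Finsupp.weight w d = k then p.coeff d else 0 := by
  classical
  induction p using MvPolynomial.induction_on' with
  | monomial e r =>
    rw [gradingHom_monomial, Polynomial.coeff_C_mul, Polynomial.coeff_X_pow]
    by_cases h : e = d
    · subst h
      by_cases h' : Finsupp.weight w e = k
      · simp [h']
      · simp [h', Ne.symm h']
    · split_ifs <;> simp [coeff_monomial, h]
  | add p q hp hq =>
    rw [map_add, Polynomial.coeff_add, coeff_add, hp, hq]
    split_ifs <;> simp

theorem isWeightedHomogeneous_iff_gradingHom {w : σ → ℕ} {p : MvPolynomial σ R} {n : ℕ} :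
    IsWeightedHomogeneous w p n ↔ gradingHom w p = Polynomial.C p * Polynomial.X ^ n := by
  constructor
  · intro h
    ext k d
    rw [gradingHom_coeff, Polynomial.coeff_C_mul, Polynomial.coeff_X_pow]
    by_cases hd : p.coeff d = 0
    · simp only [hd, ite_self]
      split_ifs <;> simp [hd]
    · rw [h hd]
      by_cases hk : n = k <;> simp [hk, eq_comm]
  · intro h d hd
    by_contra hne
    have := gradingHom_coeff w p (Finsupp.weight w d) d
    rw [h, Polynomial.coeff_C_mul, Polynomial.coeff_X_pow, if_neg hne] at this
    simp at this
    exact hd this.symm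

/-- Under `gradingHom` the product becomes a single power of t. Both the highest and the lowest
exponents of the factors add up to `n`, so in each factor they coincide. -/
theorem IsWeightedHomogeneous.exists_of_mul_left [IsDomain R] {w : σ → ℕ}
    {p q : MvPolynomial σ R} {n : ℕ} (h : IsWeightedHomogeneous w (p * q) n) (h0 : p * q ≠ 0) :
    ∃ k, IsWeightedHomogeneous w p k := by
  rw [isWeightedHomogeneous_iff_gradingHom, map_mul] at h
  have hpq : gradingHom w p * gradingHom w q ≠ 0 := by
    rw [h]
    exact mul_ne_zero (Polynomial.C_ne_zero.2 h0) (pow_ne_zero _ Polynomial.X_ne_zero)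
  have hp := left_ne_zero_of_mul hpq
  have hq := right_ne_zero_of_mul hpq
  have h1 := congrArg Polynomial.natDegree h
  rw [Polynomial.natDegree_mul hp hq, Polynomial.natDegree_C_mul_X_pow _ _ h0] at h1
  have h2 := congrArg Polynomial.natTrailingDegree h
  rw [Polynomial.natTrailingDegree_mul hp hq, Polynomial.natTrailingDegree_mul_X_pow
    (Polynomial.C_ne_zero.2 h0), Polynomial.natTrailingDegree_C, zero_add] at h2
  have h3 := (gradingHom w p).natTrailingDegree_le_natDegree
  have h4 := (gradingHom w q).natTrailingDegree_le_natDegree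
  refine ⟨(gradingHom w p).natDegree, fun {d} hd => ?_⟩
  have h5 := gradingHom_coeff w p (Finsupp.weight w d) d
  rw [if_pos rfl] at h5
  have h6 : (gradingHom w p).coeff (Finsupp.weight w d) ≠ 0 := by
    intro h0
    rw [h0, coeff_zero] at h5
    exact hd h5.symm
  have h7 := Polynomial.le_natDegree_of_ne_zero h6
  have h8 := Polynomial.natTrailingDegree_le_of_ne_zero h6
  omega

end MvPolynomial

/-! ### Bihomogeneous forms and their factors -/

section bidegree

open MvPolynomial

/-- The bigrading of the coordinate ring of `ℙᵃ × ℙᵇ`. -/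
abbrev biweight (a b : ℕ) : Fin (a + 1) ⊕ Fin (b + 1) → ℕ × ℕ :=
  Sum.elim (fun _ => (1, 0)) (fun _ => (0, 1))

theorem weight_biweight {a b : ℕ} (d : Fin (a + 1) ⊕ Fin (b + 1) →₀ ℕ) :
    Finsupp.weight (biweight a b) d = (∑ i, d (Sum.inl i), ∑ i, d (Sum.inr i)) := by
  rw [Finsupp.weight_apply, Finsupp.sum_fintype _ _ (by simp), Fintype.sum_sum_type]
  ext <;> simp [Prod.fst_sum, Prod.snd_sum]

theorem mem_bidegreeForms {a b : ℕ} {d : ℕ × ℕ} {F : MvPolynomial (Fin (a + 1) ⊕ Fin (b + 1)) ℂ} :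
    F ∈ bidegreeForms a b d ↔ IsWeightedHomogeneous (biweight a b) F d := Iff.rfl

/-- The grading by ℕ × ℕ splits into two gradings by ℕ, to which the degree argument with one
variable t applies. -/
theorem mem_bidegreeForms_iff {a b : ℕ} {d : ℕ × ℕ}
    {F : MvPolynomial (Fin (a + 1) ⊕ Fin (b + 1)) ℂ} :
    F ∈ bidegreeForms a b d ↔
      IsWeightedHomogeneous (Sum.elim (fun _ => 1) (fun _ => 0) : _ → ℕ) F d.1 ∧
      IsWeightedHomogeneous (Sum.elim (fun _ => 0) (fun _ => 1) : _ → ℕ) F d.2 := by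
  have h : ∀ e : Fin (a + 1) ⊕ Fin (b + 1) →₀ ℕ, Finsupp.weight (biweight a b) e =
      (Finsupp.weight (Sum.elim (fun _ => 1) (fun _ => 0) : _ → ℕ) e,
        Finsupp.weight (Sum.elim (fun _ => 0) (fun _ => 1) : _ → ℕ) e) := by
    intro e
    rw [weight_biweight, Finsupp.weight_apply, Finsupp.weight_apply,
      Finsupp.sum_fintype _ _ (by simp), Fintype.sum_sum_type, Finsupp.sum_fintype _ _ (by simp),
      Fintype.sum_sum_type]
    simp
  rw [mem_bidegreeForms]
  constructor
  · intro H
    exact ⟨fun {e} he => congrArg Prod.fst ((h e).symm.trans (H he)),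
      fun {e} he => congrArg Prod.snd ((h e).symm.trans (H he))⟩
  · rintro ⟨H1, H2⟩ e he
    rw [h e, H1 he, H2 he]

theorem eval_smul_bidegree {a b : ℕ} {d : ℕ × ℕ} {F : MvPolynomial (Fin (a + 1) ⊕ Fin (b + 1)) ℂ}
    (hF : F ∈ bidegreeForms a b d) (s t : ℂ) (u : Fin (a + 1) → ℂ) (w : Fin (b + 1) → ℂ) :
    eval (Sum.elim (s • u) (t • w)) F = s ^ d.1 * t ^ d.2 * eval (Sum.elim u w) F := by
  rw [eval_eq', eval_eq', Finset.mul_sum]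
  refine Finset.sum_congr rfl fun e he => ?_
  have hw := hF (mem_support_iff.1 he)
  rw [weight_biweight] at hw
  rw [← hw]
  simp only [Fintype.prod_sum_type, Sum.elim_inl, Sum.elim_inr, Pi.smul_apply, smul_eq_mul,
    mul_pow, Finset.prod_mul_distrib, Finset.prod_pow_eq_pow_sum]
  ring

theorem eval_smul_homogeneous {m d : ℕ} {F : MvPolynomial (Fin (m + 1)) ℂ}
    (hF : F.IsHomogeneous d) (s : ℂ) (u : Fin (m + 1) → ℂ) :
    eval (s • u) F = s ^ d * eval u F := by
  rw [eval_eq', eval_eq', Finset.mul_sum]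
  refine Finset.sum_congr rfl fun e he => ?_
  have hw := hF (mem_support_iff.1 he)
  rw [Finsupp.weight_apply, Finsupp.sum_fintype _ _ (by simp)] at hw
  rw [← hw]
  simp only [Pi.smul_apply, smul_eq_mul, mul_pow, Finset.prod_mul_distrib,
    Finset.prod_pow_eq_pow_sum, Pi.one_apply, mul_one]
  ring

/-- The values of a tuple of polynomials at a pair of vectors. -/
noncomputable def evalPair {a b k : ℕ} (F : Fin k → MvPolynomial (Fin (a + 1) ⊕ Fin (b + 1)) ℂ)
    (u : Fin (a + 1) → ℂ) (w : Fin (b + 1) → ℂ) : Fin k → ℂ :=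
  fun i => eval (Sum.elim u w) (F i)

theorem evalPair_smul {a b k : ℕ} {d : ℕ × ℕ}
    {F : Fin k → MvPolynomial (Fin (a + 1) ⊕ Fin (b + 1)) ℂ}
    (hF : ∀ i, F i ∈ bidegreeForms a b d) (s t : ℂ) (u : Fin (a + 1) → ℂ) (w : Fin (b + 1) → ℂ) :
    evalPair F (s • u) (t • w) = (s ^ d.1 * t ^ d.2) • evalPair F u w := by
  ext i
  exact eval_smul_bidegree (hF i) s t u w

theorem exists_evalAtProd {a b k : ℕ} {d : ℕ × ℕ}
    {F : Fin k → MvPolynomial (Fin (a + 1) ⊕ Fin (b + 1)) ℂ}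
    (hF : ∀ i, F i ∈ bidegreeForms a b d) {x : CP a × CP b} {u : Fin (a + 1) → ℂ}
    {w : Fin (b + 1) → ℂ} (hu : HasCoords x.1 u) (hw : HasCoords x.2 w) :
    ∃ c : ℂ, c ≠ 0 ∧ evalAtProd F x = c • evalPair F u w := by
  obtain ⟨s, hs, e⟩ := hu.exists_smul (HasCoords.rep _)
  obtain ⟨t, ht, e'⟩ := hw.exists_smul (HasCoords.rep _)
  refine ⟨s ^ d.1 * t ^ d.2, by simp [hs, ht], ?_⟩
  rw [← evalPair_smul hF, ← e, ← e']
  rfl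

theorem exists_bidegree_of_mul {a b : ℕ} {d : ℕ × ℕ}
    {p q : MvPolynomial (Fin (a + 1) ⊕ Fin (b + 1)) ℂ} (h0 : p * q ≠ 0)
    (h : p * q ∈ bidegreeForms a b d) :
    ∃ k l, p ∈ bidegreeForms a b k ∧ q ∈ bidegreeForms a b l ∧ k + l = d := by
  have h' := mem_bidegreeForms_iff.1 h
  obtain ⟨k₁, hk₁⟩ := h'.1.exists_of_mul_left h0
  obtain ⟨k₂, hk₂⟩ := h'.2.exists_of_mul_left h0
  rw [mul_comm] at h' h0
  obtain ⟨l₁, hl₁⟩ := h'.1.exists_of_mul_left h0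
  obtain ⟨l₂, hl₂⟩ := h'.2.exists_of_mul_left h0
  rw [mul_comm] at h0
  have hp : p ∈ bidegreeForms a b (k₁, k₂) := mem_bidegreeForms_iff.2 ⟨hk₁, hk₂⟩
  have hq : q ∈ bidegreeForms a b (l₁, l₂) := mem_bidegreeForms_iff.2 ⟨hl₁, hl₂⟩
  exact ⟨(k₁, k₂), (l₁, l₂), hp, hq,
    IsWeightedHomogeneous.inj_right h0 (IsWeightedHomogeneous.mul hp hq) h⟩

/-- Unique factorization removes the common factor. Factors of bihomogeneous forms are bihomogeneous
and bidegrees add, so both quotients have the same bidegree. -/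
theorem exists_reduced_pair {a b : ℕ} {d : ℕ × ℕ}
    {F₀ F₁ : MvPolynomial (Fin (a + 1) ⊕ Fin (b + 1)) ℂ}
    (h₀ : F₀ ∈ bidegreeForms a b d) (h₁ : F₁ ∈ bidegreeForms a b d) (hF : F₀ ≠ 0) :
    ∃ g G₀ G₁, ∃ e : ℕ × ℕ, F₀ = g * G₀ ∧ F₁ = g * G₁ ∧ IsRelPrime G₀ G₁ ∧
      G₀ ∈ bidegreeForms a b e ∧ G₁ ∈ bidegreeForms a b e := by
  obtain ⟨G₀, G₁, g, hr, rfl, rfl⟩ := UniqueFactorizationMonoid.exists_reduced_factors F₀ hF F₁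
  obtain ⟨k, l, hk, hl, e⟩ := exists_bidegree_of_mul hF h₀
  refine ⟨g, G₀, G₁, l, rfl, rfl, hr, hl, ?_⟩
  -- The zero form has every bidegree, so it needs no comparison.
  by_cases hG : G₁ = 0
  · rw [hG]; exact zero_mem _
  have hg : g ≠ 0 := left_ne_zero_of_mul hF
  obtain ⟨k', l', hk', hl', e'⟩ := exists_bidegree_of_mul (mul_ne_zero hg hG) h₁
  have := IsWeightedHomogeneous.inj_right hg hk hk'
  subst this
  have : l = l' := add_left_cancel (e.trans e'.symm)
  exact this ▸ hl'

end bidegree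

/-! ### Regular maps on products and their global representations -/

section regular

open MvPolynomial

/-- The composition of a regular map from a subset of `ℙᵃ × ℙᵇ` with a regular map. -/
theorem IsRegularMapProd.comp {a b k m : ℕ} {A : Set (CP a × CP b)} {B : Set (CP k)}
    {g : B → CP m} (hg : IsRegularMap B g) {f : A → B}
    (hf : IsRegularMapProd A (fun x => (f x).1)) : IsRegularMapProd A (fun x => g (f x)) := by
  intro x
  obtain ⟨d, F, hF, hFx, hFy⟩ := hf x
  obtain ⟨d', L, hL, hLx, hLy⟩ := hg (f x)
  obtain ⟨j, hj⟩ := Function.ne_iff.1 (f x).1.rep_nonzero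
  -- The extra factor `X j` raises the degree to at least one. Otherwise, for `d' = 0`, the
  -- composite could be nonzero at points where `F` vanishes and says nothing about `f`.
  have hL' : ∀ i, (X j * L i).IsHomogeneous (1 + d') := fun i => (isHomogeneous_X _ _).mul (hL i)
  have key : ∀ y : A, (fun i => eval (evalAtProd F y.1) (X j * L i)) =
      evalAtProd (fun i => bind₁ F (X j * L i)) y.1 := by
    intro y
    ext i
    simp only [evalAtProd, eval, eval₂Hom_bind₁]
    rfl
  refine ⟨(1 + d') • d, fun i => bind₁ F (X j * L i), fun i => ?_, ?_, fun y hy => ?_⟩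
  · refine IsWeightedHomogeneous.bind₁ (multiplesHom _ d) (fun l => ?_) (hL' i)
    have : multiplesHom (ℕ × ℕ) d 1 = d := by simp
    exact this.symm ▸ hF l
  · rw [← key]
    obtain ⟨c, hc, e⟩ := (hFy x hFx).exists_smul (HasCoords.rep _)
    obtain ⟨i, hi⟩ := Function.ne_iff.1 hLx
    refine Function.ne_iff.2 ⟨i, fun h0 => ?_⟩
    have := eval_smul_homogeneous (hL' i) c (evalAtProd F x.1)
    rw [← e, h0, Pi.zero_apply, mul_zero, map_mul, eval_X] at this
    exact mul_ne_zero hj hi this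
  · rw [← key] at hy ⊢
    have hFy0 : evalAtProd F y.1 ≠ 0 := by
      rintro h0
      apply hy
      ext i
      simp [h0]
    obtain ⟨c, hc, e⟩ := (hFy y hFy0).exists_smul (HasCoords.rep _)
    have h1 : ∀ i, (f y).1.rep j * evalAt L (f y).1 i =
        c ^ (1 + d') * eval (evalAtProd F y.1) (X j * L i) := by
      intro i
      rw [← eval_smul_homogeneous (hL' i), ← e, map_mul, eval_X]
      rfl
    have h2 : evalAt L (f y).1 ≠ 0 := by
      intro h0
      apply hy
      ext i
      have := h1 i
      rw [h0, Pi.zero_apply, mul_zero, eq_comm, mul_eq_zero] at this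
      exact this.resolve_left (pow_ne_zero _ hc)
    have h3 : (c ^ (1 + d')) • (fun i => eval (evalAtProd F y.1) (X j * L i)) =
        (f y).1.rep j • evalAt L (f y).1 := by
      ext i
      exact (h1 i).symm
    have h4 : (f y).1.rep j ≠ 0 := by
      intro h0
      rw [h0, zero_smul] at h3
      exact smul_ne_zero (pow_ne_zero _ hc) hy h3
    have h5 := (hLy (f y) h2).smul h4
    rw [← h3] at h5
    exact h5.of_smul

/-- Multiplication by one variable of each factor gives zero also when `u` or `w` vanishes, so the
product is the zero function. -/
theorem eq_zero_of_eval_eq_zero {a b : ℕ} {P : MvPolynomial (Fin (a + 1) ⊕ Fin (b + 1)) ℂ}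
    (h : ∀ u w, u ≠ 0 → w ≠ 0 → eval (Sum.elim u w) P = 0) : P = 0 := by
  have : X (Sum.inl 0) * (X (Sum.inr 0) * P) = 0 := by
    apply MvPolynomial.funext
    intro v
    simp only [map_mul, eval_X, map_zero]
    by_cases h1 : v (Sum.inl 0) = 0
    · simp [h1]
    by_cases h2 : v (Sum.inr 0) = 0
    · simp [h2]
    have := h (v ∘ Sum.inl) (v ∘ Sum.inr) (fun h0 => h1 (congrFun h0 0))
      (fun h0 => h2 (congrFun h0 0))
    rw [Sum.elim_comp_inl_inr] at this
    simp [this]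
  simpa [X_ne_zero] using this

/-- A regular map from `ℙᵃ × ℙᵇ` to `ℙ¹` is given globally by bihomogeneous forms. -/
theorem IsRegularMapProd.exists_global {a b : ℕ} {f : ↥(Set.univ : Set (CP a × CP b)) → CP 1}
    (hf : IsRegularMapProd Set.univ f) :
    ∃ (d : ℕ × ℕ) (F : Fin 2 → MvPolynomial (Fin (a + 1) ⊕ Fin (b + 1)) ℂ),
      (∀ i, F i ∈ bidegreeForms a b d) ∧ ∀ p q u w, HasCoords p u → HasCoords q w →
        HasCoords (f ⟨(p, q), trivial⟩) (evalPair F u w) := by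
  have nz : ∀ n, ∃ p : CP n, p = p := fun n =>
    ⟨Projectivization.mk ℂ (fun _ => 1) (Function.ne_iff.2 ⟨0, one_ne_zero⟩), rfl⟩
  obtain ⟨p₀, -⟩ := nz a
  obtain ⟨q₀, -⟩ := nz b
  obtain ⟨d, F, hF, hFx, hFy⟩ := hf ⟨(p₀, q₀), trivial⟩
  -- Any local representation, divided by its common factor, will turn out to be global.
  have hred : ∃ g, ∃ G : Fin 2 → MvPolynomial (Fin (a + 1) ⊕ Fin (b + 1)) ℂ, ∃ e, g ≠ 0 ∧
      (∀ i, F i = g * G i) ∧ IsRelPrime (G 0) (G 1) ∧ ∀ i, G i ∈ bidegreeForms a b e := by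
    by_cases h0 : F 0 = 0
    · have h1 : F 1 ≠ 0 := by
        intro h1
        apply hFx
        ext i
        fin_cases i <;> simp [evalAtProd, h0, h1]
      obtain ⟨g, G₁, G₀, e, e1, e0, hr, hG1, hG0⟩ := exists_reduced_pair (hF 1) (hF 0) h1
      refine ⟨g, ![G₀, G₁], e, ?_, ?_, hr.symm, ?_⟩
      · rintro rfl; exact h1 (by simpa using e1)
      · intro i; fin_cases i <;> assumption
      · intro i; fin_cases i <;> assumption
    · obtain ⟨g, G₀, G₁, e, e0, e1, hr, hG0, hG1⟩ := exists_reduced_pair (hF 0) (hF 1) h0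
      refine ⟨g, ![G₀, G₁], e, ?_, ?_, hr, ?_⟩
      · rintro rfl; exact h0 (by simpa using e0)
      · intro i; fin_cases i <;> assumption
      · intro i; fin_cases i <;> assumption
  obtain ⟨g, G, e, hg, hFG, hr, hG⟩ := hred
  refine ⟨e, G, hG, fun p q u w hu hw => ?_⟩
  obtain ⟨d', H, hH, hHx, hHy⟩ := hf ⟨(p, q), trivial⟩
  -- Two local representations are proportional where both are nonzero, and the cross product is
  -- trivially zero elsewhere.
  have cross : F 0 * H 1 - F 1 * H 0 = 0 := by
    refine eq_zero_of_eval_eq_zero fun u w hu hw => ?_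
    have hu' := HasCoords.mk hu
    have hw' := HasCoords.mk hw
    set x : CP a × CP b := (Projectivization.mk ℂ u hu, Projectivization.mk ℂ w hw) with hx
    obtain ⟨c, hc, e⟩ := exists_evalAtProd (x := x) hF hu' hw'
    obtain ⟨c', hc', e'⟩ := exists_evalAtProd (x := x) hH hu' hw'
    by_cases h0 : evalPair F u w = 0
    · have h0' := congrFun h0 0
      have h1' := congrFun h0 1
      simp only [evalPair, Pi.zero_apply] at h0' h1'
      simp [h0', h1']
    by_cases h1 : evalPair H u w = 0
    · have h0' := congrFun h1 0
      have h1' := congrFun h1 1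
      simp only [evalPair, Pi.zero_apply] at h0' h1'
      simp [h0', h1']
    have c1 := hFy ⟨x, trivial⟩ (by rw [e]; exact smul_ne_zero hc h0)
    have c2 := hHy ⟨x, trivial⟩ (by rw [e']; exact smul_ne_zero hc' h1)
    simp only [e, e'] at c1 c2
    obtain ⟨t, ht, e3⟩ := c1.of_smul.exists_smul c2.of_smul
    have h0' := congrFun e3 0
    have h1' := congrFun e3 1
    simp only [evalPair, Pi.smul_apply, smul_eq_mul] at h0' h1'
    simp only [map_sub, map_mul, h0', h1']
    ring
  have cross' : G 0 * H 1 = G 1 * H 0 := by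
    have : g * (G 0 * H 1 - G 1 * H 0) = 0 := by
      rw [← cross, hFG, hFG]; ring
    exact sub_eq_zero.1 ((mul_eq_zero.1 this).resolve_left hg)
  -- Since `G 0` and `G 1` are coprime, the cross relation makes `H` a polynomial multiple of `G`.
  -- As `H` does not vanish at the given point, neither does `G`, and both give the same point of
  -- ℙ¹.
  have hK : ∃ K, ∀ i, H i = K * G i := by
    obtain ⟨K, hK⟩ : G 0 ∣ H 0 := hr.dvd_of_dvd_mul_left ⟨H 1, cross'.symm⟩
    by_cases hG0 : G 0 = 0
    · have hu1 : IsUnit (G 1) := by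
        rw [hG0, isRelPrime_zero_left] at hr
        exact hr
      obtain ⟨K', hK'⟩ : G 1 ∣ H 1 := hu1.dvd
      refine ⟨K', fun i => ?_⟩
      fin_cases i
      · simp [hK, hG0]
      · simpa [mul_comm] using hK'
    · refine ⟨K, fun i => ?_⟩
      fin_cases i
      · simpa [mul_comm] using hK
      · have : G 0 * (H 1 - K * G 1) = 0 := by
          rw [mul_sub, cross', hK]; ring
        exact sub_eq_zero.1 ((mul_eq_zero.1 this).resolve_left hG0)
  obtain ⟨K, hK⟩ := hK
  obtain ⟨c', hc', e'⟩ := exists_evalAtProd (x := (p, q)) hH hu hw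
  have c2 := hHy ⟨(p, q), trivial⟩ hHx
  simp only [e'] at c2
  have e4 : evalPair H u w = eval (Sum.elim u w) K • evalPair G u w := by
    ext i
    simp [evalPair, hK]
  have c3 := c2.of_smul
  rw [e4] at c3
  exact c3.of_smul

/-- A homogeneous polynomial function of positive degree on `ℂ²` has a nontrivial zero. -/
theorem exists_zero_of_homogeneous {f : (Fin 2 → ℂ) → ℂ} (hc : Continuous f) {a : ℕ} (ha : a ≠ 0)
    (hf : ∀ (s : ℂ) u, f (s • u) = s ^ a * f u) (q : Polynomial ℂ)
    (hq : ∀ s, f ![s, 1] = q.eval s) : ∃ u, u ≠ 0 ∧ f u = 0 := by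
  by_contra! hne
  have h1 : ∀ s, q.eval s ≠ 0 := fun s => by
    rw [← hq]
    exact hne _ (Function.ne_iff.2 ⟨1, one_ne_zero⟩)
  have h2 : q.degree = 0 := by
    by_contra h
    obtain ⟨s, hs⟩ := IsAlgClosed.exists_root q h
    exact h1 s hs
  rw [Polynomial.eq_C_of_degree_eq_zero h2] at hq
  simp only [Polynomial.eval_C] at hq
  -- The dehomogenization has no zero, so it is constant. Homogeneity then determines `f` on the
  -- chart at infinity away from `t = 0`, and continuity forces the zero `![1, 0]`.
  have h3 : ∀ t : ℂ, t ≠ 0 → f ![1, t] = t ^ a * q.coeff 0 := by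
    intro t ht
    rw [← hq t⁻¹, ← hf]
    congr 1
    ext i
    fin_cases i <;> simp [ht]
  have h4 : Tendsto (fun t : ℂ => f ![1, t]) (𝓝[≠] 0) (𝓝 (f ![1, 0])) := by
    have : Continuous fun t : ℂ => f ![1, t] := by
      refine hc.comp (continuous_pi fun i => ?_)
      fin_cases i
      · exact continuous_const
      · exact continuous_id
    exact (this.tendsto 0).mono_left nhdsWithin_le_nhds
  have h5 : Tendsto (fun t : ℂ => t ^ a * q.coeff 0) (𝓝[≠] 0) (𝓝 0) := by
    have : Continuous fun t : ℂ => t ^ a * q.coeff 0 := by fun_prop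
    have := (this.tendsto 0).mono_left (nhdsWithin_le_nhds (s := {0}ᶜ))
    simpa [ha] using this
  have h6 := tendsto_nhds_unique h4 (h5.congr' ?_)
  · exact hne ![1, 0] (Function.ne_iff.2 ⟨0, one_ne_zero⟩) h6
  · filter_upwards [self_mem_nhdsWithin] with t ht
    exact (h3 t ht).symm

/-- A bihomogeneous form without zeros on `ℙ¹ × ℙ¹` is constant. -/
theorem bidegree_eq_zero {d : ℕ × ℕ} {K : MvPolynomial (Fin (1 + 1) ⊕ Fin (1 + 1)) ℂ}
    (hK : K ∈ bidegreeForms 1 1 d) (h : ∀ u w, u ≠ 0 → w ≠ 0 → eval (Sum.elim u w) K ≠ 0) :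
    d = 0 := by
  have h1 : (![1, 0] : Fin 2 → ℂ) ≠ 0 := Function.ne_iff.2 ⟨0, one_ne_zero⟩
  have hcK : Continuous fun v : Fin (1 + 1) ⊕ Fin (1 + 1) → ℂ => eval v K :=
    MvPolynomial.continuous_eval K
  ext
  · by_contra hd
    obtain ⟨u, hu, e⟩ := exists_zero_of_homogeneous (f := fun u => eval (Sum.elim u ![1, 0]) K)
      (hcK.comp (continuous_pi fun i => by rcases i with i | i <;> simp <;> fun_prop)) hd
      (fun s u => by simpa using eval_smul_bidegree hK s 1 u ![1, 0])
      (aeval (Sum.elim ![Polynomial.X, 1] ![1, 0]) K) (fun s => by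
        rw [← Polynomial.coe_aeval_eq_eval, ← AlgHom.comp_apply, comp_aeval, aeval_def,
          eval, coe_eval₂Hom]
        congr 1
        funext i
        rcases i with i | i <;> fin_cases i <;> simp)
    exact h _ _ hu h1 e
  · by_contra hd
    obtain ⟨u, hu, e⟩ := exists_zero_of_homogeneous (f := fun u => eval (Sum.elim ![1, 0] u) K)
      (hcK.comp (continuous_pi fun i => by rcases i with i | i <;> simp <;> fun_prop)) hd
      (fun s u => by simpa using eval_smul_bidegree hK 1 s ![1, 0] u)
      (aeval (Sum.elim ![1, 0] ![Polynomial.X, 1]) K) (fun s => by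
        rw [← Polynomial.coe_aeval_eq_eval, ← AlgHom.comp_apply, comp_aeval, aeval_def,
          eval, coe_eval₂Hom]
        congr 1
        funext i
        rcases i with i | i <;> fin_cases i <;> simp)
    exact h _ _ h1 hu e

end regular

/-! ### Automorphisms of ℙ¹ × ℙ¹ -/

section automorphisms

open MvPolynomial

theorem exists_eq_X_mul_of_cross {σ : Type*} {i j : σ} (hij : i ≠ j) {H₀ H₁ : MvPolynomial σ ℂ}
    (h : X i * H₁ = X j * H₀) : ∃ K, H₀ = X i * K ∧ H₁ = X j * K := by
  have : X i ∣ X j * H₀ := ⟨H₁, h.symm⟩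
  obtain ⟨K, rfl⟩ := (X_dvd_mul_iff.1 this).resolve_left fun h => hij (X_dvd_X.1 h)
  refine ⟨K, rfl, mul_left_cancel₀ (X_ne_zero i) ?_⟩
  rw [h]; ring

theorem exists_ne_zero_vec : (fun _ => 1 : Fin (1 + 1) → ℂ) ≠ 0 :=
  Function.ne_iff.2 ⟨0, one_ne_zero⟩

/-- If `H` represents a coordinate projection, then `H` equals `K` times the two coordinates. The
cofactor `K` has no zeros, hence has bidegree zero, and `H` has the bidegree of the coordinates. -/
theorem bidegree_of_cross {d e : ℕ × ℕ} {i j : Fin (1 + 1) ⊕ Fin (1 + 1)} (hij : i ≠ j)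
    (hi : X i ∈ bidegreeForms 1 1 e)
    {H : Fin 2 → MvPolynomial (Fin (1 + 1) ⊕ Fin (1 + 1)) ℂ}
    (hH : ∀ i, H i ∈ bidegreeForms 1 1 d) (h0 : ∀ u w, u ≠ 0 → w ≠ 0 → evalPair H u w ≠ 0)
    (h : ∀ u w, u ≠ 0 → w ≠ 0 → Sum.elim u w i * eval (Sum.elim u w) (H 1) =
      Sum.elim u w j * eval (Sum.elim u w) (H 0)) : d = e := by
  have hc : X i * H 1 = X j * H 0 := by
    rw [← sub_eq_zero]
    refine eq_zero_of_eval_eq_zero fun u w hu hw => ?_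
    have := h u w hu hw
    simp only [map_sub, map_mul, eval_X, sub_eq_zero]
    exact this
  obtain ⟨K, e0, e1⟩ := exists_eq_X_mul_of_cross hij hc
  have hK0 : ∀ u w, u ≠ 0 → w ≠ 0 → eval (Sum.elim u w) K ≠ 0 := by
    intro u w hu hw hK
    apply h0 u w hu hw
    ext l
    fin_cases l <;> simp [evalPair, e0, e1, hK]
  have hKne : K ≠ 0 := by
    rintro rfl
    exact hK0 _ _ exists_ne_zero_vec exists_ne_zero_vec (by simp)
  have hne : X i * K ≠ 0 := mul_ne_zero (X_ne_zero _) hKne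
  obtain ⟨k, l, hk, hl, hkl⟩ := exists_bidegree_of_mul hne (e0 ▸ hH 0)
  have hl0 := bidegree_eq_zero hl hK0
  have hk1 := IsWeightedHomogeneous.inj_right (X_ne_zero i) hk hi
  rw [← hkl, hl0, hk1, add_zero]

theorem exists_linear_of_bidegree_one_zero {F : MvPolynomial (Fin (1 + 1) ⊕ Fin (1 + 1)) ℂ}
    (hF : F ∈ bidegreeForms 1 1 (1, 0)) :
    ∃ a : Fin 2 → ℂ, ∀ u w, eval (Sum.elim u w) F = a ⬝ᵥ u := by
  -- A monomial of bidegree (1,0) is one variable of the first factor, so its exponent `d (Sum.inl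
  -- i)` is the indicator of that variable.
  refine ⟨fun i => ∑ d ∈ F.support, F.coeff d * d (Sum.inl i), fun u w => ?_⟩
  rw [eval_eq', dotProduct, Fin.sum_univ_two, Finset.sum_mul, Finset.sum_mul,
    ← Finset.sum_add_distrib]
  refine Finset.sum_congr rfl fun d hd => ?_
  have hw := hF (mem_support_iff.1 hd)
  rw [weight_biweight, Prod.mk.injEq, Fin.sum_univ_two, Fin.sum_univ_two] at hw
  have h1 : ∀ i, d (Sum.inr i) = 0 := fun i => by fin_cases i <;> simp <;> omega
  simp only [Fintype.prod_sum_type, Sum.elim_inl, Sum.elim_inr, h1, pow_zero,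
    Finset.prod_const_one, mul_one]
  rw [Fin.prod_univ_two]
  rcases Nat.eq_zero_or_pos (d (Sum.inl 0)) with h | h
  · have h3 : d (Sum.inl 1) = 1 := by omega
    simp [h, h3]
  · have h3 : d (Sum.inl 1) = 0 := by omega
    have h4 : d (Sum.inl 0) = 1 := by omega
    simp [h4, h3]

theorem exists_linear_of_bidegree_zero_one {F : MvPolynomial (Fin (1 + 1) ⊕ Fin (1 + 1)) ℂ}
    (hF : F ∈ bidegreeForms 1 1 (0, 1)) :
    ∃ a : Fin 2 → ℂ, ∀ u w, eval (Sum.elim u w) F = a ⬝ᵥ w := by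
  refine ⟨fun i => ∑ d ∈ F.support, F.coeff d * d (Sum.inr i), fun u w => ?_⟩
  rw [eval_eq', dotProduct, Fin.sum_univ_two, Finset.sum_mul, Finset.sum_mul,
    ← Finset.sum_add_distrib]
  refine Finset.sum_congr rfl fun d hd => ?_
  have hw := hF (mem_support_iff.1 hd)
  rw [weight_biweight, Prod.mk.injEq, Fin.sum_univ_two, Fin.sum_univ_two] at hw
  have h1 : ∀ i, d (Sum.inl i) = 0 := fun i => by fin_cases i <;> simp <;> omega
  simp only [Fintype.prod_sum_type, Sum.elim_inl, Sum.elim_inr, h1, pow_zero,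
    Finset.prod_const_one, one_mul]
  rw [Fin.prod_univ_two]
  rcases Nat.eq_zero_or_pos (d (Sum.inr 0)) with h | h
  · have h3 : d (Sum.inr 1) = 1 := by omega
    simp [h, h3]
  · have h3 : d (Sum.inr 1) = 0 := by omega
    have h4 : d (Sum.inr 0) = 1 := by omega
    simp [h4, h3]

theorem exists_matrix_of_bidegree_one_zero
    {F : Fin 2 → MvPolynomial (Fin (1 + 1) ⊕ Fin (1 + 1)) ℂ}
    (hF : ∀ i, F i ∈ bidegreeForms 1 1 (1, 0)) :
    ∃ g : Matrix (Fin 2) (Fin 2) ℂ, ∀ u w, evalPair F u w = g.mulVec u := by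
  choose a ha using fun i => exists_linear_of_bidegree_one_zero (hF i)
  exact ⟨Matrix.of a, fun u w => funext fun i => ha i u w⟩

theorem exists_matrix_of_bidegree_zero_one
    {F : Fin 2 → MvPolynomial (Fin (1 + 1) ⊕ Fin (1 + 1)) ℂ}
    (hF : ∀ i, F i ∈ bidegreeForms 1 1 (0, 1)) :
    ∃ g : Matrix (Fin 2) (Fin 2) ℂ, ∀ u w, evalPair F u w = g.mulVec w := by
  choose a ha using fun i => exists_linear_of_bidegree_zero_one (hF i)
  exact ⟨Matrix.of a, fun u w => funext fun i => ha i u w⟩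

/-- A global bihomogeneous representation of a map `ℙ¹ × ℙ¹ → ℙ¹`. -/
def IsGlobalRep (f : CP 1 × CP 1 → CP 1) (d : ℕ × ℕ)
    (F : Fin 2 → MvPolynomial (Fin (1 + 1) ⊕ Fin (1 + 1)) ℂ) : Prop :=
  (∀ i, F i ∈ bidegreeForms 1 1 d) ∧ ∀ p q u w, HasCoords p u → HasCoords q w →
    HasCoords (f (p, q)) (evalPair F u w)

theorem IsGlobalRep.ne_zero {f : CP 1 × CP 1 → CP 1} {d : ℕ × ℕ}
    {F : Fin 2 → MvPolynomial (Fin (1 + 1) ⊕ Fin (1 + 1)) ℂ} (h : IsGlobalRep f d F)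
    {u w : Fin 2 → ℂ} (hu : u ≠ 0) (hw : w ≠ 0) : evalPair F u w ≠ 0 :=
  (h.2 _ _ u w (HasCoords.mk hu) (HasCoords.mk hw)).ne_zero

/-- Under substitution bidegrees transform linearly. Composition of maps of ℙ¹ × ℙ¹ therefore
multiplies the 2 × 2 matrices of bidegrees. -/
theorem IsGlobalRep.comp {f₁ f₂ g : CP 1 × CP 1 → CP 1} {d₁ d₂ e : ℕ × ℕ}
    {F₁ F₂ G : Fin 2 → MvPolynomial (Fin (1 + 1) ⊕ Fin (1 + 1)) ℂ} (h₁ : IsGlobalRep f₁ d₁ F₁)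
    (h₂ : IsGlobalRep f₂ d₂ F₂) (h : IsGlobalRep g e G) :
    IsGlobalRep (fun x => g (f₁ x, f₂ x)) (e.1 • d₁ + e.2 • d₂)
      (fun i => bind₁ (Sum.elim F₁ F₂) (G i)) := by
  constructor
  · intro i
    let φ : ℕ × ℕ →+ ℕ × ℕ := (multiplesHom _ d₁).coprod (multiplesHom _ d₂)
    have h3 : φ e = e.1 • d₁ + e.2 • d₂ := by simp [φ]
    rw [← h3]
    refine IsWeightedHomogeneous.bind₁ φ (fun l => ?_) (h.1 i)
    rcases l with l | l
    · have : φ (1, 0) = d₁ := by simp [φ]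
      exact this.symm ▸ h₁.1 l
    · have : φ (0, 1) = d₂ := by simp [φ]
      exact this.symm ▸ h₂.1 l
  · intro p q u w hu hw
    have := h.2 _ _ _ _ (h₁.2 _ _ _ _ hu hw) (h₂.2 _ _ _ _ hu hw)
    convert this using 1
    ext i
    simp only [evalPair, eval, eval₂Hom_bind₁]
    congr 2
    ext l
    rcases l with l | l <;> rfl

theorem IsGlobalRep.degree_fst {d : ℕ × ℕ} {f : CP 1 × CP 1 → CP 1}
    {F : Fin 2 → MvPolynomial (Fin (1 + 1) ⊕ Fin (1 + 1)) ℂ} (h : IsGlobalRep f d F)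
    (hf : ∀ x, f x = x.1) : d = (1, 0) := by
  refine bidegree_of_cross (i := Sum.inl 0) (j := Sum.inl 1) (by simp)
    (isWeightedHomogeneous_X _ _ _) h.1 (fun u w => h.ne_zero) fun u w hu hw => ?_
  have h1 := h.2 _ _ u w (HasCoords.mk hu) (HasCoords.mk hw)
  rw [hf] at h1
  obtain ⟨c, hc, e⟩ := (HasCoords.mk hu).exists_smul h1
  have e0 := congrFun e 0
  have e1 := congrFun e 1
  simp only [evalPair, Pi.smul_apply, smul_eq_mul] at e0 e1
  simp only [e0, e1, Sum.elim_inl]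
  ring

theorem IsGlobalRep.degree_snd {d : ℕ × ℕ} {f : CP 1 × CP 1 → CP 1}
    {F : Fin 2 → MvPolynomial (Fin (1 + 1) ⊕ Fin (1 + 1)) ℂ} (h : IsGlobalRep f d F)
    (hf : ∀ x, f x = x.2) : d = (0, 1) := by
  refine bidegree_of_cross (i := Sum.inr 0) (j := Sum.inr 1) (by simp)
    (isWeightedHomogeneous_X _ _ _) h.1 (fun u w => h.ne_zero) fun u w hu hw => ?_
  have h1 := h.2 _ _ u w (HasCoords.mk hu) (HasCoords.mk hw)
  rw [hf] at h1
  obtain ⟨c, hc, e⟩ := (HasCoords.mk hw).exists_smul h1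
  have e0 := congrFun e 0
  have e1 := congrFun e 1
  simp only [evalPair, Pi.smul_apply, smul_eq_mul] at e0 e1
  simp only [e0, e1, Sum.elim_inr]
  ring

/-- A matrix of natural numbers with a left inverse of the same kind is a permutation matrix: no
cancellation is possible, so every summand is 0 or 1. -/
theorem permutation_of_mul_eq_one {a b c d a' b' c' d' : ℕ}
    (h1 : a' * a + b' * c = 1) (h2 : a' * b + b' * d = 0) (h3 : c' * a + d' * c = 0)
    (h4 : c' * b + d' * d = 1) :
    (a = 1 ∧ b = 0 ∧ c = 0 ∧ d = 1) ∨ (a = 0 ∧ b = 1 ∧ c = 1 ∧ d = 0) := by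
  rcases Nat.add_eq_one_iff.1 h1 with ⟨h, h'⟩ | ⟨h, h'⟩ <;>
  rcases Nat.add_eq_one_iff.1 h4 with ⟨k, k'⟩ | ⟨k, k'⟩ <;>
  obtain ⟨p, q⟩ := Nat.add_eq_zero_iff.1 h2 <;>
  obtain ⟨p', q'⟩ := Nat.add_eq_zero_iff.1 h3 <;>
  simp_all [mul_eq_one]

/-- The biregular automorphisms of `ℙ¹ × ℙ¹` are the products of two projective transformations,
possibly composed with the exchange of the factors. -/
theorem exists_matrices_of_inverse {f₁ f₂ g₁ g₂ : CP 1 × CP 1 → CP 1}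
    (hf₁ : ∃ d F, IsGlobalRep f₁ d F) (hf₂ : ∃ d F, IsGlobalRep f₂ d F)
    (hg₁ : ∃ d F, IsGlobalRep g₁ d F) (hg₂ : ∃ d F, IsGlobalRep g₂ d F)
    (h₁ : ∀ x, g₁ (f₁ x, f₂ x) = x.1) (h₂ : ∀ x, g₂ (f₁ x, f₂ x) = x.2) :
    ∃ a b : Matrix (Fin 2) (Fin 2) ℂ,
      (∀ p q u w, HasCoords p u → HasCoords q w →
        HasCoords (f₁ (p, q)) (a.mulVec u) ∧ HasCoords (f₂ (p, q)) (b.mulVec w)) ∨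
      (∀ p q u w, HasCoords p u → HasCoords q w →
        HasCoords (f₁ (p, q)) (a.mulVec w) ∧ HasCoords (f₂ (p, q)) (b.mulVec u)) := by
  obtain ⟨d₁, F₁, hF₁⟩ := hf₁
  obtain ⟨d₂, F₂, hF₂⟩ := hf₂
  obtain ⟨e₁, G₁, hG₁⟩ := hg₁
  obtain ⟨e₂, G₂, hG₂⟩ := hg₂
  have k1 := (hF₁.comp hF₂ hG₁).degree_fst h₁
  have k2 := (hF₁.comp hF₂ hG₂).degree_snd h₂
  obtain ⟨a, b⟩ := d₁
  obtain ⟨c, d⟩ := d₂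
  simp only [Prod.smul_mk, Prod.mk_add_mk, Prod.mk.injEq, smul_eq_mul] at k1 k2
  rcases permutation_of_mul_eq_one k1.1 k1.2 k2.1 k2.2 with ⟨rfl, rfl, rfl, rfl⟩ |
    ⟨rfl, rfl, rfl, rfl⟩
  · obtain ⟨g, hg⟩ := exists_matrix_of_bidegree_one_zero hF₁.1
    obtain ⟨h, hh⟩ := exists_matrix_of_bidegree_zero_one hF₂.1
    refine ⟨g, h, Or.inl fun p q u w hu hw => ⟨?_, ?_⟩⟩
    · rw [← hg u w]; exact hF₁.2 _ _ _ _ hu hw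
    · rw [← hh u w]; exact hF₂.2 _ _ _ _ hu hw
  · obtain ⟨g, hg⟩ := exists_matrix_of_bidegree_zero_one hF₁.1
    obtain ⟨h, hh⟩ := exists_matrix_of_bidegree_one_zero hF₂.1
    refine ⟨g, h, Or.inr fun p q u w hu hw => ⟨?_, ?_⟩⟩
    · rw [← hg u w]; exact hF₁.2 _ _ _ _ hu hw
    · rw [← hh u w]; exact hF₂.2 _ _ _ _ hu hw

end automorphisms

/-! ### The double Segre embedding -/

/-- The ring of complex `3 × 3` matrices, the ambient space of the double Segre surface. -/
abbrev Mat3 : Type := Matrix (Fin 3) (Fin 3) ℂ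

/-- The parametrization of the conic `-y₀² + y₁² + y₂² = 0`. -/
def conicVec (u : Fin 2 → ℂ) : Fin 3 → ℂ :=
  ![u 0 ^ 2 + u 1 ^ 2, u 0 ^ 2 - u 1 ^ 2, 2 * u 0 * u 1]

/-- The action of `2 × 2` matrices on the plane of the conic. -/
noncomputable def sym2 (g : Matrix (Fin 2) (Fin 2) ℂ) : Mat3 :=
  !![(g 0 0 ^ 2 + g 1 0 ^ 2 + g 0 1 ^ 2 + g 1 1 ^ 2) / 2,
      (g 0 0 ^ 2 + g 1 0 ^ 2 - g 0 1 ^ 2 - g 1 1 ^ 2) / 2, g 0 0 * g 0 1 + g 1 0 * g 1 1;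
    (g 0 0 ^ 2 - g 1 0 ^ 2 + g 0 1 ^ 2 - g 1 1 ^ 2) / 2,
      (g 0 0 ^ 2 - g 1 0 ^ 2 - g 0 1 ^ 2 + g 1 1 ^ 2) / 2, g 0 0 * g 0 1 - g 1 0 * g 1 1;
    g 0 0 * g 1 0 + g 0 1 * g 1 1, g 0 0 * g 1 0 - g 0 1 * g 1 1,
      g 0 0 * g 1 1 + g 0 1 * g 1 0]

/-- The signs of the quadratic form `-y₀² + y₁² + y₂²`. -/
def conicSign : Fin 3 → ℂ := ![-1, 1, 1]

theorem sym2_mulVec (g : Matrix (Fin 2) (Fin 2) ℂ) (u : Fin 2 → ℂ) :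
    (sym2 g).mulVec (conicVec u) = conicVec (g.mulVec u) := by
  ext i
  fin_cases i <;>
  simp [sym2, conicVec, Matrix.mulVec, dotProduct, Fin.sum_univ_three, Fin.sum_univ_two] <;> ring

theorem sym2_mul (g h : Matrix (Fin 2) (Fin 2) ℂ) : sym2 (g * h) = sym2 g * sym2 h := by
  ext i j
  fin_cases i <;> fin_cases j <;>
  simp [sym2, Matrix.mul_apply, Fin.sum_univ_three, Fin.sum_univ_two] <;> ring

@[simp]
theorem sym2_one : sym2 1 = 1 := by
  ext i j
  fin_cases i <;> fin_cases j <;> simp [sym2]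

theorem sym2_map_star (g : Matrix (Fin 2) (Fin 2) ℂ) :
    sym2 (g.map (starRingEnd ℂ)) = (sym2 g).map (starRingEnd ℂ) := by
  ext i j
  fin_cases i <;> fin_cases j <;> simp [sym2, map_ofNat]

/-- In terms of u₀², u₁² and 2u₀u₁ the form `-y₀² + y₁² + y₂²` is a discriminant, which a
substitution multiplies by the square of its determinant. -/
theorem sym2_form (g : Matrix (Fin 2) (Fin 2) ℂ) :
    (sym2 g).transpose * Matrix.diagonal conicSign * sym2 g =
      g.det ^ 2 • Matrix.diagonal conicSign := by
  ext i j
  fin_cases i <;> fin_cases j <;>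
  simp [sym2, conicSign, Matrix.mul_apply, Fin.sum_univ_three, Matrix.det_fin_two,
    Matrix.diagonal_apply] <;> ring

theorem conicVec_smul (c : ℂ) (u : Fin 2 → ℂ) : conicVec (c • u) = c ^ 2 • conicVec u := by
  ext i
  fin_cases i <;> simp [conicVec] <;> ring

theorem conicVec_star (u : Fin 2 → ℂ) : conicVec (star u) = star (conicVec u) := by
  ext i
  fin_cases i <;> simp [conicVec]

theorem conicVec_ne_zero {u : Fin 2 → ℂ} (hu : u ≠ 0) : conicVec u ≠ 0 := by
  intro h
  apply hu
  have h0 := congrFun h 0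
  have h1 := congrFun h 1
  simp only [conicVec, Matrix.cons_val_zero, Matrix.cons_val_one, Pi.zero_apply] at h0 h1
  have k0 : u 0 ^ 2 = 0 := by linear_combination (h0 + h1) / 2
  have k1 : u 1 ^ 2 = 0 := by linear_combination (h0 - h1) / 2
  ext i
  fin_cases i
  · simpa using k0
  · simpa using k1

/-- The conic coordinates determine all products of the coordinates of `u'` up to `c`; these make
the square of the determinant of `u'` and `u` zero. -/
theorem exists_smul_of_conicVec_eq {u u' : Fin 2 → ℂ} (hu : u ≠ 0) {c : ℂ}
    (h : conicVec u' = c • conicVec u) : ∃ s : ℂ, u' = s • u := by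
  have h0 := congrFun h 0
  have h1 := congrFun h 1
  have h2 := congrFun h 2
  simp only [conicVec, Matrix.cons_val_zero, Matrix.cons_val_one, Matrix.cons_val_two,
    Pi.smul_apply, smul_eq_mul, Matrix.tail_cons, Matrix.head_cons] at h0 h1 h2
  have k0 : u' 0 ^ 2 = c * u 0 ^ 2 := by linear_combination (h0 + h1) / 2
  have k1 : u' 1 ^ 2 = c * u 1 ^ 2 := by linear_combination (h0 - h1) / 2
  have k2 : u' 0 * u' 1 = c * (u 0 * u 1) := by linear_combination h2 / 2
  have hx : (u' 0 * u 1 - u' 1 * u 0) ^ 2 = 0 := by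
    linear_combination (u 1) ^ 2 * k0 + (u 0) ^ 2 * k1 - 2 * u 0 * u 1 * k2
  have hx' : u' 0 * u 1 = u' 1 * u 0 := sub_eq_zero.1 (pow_eq_zero_iff two_ne_zero |>.1 hx)
  by_cases hu0 : u 0 = 0
  · have hu1 : u 1 ≠ 0 := by
      intro hu1
      apply hu
      ext i
      fin_cases i <;> assumption
    refine ⟨u' 1 / u 1, ?_⟩
    ext i
    fin_cases i
    · simp [hu0, hu1] at hx' ⊢
      exact hx'
    · simp [hu1]
  · refine ⟨u' 0 / u 0, ?_⟩
    ext i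
    fin_cases i
    · simp [hu0]
    · simp only [Fin.mk_one, Pi.smul_apply, smul_eq_mul]
      field_simp
      linear_combination -hx'

/-- The double Segre embedding of `ℙ¹ × ℙ¹`. -/
def segre (u w : Fin 2 → ℂ) : Mat3 := Matrix.vecMulVec (conicVec u) (conicVec w)

theorem segre_apply (u w : Fin 2 → ℂ) (i j : Fin 3) :
    segre u w i j = conicVec u i * conicVec w j := rfl

theorem segre_smul (s t : ℂ) (u w : Fin 2 → ℂ) :
    segre (s • u) (t • w) = (s ^ 2 * t ^ 2) • segre u w := by
  ext i j
  simp only [segre_apply, conicVec_smul, Matrix.smul_apply, Pi.smul_apply, smul_eq_mul]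
  ring

theorem segre_transpose (u w : Fin 2 → ℂ) : (segre u w).transpose = segre w u := by
  ext i j
  simp only [segre_apply, Matrix.transpose_apply]
  ring

theorem segre_star (u w : Fin 2 → ℂ) : (segre u w).map (starRingEnd ℂ) = segre (star u) (star w) := by
  ext i j
  simp [segre_apply, conicVec_star]

theorem segre_ne_zero {u w : Fin 2 → ℂ} (hu : u ≠ 0) (hw : w ≠ 0) : segre u w ≠ 0 := by
  obtain ⟨i, hi⟩ := Function.ne_iff.1 (conicVec_ne_zero hu)
  obtain ⟨j, hj⟩ := Function.ne_iff.1 (conicVec_ne_zero hw)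
  intro h
  have := congrFun (congrFun h i) j
  rw [segre_apply] at this
  exact mul_ne_zero hi hj this

theorem exists_smul_of_segre_eq {u u' w w' : Fin 2 → ℂ} (hu : u ≠ 0) (hw : w ≠ 0)
    (hu' : u' ≠ 0) (hw' : w' ≠ 0) {c : ℂ} (h : segre u' w' = c • segre u w) :
    (∃ s : ℂ, u' = s • u) ∧ ∃ s : ℂ, w' = s • w := by
  obtain ⟨i, hi⟩ := Function.ne_iff.1 (conicVec_ne_zero hu')
  obtain ⟨j, hj⟩ := Function.ne_iff.1 (conicVec_ne_zero hw')
  have h' : ∀ k l, conicVec u' k * conicVec w' l = c * (conicVec u k * conicVec w l) :=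
    fun k l => congrFun (congrFun h k) l
  rw [Pi.zero_apply] at hi hj
  constructor
  · refine exists_smul_of_conicVec_eq (c := c * conicVec w j / conicVec w' j) hu ?_
    ext k
    simp only [Pi.smul_apply, smul_eq_mul]
    field_simp
    linear_combination h' k j
  · refine exists_smul_of_conicVec_eq (c := c * conicVec u i / conicVec u' i) hw ?_
    ext k
    simp only [Pi.smul_apply, smul_eq_mul]
    field_simp
    linear_combination h' i k

/-- The linear map `Y ↦ S Y Tᵀ`. -/
def sandwich (S T : Mat3) : Mat3 →ₗ[ℂ] Mat3 where
  toFun Y := S * Y * T.transpose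
  map_add' Y Z := by rw [mul_add, add_mul]
  map_smul' c Y := by simp

theorem sandwich_apply (S T Y : Mat3) : sandwich S T Y = S * Y * T.transpose := rfl

theorem sandwich_sandwich (S T S' T' Y : Mat3) :
    sandwich S T (sandwich S' T' Y) = sandwich (S * S') (T * T') Y := by
  simp only [sandwich_apply, Matrix.transpose_mul, mul_assoc]

theorem sandwich_one (Y : Mat3) : sandwich 1 1 Y = Y := by simp [sandwich_apply]

theorem sandwich_vecMulVec (S T : Mat3) (a b : Fin 3 → ℂ) :
    sandwich S T (Matrix.vecMulVec a b) = Matrix.vecMulVec (S.mulVec a) (T.mulVec b) := by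
  rw [sandwich_apply, Matrix.mul_vecMulVec, Matrix.vecMulVec_mul, Matrix.vecMul_transpose]

theorem sandwich_transpose (S T Y : Mat3) :
    (sandwich S T Y).transpose = sandwich T S Y.transpose := by
  simp only [sandwich_apply, Matrix.transpose_mul, Matrix.transpose_transpose, mul_assoc]

theorem sandwich_map_star (S T Y : Mat3) : (sandwich S T Y).map (starRingEnd ℂ) =
    sandwich (S.map (starRingEnd ℂ)) (T.map (starRingEnd ℂ)) (Y.map (starRingEnd ℂ)) := by
  simp only [sandwich_apply, Matrix.map_mul, Matrix.transpose_map]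

/-- The invertible map `Y ↦ S Y Tᵀ`. -/
noncomputable def sandwichEquiv {S T : Mat3} (hS : IsUnit S.det) (hT : IsUnit T.det) :
    Mat3 ≃ₗ[ℂ] Mat3 :=
  LinearEquiv.ofLinearMap (sandwich S T) (sandwich S⁻¹ T⁻¹)
    (LinearMap.ext fun Y => by
      rw [LinearMap.comp_apply, sandwich_sandwich, Matrix.mul_nonsing_inv _ hS,
        Matrix.mul_nonsing_inv _ hT, sandwich_one, LinearMap.id_apply])
    (LinearMap.ext fun Y => by
      rw [LinearMap.comp_apply, sandwich_sandwich, Matrix.nonsing_inv_mul _ hS,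
        Matrix.nonsing_inv_mul _ hT, sandwich_one, LinearMap.id_apply])

@[simp]
theorem sandwichEquiv_apply {S T : Mat3} (hS : IsUnit S.det) (hT : IsUnit T.det) (Y : Mat3) :
    sandwichEquiv hS hT Y = sandwich S T Y := rfl

/-- The action of pairs of `2 × 2` matrices on the ambient space of the double Segre surface. -/
noncomputable def segreAct (g h : Matrix (Fin 2) (Fin 2) ℂ) : Mat3 →ₗ[ℂ] Mat3 :=
  sandwich (sym2 g) (sym2 h)

theorem segreAct_segre (g h : Matrix (Fin 2) (Fin 2) ℂ) (u w : Fin 2 → ℂ) :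
    segreAct g h (segre u w) = segre (g.mulVec u) (h.mulVec w) := by
  rw [segreAct, segre, sandwich_vecMulVec, sym2_mulVec, sym2_mulVec, segre]

theorem segreAct_segreAct (g h g' h' : Matrix (Fin 2) (Fin 2) ℂ) (Y : Mat3) :
    segreAct g h (segreAct g' h' Y) = segreAct (g * g') (h * h') Y := by
  rw [segreAct, segreAct, sandwich_sandwich, ← sym2_mul, ← sym2_mul, segreAct]

@[simp]
theorem segreAct_one (Y : Mat3) : segreAct 1 1 Y = Y := by
  rw [segreAct, sym2_one, sandwich_one]

theorem segreAct_transpose (g h : Matrix (Fin 2) (Fin 2) ℂ) (Y : Mat3) :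
    (segreAct g h Y).transpose = segreAct h g Y.transpose :=
  sandwich_transpose _ _ _

theorem segreAct_map_star (g h : Matrix (Fin 2) (Fin 2) ℂ) (Y : Mat3) :
    (segreAct g h Y).map (starRingEnd ℂ) =
      segreAct (g.map (starRingEnd ℂ)) (h.map (starRingEnd ℂ)) (Y.map (starRingEnd ℂ)) := by
  rw [segreAct, segreAct, sandwich_map_star, sym2_map_star, sym2_map_star]

theorem sym2_inv_mul {g : Matrix (Fin 2) (Fin 2) ℂ} (hg : IsUnit g.det) :
    IsUnit (sym2 g).det := by
  rw [← Matrix.isUnit_iff_isUnit_det]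
  refine ⟨⟨sym2 g, sym2 g⁻¹, ?_, ?_⟩, rfl⟩
  · rw [← sym2_mul, Matrix.mul_nonsing_inv _ hg, sym2_one]
  · rw [← sym2_mul, Matrix.nonsing_inv_mul _ hg, sym2_one]

/-- The action of a pair of invertible matrices. -/
noncomputable def segreActEquiv {g h : Matrix (Fin 2) (Fin 2) ℂ} (hg : IsUnit g.det)
    (hh : IsUnit h.det) : Mat3 ≃ₗ[ℂ] Mat3 :=
  sandwichEquiv (sym2_inv_mul hg) (sym2_inv_mul hh)

@[simp]
theorem segreActEquiv_apply {g h : Matrix (Fin 2) (Fin 2) ℂ} (hg : IsUnit g.det)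
    (hh : IsUnit h.det) (Y : Mat3) : segreActEquiv hg hh Y = segreAct g h Y := rfl

/-! ### The invariant form -/

/-- The invariant bilinear form of the double Segre surface. -/
def segreForm (Y Z : Mat3) : ℂ := ∑ i, ∑ j, conicSign i * conicSign j * (Y i j * Z i j)

theorem segreForm_eq_trace (Y Z : Mat3) : segreForm Y Z = Matrix.trace
    (Y.transpose * Matrix.diagonal conicSign * Z * Matrix.diagonal conicSign) := by
  simp only [segreForm, Matrix.trace, Matrix.diag, Matrix.mul_diagonal,
    Matrix.mul_apply (M := Y.transpose * Matrix.diagonal conicSign) (N := Z)]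
  rw [Finset.sum_comm]
  refine Finset.sum_congr rfl fun i _ => ?_
  rw [Finset.sum_mul]
  refine Finset.sum_congr rfl fun j _ => ?_
  rw [Matrix.transpose_apply]
  ring

/-- Written as a trace, the form lets `sym2_form` act on the left factor directly and on the right
factor after a cyclic permutation. -/
theorem segreForm_segreAct (g h : Matrix (Fin 2) (Fin 2) ℂ) (Y Z : Mat3) :
    segreForm (segreAct g h Y) (segreAct g h Z) =
      (g.det ^ 2 * h.det ^ 2) * segreForm Y Z := by
  rw [segreForm_eq_trace, segreForm_eq_trace, segreAct, sandwich_apply, sandwich_apply]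
  simp only [Matrix.transpose_mul, Matrix.transpose_transpose]
  have e : sym2 h * (Y.transpose * (sym2 g).transpose) * Matrix.diagonal conicSign *
      (sym2 g * Z * (sym2 h).transpose) * Matrix.diagonal conicSign =
      sym2 h * (Y.transpose * ((sym2 g).transpose * Matrix.diagonal conicSign * sym2 g) * Z *
        (sym2 h).transpose * Matrix.diagonal conicSign) := by
    simp only [mul_assoc]
  rw [e, sym2_form, Matrix.trace_mul_comm]
  have e' : Y.transpose * (g.det ^ 2 • Matrix.diagonal conicSign) * Z *
        (sym2 h).transpose * Matrix.diagonal conicSign * sym2 h =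
      g.det ^ 2 • (Y.transpose * Matrix.diagonal conicSign * Z *
        ((sym2 h).transpose * Matrix.diagonal conicSign * sym2 h)) := by
    simp only [mul_assoc, Matrix.mul_smul, Matrix.smul_mul]
  rw [e', sym2_form, Matrix.mul_smul, smul_smul, Matrix.trace_smul, smul_eq_mul]

theorem segreForm_transpose (Y Z : Mat3) :
    segreForm Y.transpose Z.transpose = segreForm Y Z := by
  simp only [segreForm, Matrix.transpose_apply]
  rw [Finset.sum_comm]
  refine Finset.sum_congr rfl fun i _ => Finset.sum_congr rfl fun j _ => ?_
  ring

/-- On a rank one matrix the form is a product of two values of the equation of the conic, both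
zero. -/
theorem segreForm_segre (u w : Fin 2 → ℂ) : segreForm (segre u w) (segre u w) = 0 := by
  have : ∀ i j, conicSign i * conicSign j * (segre u w i j * segre u w i j) =
      (conicSign i * conicVec u i ^ 2) * (conicSign j * conicVec w j ^ 2) := by
    intro i j
    rw [segre_apply]
    ring
  simp only [segreForm, this, ← Finset.mul_sum, ← Finset.sum_mul]
  have h : ∑ i, conicSign i * conicVec u i ^ 2 = 0 := by
    simp [Fin.sum_univ_three, conicSign, conicVec]
    ring
  rw [h, zero_mul]

/-! ### Linear maps and the double Segre surface -/

/-- The matrix whose columns are three points of the conic. -/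
def conicFrame : Mat3 := !![1, 1, 2; 1, -1, 0; 0, 0, 2]

/-- Three points of the projective line. -/
def lineFrame : Fin 3 → Fin 2 → ℂ := ![![1, 0], ![0, 1], ![1, 1]]

theorem lineFrame_ne_zero (i : Fin 3) : lineFrame i ≠ 0 := by
  fin_cases i
  · exact Function.ne_iff.2 ⟨0, one_ne_zero⟩
  · exact Function.ne_iff.2 ⟨1, one_ne_zero⟩
  · exact Function.ne_iff.2 ⟨0, one_ne_zero⟩

theorem isUnit_conicFrame_det : IsUnit conicFrame.det := by
  rw [isUnit_iff_ne_zero]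
  simp [conicFrame, Matrix.det_fin_three]
  norm_num

/-- The change of basis to a basis of points of the double Segre surface. -/
noncomputable def segreFrame : Mat3 ≃ₗ[ℂ] Mat3 :=
  sandwichEquiv isUnit_conicFrame_det isUnit_conicFrame_det

/-- The coordinates of a tenth point of the double Segre surface. -/
def unitCoeff : Fin 3 → ℂ := ![2, 2, -1]

theorem unitCoeff_ne_zero (i : Fin 3) : unitCoeff i ≠ 0 := by
  fin_cases i <;> simp [unitCoeff]

/-- A fourth point of the projective line. -/
def lineUnit : Fin 2 → ℂ := ![1, -1]

theorem lineUnit_ne_zero : lineUnit ≠ 0 := Function.ne_iff.2 ⟨0, one_ne_zero⟩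

theorem segreFrame_single (i j : Fin 3) :
    segreFrame (Matrix.single i j 1) = segre (lineFrame i) (lineFrame j) := by
  have h : ∀ i, conicFrame.mulVec (Pi.single i 1) = conicVec (lineFrame i) := by
    intro i
    ext k
    fin_cases i <;> fin_cases k <;> simp [conicFrame, conicVec, lineFrame] <;> norm_num
  rw [Matrix.single_eq_single_vecMulVec_single, segreFrame, sandwichEquiv_apply, sandwich_vecMulVec, h, h, segre]

/-- Together with the nine points of `segreFrame_single` this is a projective frame inside the
surface: no coordinate of the tenth point is zero. The numbers 2, 2, -1 express `conicVec lineUnit`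
in the columns of `conicFrame`. -/
theorem segreFrame_unit :
    segreFrame (Matrix.vecMulVec unitCoeff unitCoeff) = segre lineUnit lineUnit := by
  have h : conicFrame.mulVec unitCoeff = conicVec lineUnit := by
    ext k
    fin_cases k <;> simp [conicFrame, conicVec, lineUnit, unitCoeff, Matrix.mulVec, dotProduct,
      Fin.sum_univ_three]
    norm_num
  rw [segreFrame, sandwichEquiv_apply, sandwich_vecMulVec, h, segre]

/-- Two linear maps that agree projectively on the double Segre surface are proportional. -/
theorem exists_eq_smul_of_segre {V : Type*} [AddCommGroup V] [Module ℂ V] {L L' : Mat3 →ₗ[ℂ] V}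
    (hL : Function.Injective L)
    (h : ∀ u w, u ≠ 0 → w ≠ 0 → ∃ c : ℂ, L' (segre u w) = c • L (segre u w)) :
    ∃ c : ℂ, ∀ Y, L' Y = c • L Y := by
  choose c hc using fun ij : Fin 3 × Fin 3 =>
    h _ _ (lineFrame_ne_zero ij.1) (lineFrame_ne_zero ij.2)
  obtain ⟨d, hd⟩ := h _ _ lineUnit_ne_zero lineUnit_ne_zero
  have hsum : ∀ Y : Mat3, Y = ∑ i, ∑ j, Y i j • Matrix.single i j (1 : ℂ) := by
    intro Y
    conv_lhs => rw [Matrix.matrix_eq_sum_single Y]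
    simp
  have key : ∀ Y : Mat3, L' (segreFrame Y) =
      L (segreFrame (∑ i, ∑ j, (Y i j * c (i, j)) • Matrix.single i j (1 : ℂ))) := by
    intro Y
    conv_lhs => rw [hsum Y]
    simp only [map_sum, map_smul]
    refine Finset.sum_congr rfl fun i _ => Finset.sum_congr rfl fun j _ => ?_
    rw [segreFrame_single, hc (i, j), smul_smul]
  have h1 := key (Matrix.vecMulVec unitCoeff unitCoeff)
  rw [segreFrame_unit, hd, ← segreFrame_unit, ← map_smul, ← map_smul] at h1
  have h2 := segreFrame.injective (hL h1)
  -- The nine factors at the basis points all equal the factor `d` at the tenth point, as its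
  -- coordinates are nonzero.
  have h3 : ∀ i j, c (i, j) = d := by
    intro i j
    have h4 := congrFun (congrFun h2 i) j
    simp only [Matrix.smul_apply, Matrix.vecMulVec_apply, smul_eq_mul, Matrix.sum_apply,
      Matrix.single_apply, mul_ite, mul_one, mul_zero] at h4
    simp [ite_and] at h4
    have h5 : unitCoeff i * unitCoeff j ≠ 0 := mul_ne_zero (unitCoeff_ne_zero i)
      (unitCoeff_ne_zero j)
    exact mul_left_cancel₀ h5 (by rw [mul_comm _ d]; exact h4.symm)
  refine ⟨d, fun Y => ?_⟩
  obtain ⟨Z, rfl⟩ := segreFrame.surjective Y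
  rw [key Z, ← map_smul, ← map_smul]
  congr 2
  conv_rhs => rw [hsum Z]
  simp only [h3, Finset.smul_sum, smul_smul, mul_comm d]

/-- The surface spans `Mat3`. Comparing Y ↦ (0, L Y) with the injective map Y ↦ (Y, 0) into `Mat3 ×
V`, with factor 0 at every point of the surface, reduces this to `exists_eq_smul_of_segre`. -/
theorem eq_zero_of_segre {V : Type*} [AddCommGroup V] [Module ℂ V] {L : Mat3 →ₗ[ℂ] V}
    (h : ∀ u w, L (segre u w) = 0) : L = 0 := by
  obtain ⟨c, hc⟩ := exists_eq_smul_of_segre (L := LinearMap.inl ℂ Mat3 V)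
    (L' := LinearMap.inr ℂ Mat3 V ∘ₗ L) LinearMap.inl_injective
    (fun u w _ _ => ⟨0, by simp [h]⟩)
  ext1 Y
  simpa using congrArg Prod.snd (hc Y)

/-- The surface `X` is the image of the double Segre surface under the linear map `P`. -/
def IsParam (P : Mat3 ≃ₗ[ℂ] (Fin 9 → ℂ)) (X : Set (CP 8)) : Prop :=
  ∀ p, p ∈ X ↔ ∃ u w, u ≠ 0 ∧ w ≠ 0 ∧ HasCoords p (P (segre u w))

/-! ### Forms of bidegree (2,2) as linear forms on `Mat3` -/

section regular

open MvPolynomial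

/-- A linear form as a polynomial. -/
noncomputable def linPoly {m : ℕ} (ℓ : (Fin (m + 1) → ℂ) →ₗ[ℂ] ℂ) :
    MvPolynomial (Fin (m + 1)) ℂ := ∑ i, C (ℓ (Pi.single i 1)) * X i

theorem isHomogeneous_linPoly {m : ℕ} (ℓ : (Fin (m + 1) → ℂ) →ₗ[ℂ] ℂ) :
    (linPoly ℓ).IsHomogeneous 1 := by
  refine IsHomogeneous.sum _ _ _ fun i _ => ?_
  simpa using (isHomogeneous_C _ (ℓ (Pi.single i 1))).mul (isHomogeneous_X ℂ i)

theorem eval_linPoly {m : ℕ} (ℓ : (Fin (m + 1) → ℂ) →ₗ[ℂ] ℂ) (v : Fin (m + 1) → ℂ) :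
    eval v (linPoly ℓ) = ℓ v := by
  simp only [linPoly, map_sum, map_mul, eval_C, eval_X]
  conv_rhs => rw [pi_eq_sum_univ' v, map_sum]
  refine Finset.sum_congr rfl fun i _ => ?_
  rw [map_smul, smul_eq_mul, mul_comm]

theorem isRegularMap_of_linear {m k : ℕ} {A : Set (CP m)} {f : A → CP k}
    (h : ∀ a : A, ∃ L : (Fin (m + 1) → ℂ) →ₗ[ℂ] (Fin (k + 1) → ℂ),
      (∀ v, HasCoords a.1 v → L v ≠ 0) ∧
        ∀ (b : A) v, HasCoords b.1 v → L v ≠ 0 → HasCoords (f b) (L v)) : IsRegularMap A f := by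
  intro a
  obtain ⟨L, h1, h2⟩ := h a
  have key : ∀ p : CP m, evalAt (fun i => linPoly (LinearMap.proj i ∘ₗ L)) p = L p.rep := by
    intro p
    ext i
    rw [evalAt, eval_linPoly]
    rfl
  refine ⟨1, fun i => linPoly (LinearMap.proj i ∘ₗ L), fun i => isHomogeneous_linPoly _, ?_, ?_⟩
  · rw [key]; exact h1 _ (HasCoords.rep _)
  · intro b hb
    rw [key] at hb ⊢
    exact h2 b _ (HasCoords.rep _) hb

theorem exists_quadVec {a b : ℕ} (h : a + b = 2) :
    ∃ q : Fin 3 → ℂ, ∀ u : Fin 2 → ℂ, u 0 ^ a * u 1 ^ b = q ⬝ᵥ conicVec u := by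
  have : a = 0 ∧ b = 2 ∨ a = 1 ∧ b = 1 ∨ a = 2 ∧ b = 0 := by omega
  rcases this with ⟨rfl, rfl⟩ | ⟨rfl, rfl⟩ | ⟨rfl, rfl⟩
  · exact ⟨![1 / 2, -1 / 2, 0], fun u => by
      simp [conicVec, dotProduct, Fin.sum_univ_three]; ring⟩
  · exact ⟨![0, 0, 1 / 2], fun u => by
      simp [conicVec, dotProduct, Fin.sum_univ_three]; ring⟩
  · exact ⟨![1 / 2, 1 / 2, 0], fun u => by
      simp [conicVec, dotProduct, Fin.sum_univ_three]; ring⟩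

/-- The forms of bidegree `(2, 2)` are the linear forms in the double Segre coordinates. -/
theorem exists_coeff_of_bidegree_two_two {F : MvPolynomial (Fin (1 + 1) ⊕ Fin (1 + 1)) ℂ}
    (hF : F ∈ bidegreeForms 1 1 (2, 2)) :
    ∃ c : Mat3, ∀ u w, eval (Sum.elim u w) F = ∑ i, ∑ j, c i j * segre u w i j := by
  classical
  have : ∀ d : Fin (1 + 1) ⊕ Fin (1 + 1) →₀ ℕ, ∃ c : Mat3, d ∈ F.support →
      ∀ u w : Fin 2 → ℂ, ∏ i, Sum.elim u w i ^ d i = ∑ i, ∑ j, c i j * segre u w i j := by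
    intro d
    by_cases hd : d ∈ F.support
    · have hw := hF (mem_support_iff.1 hd)
      rw [weight_biweight, Prod.mk.injEq, Fin.sum_univ_two, Fin.sum_univ_two] at hw
      obtain ⟨q, hq⟩ := exists_quadVec hw.1
      obtain ⟨r, hr⟩ := exists_quadVec hw.2
      refine ⟨Matrix.vecMulVec q r, fun _ u w => ?_⟩
      rw [Fintype.prod_sum_type]
      simp only [Sum.elim_inl, Sum.elim_inr]
      rw [Fin.prod_univ_two, Fin.prod_univ_two, hq, hr, dotProduct, dotProduct,
        Finset.sum_mul_sum]
      refine Finset.sum_congr rfl fun i _ => Finset.sum_congr rfl fun j _ => ?_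
      rw [Matrix.vecMulVec_apply, segre_apply]
      ring
    · exact ⟨0, fun h => absurd h hd⟩
  choose c hc using this
  refine ⟨∑ d ∈ F.support, F.coeff d • c d, fun u w => ?_⟩
  rw [eval_eq']
  have e : ∀ d ∈ F.support, F.coeff d * ∏ i, Sum.elim u w i ^ d i =
      ∑ i, ∑ j, F.coeff d * c d i j * segre u w i j := by
    intro d hd
    rw [hc d hd, Finset.mul_sum]
    refine Finset.sum_congr rfl fun i _ => ?_
    rw [Finset.mul_sum]
    exact Finset.sum_congr rfl fun j _ => (mul_assoc _ _ _).symm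
  rw [Finset.sum_congr rfl e, Finset.sum_comm]
  refine Finset.sum_congr rfl fun i _ => ?_
  rw [Finset.sum_comm]
  refine Finset.sum_congr rfl fun j _ => ?_
  rw [Matrix.sum_apply, Finset.sum_mul]
  rfl

theorem finrank_mat3 : Module.finrank ℂ Mat3 = 9 := by
  rw [Module.finrank_matrix]
  simp

/-- Each form is a linear form in the entries of `segre u w`. A linear relation between the
coefficient matrices would give one between the polynomials, so the nine linear forms are
independent and are coordinates on `Mat3`. -/
theorem exists_param_of_basis {F : Fin (8 + 1) → MvPolynomial (Fin (1 + 1) ⊕ Fin (1 + 1)) ℂ}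
    (hF : LinearIndependent ℂ F) (hd : ∀ k, F k ∈ bidegreeForms 1 1 (2, 2)) :
    ∃ P : Mat3 ≃ₗ[ℂ] (Fin 9 → ℂ), ∀ u w, P (segre u w) = evalPair F u w := by
  choose c hc using fun k => exists_coeff_of_bidegree_two_two (hd k)
  have hli : LinearIndependent ℂ c := by
    rw [Fintype.linearIndependent_iff] at hF ⊢
    intro a ha
    refine hF a ?_
    refine eq_zero_of_eval_eq_zero fun u w _ _ => ?_
    simp only [map_sum, smul_eval, hc]
    have : ∀ k, a k * ∑ i, ∑ j, c k i j * segre u w i j =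
        ∑ i, ∑ j, (a k • c k) i j * segre u w i j := by
      intro k
      rw [Finset.mul_sum]
      refine Finset.sum_congr rfl fun i _ => ?_
      rw [Finset.mul_sum]
      exact Finset.sum_congr rfl fun j _ => (mul_assoc _ _ _).symm
    simp only [this]
    rw [Finset.sum_comm]
    refine Finset.sum_eq_zero fun i _ => ?_
    rw [Finset.sum_comm]
    refine Finset.sum_eq_zero fun j _ => ?_
    rw [← Finset.sum_mul, ← Matrix.sum_apply, ha, Matrix.zero_apply, zero_mul]
  have hspan : Submodule.span ℂ (Set.range c) = ⊤ :=
    hli.span_eq_top_of_card_eq_finrank (by simp [finrank_mat3])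
  let L : Mat3 →ₗ[ℂ] (Fin 9 → ℂ) :=
    { toFun := fun Y k => ∑ i, ∑ j, c k i j * Y i j
      map_add' := fun Y Z => by
        ext k
        simp only [Matrix.add_apply, mul_add, Finset.sum_add_distrib, Pi.add_apply]
      map_smul' := fun a Y => by
        ext k
        simp only [Matrix.smul_apply, smul_eq_mul, RingHom.id_apply, Pi.smul_apply,
          Finset.mul_sum]
        exact Finset.sum_congr rfl fun i _ => Finset.sum_congr rfl fun j _ => by ring }
  have hL : Function.Injective L := by
    rw [injective_iff_map_eq_zero]
    intro Y hY
    ext i j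
    -- The pairing with `Y` vanishes on every coefficient matrix, hence on their span, which
    -- contains the matrix units.
    have : ∀ Z ∈ Submodule.span ℂ (Set.range c), ∑ i, ∑ j, Z i j * Y i j = 0 := by
      intro Z hZ
      induction hZ using Submodule.span_induction with
      | mem Z hZ => obtain ⟨k, rfl⟩ := hZ; exact congrFun hY k
      | zero => simp
      | add Z Z' _ _ h h' =>
        simp only [Matrix.add_apply, add_mul, Finset.sum_add_distrib, h, h', add_zero]
      | smul a Z _ h =>
        simp only [Matrix.smul_apply, smul_eq_mul, mul_assoc, ← Finset.mul_sum, h, mul_zero]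
    have h1 := this (Matrix.single i j 1) (hspan ▸ Submodule.mem_top)
    simpa [Matrix.single_apply, ite_and] using h1
  refine ⟨L.linearEquivOfInjective hL (by simp [finrank_mat3]), fun u w => ?_⟩
  ext k
  exact (hc k u w).symm

/-- The complex conjugate of a tuple of polynomials. -/
noncomputable def conjPoly {σ : Type*} {k : ℕ} (F : Fin k → MvPolynomial σ ℂ) :
    Fin k → MvPolynomial σ ℂ := fun i => map (starRingEnd ℂ) (F i)

theorem conjPoly_mem {a b k : ℕ} {d : ℕ × ℕ}
    {F : Fin k → MvPolynomial (Fin (a + 1) ⊕ Fin (b + 1)) ℂ}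
    (hF : ∀ i, F i ∈ bidegreeForms a b d) (i : Fin k) : conjPoly F i ∈ bidegreeForms a b d := by
  intro e he
  rw [conjPoly, coeff_map] at he
  exact hF i fun h => he (by rw [h, map_zero])

theorem evalPair_conjPoly {a b k : ℕ} (F : Fin k → MvPolynomial (Fin (a + 1) ⊕ Fin (b + 1)) ℂ)
    (u : Fin (a + 1) → ℂ) (w : Fin (b + 1) → ℂ) :
    evalPair (conjPoly F) u w = star (evalPair F (star u) (star w)) := by
  ext i
  simp only [evalPair, conjPoly, Pi.star_apply]
  rw [eval_map, ← starRingEnd_apply, ← coe_eval₂Hom, eval, ← RingHom.comp_apply]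
  congr 1
  apply MvPolynomial.ringHom_ext
  · intro r; simp
  · rintro (j | j) <;> simp

/-- Conjugating a map before and after by the antiholomorphic involution only conjugates its
coefficients, so the result is algebraic of the same bidegree. -/
theorem IsGlobalRep.conj {f : CP 1 × CP 1 → CP 1} {d : ℕ × ℕ}
    {F : Fin 2 → MvPolynomial (Fin (1 + 1) ⊕ Fin (1 + 1)) ℂ} (h : IsGlobalRep f d F) :
    IsGlobalRep (fun x => CP.conj (f (CP.conj x.1, CP.conj x.2))) d (conjPoly F) := by
  refine ⟨conjPoly_mem h.1, fun p q u w hu hw => ?_⟩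
  rw [evalPair_conjPoly]
  exact (h.2 _ _ _ _ hu.conj hw.conj).conj

theorem IsRegularMapProd.exists_globalRep {f : CP 1 × CP 1 → CP 1}
    (h : IsRegularMapProd Set.univ fun x => f x.1) : ∃ d F, IsGlobalRep f d F := by
  obtain ⟨d, F, h1, h2⟩ := h.exists_global
  exact ⟨d, F, h1, h2⟩

theorem isUnit_det_of_mulVec_ne_zero {g : Matrix (Fin 2) (Fin 2) ℂ}
    (h : ∀ u, u ≠ 0 → g.mulVec u ≠ 0) : IsUnit g.det := by
  rw [isUnit_iff_ne_zero]
  intro h0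
  obtain ⟨u, hu, e⟩ := Matrix.exists_mulVec_eq_zero_iff.2 h0
  exact h u hu e

/-- The biregular automorphisms of `ℙ¹ × ℙ¹`, with invertible matrices. -/
theorem exists_unit_matrices_of_inverse {f₁ f₂ g₁ g₂ : CP 1 × CP 1 → CP 1}
    (hf₁ : ∃ d F, IsGlobalRep f₁ d F) (hf₂ : ∃ d F, IsGlobalRep f₂ d F)
    (hg₁ : ∃ d F, IsGlobalRep g₁ d F) (hg₂ : ∃ d F, IsGlobalRep g₂ d F)
    (h₁ : ∀ x, g₁ (f₁ x, f₂ x) = x.1) (h₂ : ∀ x, g₂ (f₁ x, f₂ x) = x.2) :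
    ∃ a b : Matrix (Fin 2) (Fin 2) ℂ, IsUnit a.det ∧ IsUnit b.det ∧
      ((∀ p q u w, HasCoords p u → HasCoords q w →
        HasCoords (f₁ (p, q)) (a.mulVec u) ∧ HasCoords (f₂ (p, q)) (b.mulVec w)) ∨
      (∀ p q u w, HasCoords p u → HasCoords q w →
        HasCoords (f₁ (p, q)) (a.mulVec w) ∧ HasCoords (f₂ (p, q)) (b.mulVec u))) := by
  obtain ⟨a, b, H⟩ := exists_matrices_of_inverse hf₁ hf₂ hg₁ hg₂ h₁ h₂
  have hv := exists_ne_zero_vec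
  refine ⟨a, b, isUnit_det_of_mulVec_ne_zero fun u hu => ?_,
    isUnit_det_of_mulVec_ne_zero fun u hu => ?_, H⟩
  · rcases H with H | H
    · exact (H _ _ _ _ (HasCoords.mk hu) (HasCoords.mk hv)).1.ne_zero
    · exact (H _ _ _ _ (HasCoords.mk hv) (HasCoords.mk hu)).1.ne_zero
  · rcases H with H | H
    · exact (H _ _ _ _ (HasCoords.mk hv) (HasCoords.mk hu)).2.ne_zero
    · exact (H _ _ _ _ (HasCoords.mk hu) (HasCoords.mk hv)).2.ne_zero

end regular

/-! ### Double Segre surfaces as linear images of rank one matrices -/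

section parametrization

open MvPolynomial

/-- The coordinates of the conic as polynomials in the variables of one of the factors. -/
noncomputable def conicPoly (x : Fin 2 → Fin (1 + 1) ⊕ Fin (1 + 1)) :
    Fin 3 → MvPolynomial (Fin (1 + 1) ⊕ Fin (1 + 1)) ℂ :=
  ![X (x 0) * X (x 0) + X (x 1) * X (x 1), X (x 0) * X (x 0) - X (x 1) * X (x 1),
    C 2 * (X (x 0) * X (x 1))]

theorem eval_conicPoly (x : Fin 2 → Fin (1 + 1) ⊕ Fin (1 + 1)) (v : Fin (1 + 1) ⊕ Fin (1 + 1) → ℂ)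
    (i : Fin 3) : eval v (conicPoly x i) = conicVec (v ∘ x) i := by
  fin_cases i <;> simp [conicPoly, conicVec] <;> ring

theorem conicPoly_mem {x : Fin 2 → Fin (1 + 1) ⊕ Fin (1 + 1)} {d : ℕ × ℕ}
    (h : ∀ i, X (x i) ∈ bidegreeForms 1 1 d) (i : Fin 3) :
    conicPoly x i ∈ bidegreeForms 1 1 (d + d) := by
  have hm : ∀ i j, X (x i) * X (x j) ∈ bidegreeForms 1 1 (d + d) := fun i j =>
    IsWeightedHomogeneous.mul (h i) (h j)
  fin_cases i
  · exact add_mem (hm 0 0) (hm 1 1)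
  · exact sub_mem (hm 0 0) (hm 1 1)
  · exact IsWeightedHomogeneous.C_mul (hm 0 1) 2

/-- The forms of bidegree `(2, 2)` that are the components of a parametrization. -/
noncomputable def paramPoly (P : Mat3 →ₗ[ℂ] (Fin 9 → ℂ)) (k : Fin (8 + 1)) :
    MvPolynomial (Fin (1 + 1) ⊕ Fin (1 + 1)) ℂ :=
  ∑ i, ∑ j, C (P (Matrix.single i j 1) k) * (conicPoly Sum.inl i * conicPoly Sum.inr j)

theorem paramPoly_mem (P : Mat3 →ₗ[ℂ] (Fin 9 → ℂ)) (k : Fin (8 + 1)) :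
    paramPoly P k ∈ bidegreeForms 1 1 (2, 2) := by
  have h1 : ∀ i, conicPoly Sum.inl i ∈ bidegreeForms 1 1 ((1, 0) + (1, 0)) :=
    conicPoly_mem fun i => isWeightedHomogeneous_X _ _ _
  have h2 : ∀ j, conicPoly Sum.inr j ∈ bidegreeForms 1 1 ((0, 1) + (0, 1)) :=
    conicPoly_mem fun i => isWeightedHomogeneous_X _ _ _
  have h3 : ∀ i j, C (P (Matrix.single i j 1) k) * (conicPoly Sum.inl i * conicPoly Sum.inr j) ∈
      bidegreeForms 1 1 ((1, 0) + (1, 0) + ((0, 1) + (0, 1))) := fun i j =>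
    IsWeightedHomogeneous.C_mul (IsWeightedHomogeneous.mul (h1 i) (h2 j)) _
  have h4 : ((1, 0) + (1, 0) + ((0, 1) + (0, 1)) : ℕ × ℕ) = (2, 2) := rfl
  rw [h4] at h3
  unfold paramPoly
  exact Submodule.sum_mem _ fun i _ => Submodule.sum_mem _ fun j _ => h3 i j

theorem Mat3.eq_sum_single (Y : Mat3) : Y = ∑ i, ∑ j, Y i j • Matrix.single i j (1 : ℂ) := by
  conv_lhs => rw [Matrix.matrix_eq_sum_single Y]
  simp

theorem evalPair_paramPoly (P : Mat3 →ₗ[ℂ] (Fin 9 → ℂ)) (u w : Fin 2 → ℂ) :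
    evalPair (paramPoly P) u w = P (segre u w) := by
  ext k
  conv_rhs => rw [Mat3.eq_sum_single (segre u w)]
  simp only [evalPair, paramPoly, map_sum, map_mul, eval_C, eval_conicPoly, map_smul,
    Finset.sum_apply, Pi.smul_apply, smul_eq_mul, segre_apply]
  refine Finset.sum_congr rfl fun i _ => Finset.sum_congr rfl fun j _ => ?_
  rw [mul_comm]
  rfl

theorem linearIndependent_paramPoly (P : Mat3 ≃ₗ[ℂ] (Fin 9 → ℂ)) :
    LinearIndependent ℂ (paramPoly P.toLinearMap) := by
  rw [Fintype.linearIndependent_iff]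
  intro a ha
  have h : (dotProductBilin ℂ ℂ a) ∘ₗ P.toLinearMap = 0 := by
    refine eq_zero_of_segre fun u w => ?_
    have := congrArg (eval (Sum.elim u w)) ha
    simp only [map_sum, smul_eval, map_zero] at this
    rw [← this]
    rw [LinearMap.comp_apply, ← evalPair_paramPoly]
    rfl
  intro k
  have := LinearMap.congr_fun h (P.symm (Pi.single k 1))
  simpa using this

theorem span_paramPoly (P : Mat3 ≃ₗ[ℂ] (Fin 9 → ℂ)) :
    Submodule.span ℂ (Set.range (paramPoly P.toLinearMap)) = bidegreeForms 1 1 (2, 2) := by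
  refine le_antisymm (Submodule.span_le.2 ?_) fun F hF => ?_
  · rintro _ ⟨k, rfl⟩
    exact paramPoly_mem _ k
  · obtain ⟨c, hc⟩ := exists_coeff_of_bidegree_two_two hF
    let φ : Mat3 →ₗ[ℂ] ℂ :=
      { toFun := fun Y => ∑ i, ∑ j, c i j * Y i j
        map_add' := fun Y Z => by
          simp only [Matrix.add_apply, mul_add, Finset.sum_add_distrib]
        map_smul' := fun a Y => by
          simp only [Matrix.smul_apply, smul_eq_mul, RingHom.id_apply, Finset.mul_sum]
          exact Finset.sum_congr rfl fun i _ => Finset.sum_congr rfl fun j _ => by ring }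
    have : F = ∑ k, φ (P.symm (Pi.single k 1)) • paramPoly P.toLinearMap k := by
      rw [← sub_eq_zero]
      refine eq_zero_of_eval_eq_zero fun u w _ _ => ?_
      rw [map_sub, hc, map_sum, sub_eq_zero]
      have e1 : ∑ i, ∑ j, c i j * segre u w i j = φ (P.symm (P (segre u w))) := by
        rw [P.symm_apply_apply]; rfl
      rw [e1]
      conv_lhs => rw [pi_eq_sum_univ' (P (segre u w)), map_sum, map_sum]
      refine Finset.sum_congr rfl fun k _ => ?_
      rw [map_smul, map_smul, smul_eval, smul_eq_mul, mul_comm]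
      congr 1
      exact (congrFun (evalPair_paramPoly P.toLinearMap u w) k).symm
    rw [this]
    exact sum_mem fun k _ => Submodule.smul_mem _ _ (Submodule.subset_span ⟨k, rfl⟩)

theorem IsParam.mem {P : Mat3 ≃ₗ[ℂ] (Fin 9 → ℂ)} {X : Set (CP 8)} (h : IsParam P X)
    {p : CP 8} {u w : Fin 2 → ℂ} (hu : u ≠ 0) (hw : w ≠ 0) (hp : HasCoords p (P (segre u w))) :
    p ∈ X := (h p).2 ⟨u, w, hu, hw, hp⟩

theorem param_ne_zero (P : Mat3 ≃ₗ[ℂ] (Fin 9 → ℂ)) {u w : Fin 2 → ℂ} (hu : u ≠ 0) (hw : w ≠ 0) :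
    P (segre u w) ≠ 0 := by
  rw [Ne, LinearEquiv.map_eq_zero_iff]
  exact segre_ne_zero hu hw

theorem hasCoords_param (P : Mat3 ≃ₗ[ℂ] (Fin 9 → ℂ)) {p : CP 8} {u w u' w' : Fin 2 → ℂ}
    {x y : CP 1} (hp : HasCoords p (P (segre u w))) (hu : HasCoords x u) (hu' : HasCoords x u')
    (hw : HasCoords y w) (hw' : HasCoords y w') : HasCoords p (P (segre u' w')) := by
  obtain ⟨s, hs, rfl⟩ := hu.exists_smul hu'
  obtain ⟨t, ht, rfl⟩ := hw.exists_smul hw'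
  rw [segre_smul, map_smul]
  exact hp.smul (by simp [hs, ht])

/-- The parametrization is given by forms of bidegree (2,2). Each component of its inverse is linear
on suitable open sets: a nonzero column or row of `segre u w` is a point of the conic, from which
the point of ℙ¹ is recovered. -/
theorem IsParam.exists_equiv {P : Mat3 ≃ₗ[ℂ] (Fin 9 → ℂ)} {X : Set (CP 8)} (h : IsParam P X) :
    ∃ e : (Set.univ : Set (CP 1 × CP 1)) ≃ X, IsBiregularProd e ∧
      ∀ x u w, HasCoords x.1.1 u → HasCoords x.1.2 w → HasCoords (e x).1 (P (segre u w)) := by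
  let f : ↥(Set.univ : Set (CP 1 × CP 1)) → X := fun x =>
    ⟨Projectivization.mk ℂ (P (segre x.1.1.rep x.1.2.rep))
      (param_ne_zero P x.1.1.rep_nonzero x.1.2.rep_nonzero),
      h.mem x.1.1.rep_nonzero x.1.2.rep_nonzero (HasCoords.mk _)⟩
  have hf0 : ∀ x, HasCoords (f x).1 (P (segre x.1.1.rep x.1.2.rep)) := fun x => HasCoords.mk _
  have hf : ∀ x u w, HasCoords x.1.1 u → HasCoords x.1.2 w →
      HasCoords (f x).1 (P (segre u w)) := fun x u w hu hw =>
    hasCoords_param P (hf0 x) (HasCoords.rep _) hu (HasCoords.rep _) hw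
  have hbij : Function.Bijective f := by
    constructor
    · intro x y hxy
      have h1 := hf0 x
      rw [hxy] at h1
      obtain ⟨c, hc, e⟩ := h1.exists_smul (hf0 y)
      rw [← map_smul] at e
      obtain ⟨⟨s, hs⟩, t, ht⟩ := exists_smul_of_segre_eq x.1.1.rep_nonzero x.1.2.rep_nonzero
        y.1.1.rep_nonzero y.1.2.rep_nonzero (P.injective e)
      have k1 := HasCoords.rep y.1.1
      have k2 := HasCoords.rep y.1.2
      rw [hs] at k1
      rw [ht] at k2
      exact Subtype.ext (Prod.ext ((HasCoords.rep x.1.1).eq k1.of_smul)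
        ((HasCoords.rep x.1.2).eq k2.of_smul))
    · rintro ⟨p, hp⟩
      obtain ⟨u, w, hu, hw, hp'⟩ := (h p).1 hp
      refine ⟨⟨(Projectivization.mk ℂ u hu, Projectivization.mk ℂ w hw), trivial⟩, ?_⟩
      exact Subtype.ext ((hf _ u w (HasCoords.mk hu) (HasCoords.mk hw)).eq hp')
  have hpt : ∀ (y : X) v, HasCoords y.1 v → ∃ u w, ∃ c : ℂ, c ≠ 0 ∧
      HasCoords ((Equiv.ofBijective f hbij).symm y).1.1 u ∧
      HasCoords ((Equiv.ofBijective f hbij).symm y).1.2 w ∧ P.symm v = c • segre u w := by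
    intro y v hv
    have h1 := hf0 ((Equiv.ofBijective f hbij).symm y)
    have h2 : f ((Equiv.ofBijective f hbij).symm y) = y :=
      (Equiv.ofBijective f hbij).apply_symm_apply y
    rw [h2] at h1
    obtain ⟨c, hc, e⟩ := h1.exists_smul hv
    refine ⟨_, _, c, hc, HasCoords.rep _, HasCoords.rep _, ?_⟩
    rw [e, map_smul, P.symm_apply_apply]
  refine ⟨Equiv.ofBijective f hbij, ⟨?_, ?_, ?_⟩, hf⟩
  · have hpoly : ∀ x : CP 1 × CP 1, evalAtProd (paramPoly P.toLinearMap) x =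
        P (segre x.1.rep x.2.rep) := fun x => evalPair_paramPoly P.toLinearMap _ _
    refine fun x => ⟨(2, 2), paramPoly P.toLinearMap, paramPoly_mem _, ?_, fun y _ => ?_⟩
    · rw [hpoly]
      exact (hf0 x).ne_zero
    · rw [hpoly]
      exact hf0 y
  -- Up to the common factor `conicVec w j`, `L₀` reads off (2u₀², 2u₀u₁) and `L₁` reads off (2u₀u₁,
  -- 2u₁²). They recover `u` on the charts u₀ ≠ 0 and u₁ ≠ 0; the second factor is treated in the
  -- same way with rows.
  · let L₀ (j : Fin 3) : Mat3 →ₗ[ℂ] (Fin 2 → ℂ) :=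
      { toFun := fun Y => ![Y 0 j + Y 1 j, Y 2 j]
        map_add' := fun Y Z => by ext i; fin_cases i <;> simp <;> ring
        map_smul' := fun c Y => by ext i; fin_cases i <;> simp; ring }
    let L₁ (j : Fin 3) : Mat3 →ₗ[ℂ] (Fin 2 → ℂ) :=
      { toFun := fun Y => ![Y 2 j, Y 0 j - Y 1 j]
        map_add' := fun Y Z => by ext i; fin_cases i <;> simp; ring
        map_smul' := fun c Y => by ext i; fin_cases i <;> simp; ring }
    have e₀ : ∀ j u w, L₀ j (segre u w) = (2 * u 0 * conicVec w j) • u := by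
      intro j u w
      ext i
      fin_cases i <;> simp [L₀, segre_apply, conicVec] <;> ring
    have e₁ : ∀ j u w, L₁ j (segre u w) = (2 * u 1 * conicVec w j) • u := by
      intro j u w
      ext i
      fin_cases i <;> simp [L₁, segre_apply, conicVec] <;> ring
    have gen : ∀ L : Mat3 →ₗ[ℂ] (Fin 2 → ℂ), (∀ u w, ∃ c : ℂ, L (segre u w) = c • u) →
        ∀ (b : X) v, HasCoords b.1 v → (L ∘ₗ P.symm.toLinearMap) v ≠ 0 →
        HasCoords ((Equiv.ofBijective f hbij).symm b).1.1 ((L ∘ₗ P.symm.toLinearMap) v) := by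
      intro L hL b v hv h0
      obtain ⟨u, w, c, hc, hu, hw, e⟩ := hpt b v hv
      obtain ⟨d, hd⟩ := hL u w
      have e' : (L ∘ₗ P.symm.toLinearMap) v = (c * d) • u := by
        simp only [LinearMap.comp_apply, LinearEquiv.coe_coe, e, map_smul, hd, smul_smul]
      rw [e'] at h0 ⊢
      exact hu.smul fun h => h0 (by rw [h, zero_smul])
    refine isRegularMap_of_linear fun y => ?_
    obtain ⟨u, w, c, hc, hu, hw, e⟩ := hpt y _ (HasCoords.rep _)
    obtain ⟨j, hj⟩ := Function.ne_iff.1 (conicVec_ne_zero hw.ne_zero)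
    have nz : ∀ L : Mat3 →ₗ[ℂ] (Fin 2 → ℂ), L (segre u w) ≠ 0 → ∀ v, HasCoords y.1 v →
        (L ∘ₗ P.symm.toLinearMap) v ≠ 0 := by
      intro L hL v hv
      obtain ⟨s, hs, e2⟩ := (HasCoords.rep y.1).exists_smul hv
      simp only [LinearMap.comp_apply, LinearEquiv.coe_coe, e2, map_smul, e]
      exact smul_ne_zero hs (smul_ne_zero hc hL)
    by_cases hu0 : u 0 = 0
    · have hu1 : u 1 ≠ 0 := fun hu1 => hu.ne_zero (by ext i; fin_cases i <;> assumption)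
      refine ⟨L₁ j ∘ₗ P.symm.toLinearMap, nz _ ?_, gen _ fun u w => ⟨_, e₁ j u w⟩⟩
      rw [e₁]
      exact smul_ne_zero (by simpa [hu1] using hj) hu.ne_zero
    · refine ⟨L₀ j ∘ₗ P.symm.toLinearMap, nz _ ?_, gen _ fun u w => ⟨_, e₀ j u w⟩⟩
      rw [e₀]
      exact smul_ne_zero (by simpa [hu0] using hj) hu.ne_zero
  · let L₀ (j : Fin 3) : Mat3 →ₗ[ℂ] (Fin 2 → ℂ) :=
      { toFun := fun Y => ![Y j 0 + Y j 1, Y j 2]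
        map_add' := fun Y Z => by ext i; fin_cases i <;> simp <;> ring
        map_smul' := fun c Y => by ext i; fin_cases i <;> simp; ring }
    let L₁ (j : Fin 3) : Mat3 →ₗ[ℂ] (Fin 2 → ℂ) :=
      { toFun := fun Y => ![Y j 2, Y j 0 - Y j 1]
        map_add' := fun Y Z => by ext i; fin_cases i <;> simp; ring
        map_smul' := fun c Y => by ext i; fin_cases i <;> simp; ring }
    have e₀ : ∀ j u w, L₀ j (segre u w) = (2 * w 0 * conicVec u j) • w := by
      intro j u w
      ext i
      fin_cases i <;> simp [L₀, segre_apply, conicVec] <;> ring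
    have e₁ : ∀ j u w, L₁ j (segre u w) = (2 * w 1 * conicVec u j) • w := by
      intro j u w
      ext i
      fin_cases i <;> simp [L₁, segre_apply, conicVec] <;> ring
    have gen : ∀ L : Mat3 →ₗ[ℂ] (Fin 2 → ℂ), (∀ u w, ∃ c : ℂ, L (segre u w) = c • w) →
        ∀ (b : X) v, HasCoords b.1 v → (L ∘ₗ P.symm.toLinearMap) v ≠ 0 →
        HasCoords ((Equiv.ofBijective f hbij).symm b).1.2 ((L ∘ₗ P.symm.toLinearMap) v) := by
      intro L hL b v hv h0
      obtain ⟨u, w, c, hc, hu, hw, e⟩ := hpt b v hv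
      obtain ⟨d, hd⟩ := hL u w
      have e' : (L ∘ₗ P.symm.toLinearMap) v = (c * d) • w := by
        simp only [LinearMap.comp_apply, LinearEquiv.coe_coe, e, map_smul, hd, smul_smul]
      rw [e'] at h0 ⊢
      exact hw.smul fun h => h0 (by rw [h, zero_smul])
    refine isRegularMap_of_linear fun y => ?_
    obtain ⟨u, w, c, hc, hu, hw, e⟩ := hpt y _ (HasCoords.rep _)
    obtain ⟨j, hj⟩ := Function.ne_iff.1 (conicVec_ne_zero hu.ne_zero)
    have nz : ∀ L : Mat3 →ₗ[ℂ] (Fin 2 → ℂ), L (segre u w) ≠ 0 → ∀ v, HasCoords y.1 v →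
        (L ∘ₗ P.symm.toLinearMap) v ≠ 0 := by
      intro L hL v hv
      obtain ⟨s, hs, e2⟩ := (HasCoords.rep y.1).exists_smul hv
      simp only [LinearMap.comp_apply, LinearEquiv.coe_coe, e2, map_smul, e]
      exact smul_ne_zero hs (smul_ne_zero hc hL)
    by_cases hw0 : w 0 = 0
    · have hw1 : w 1 ≠ 0 := fun hw1 => hw.ne_zero (by ext i; fin_cases i <;> assumption)
      refine ⟨L₁ j ∘ₗ P.symm.toLinearMap, nz _ ?_, gen _ fun u w => ⟨_, e₁ j u w⟩⟩
      rw [e₁]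
      exact smul_ne_zero (by simpa [hw1] using hj) hw.ne_zero
    · refine ⟨L₀ j ∘ₗ P.symm.toLinearMap, nz _ ?_, gen _ fun u w => ⟨_, e₀ j u w⟩⟩
      rw [e₀]
      exact smul_ne_zero (by simpa [hw0] using hj) hw.ne_zero

theorem IsParam.isDoubleSegre {P : Mat3 ≃ₗ[ℂ] (Fin 9 → ℂ)} {X : Set (CP 8)} (h : IsParam P X)
    (hX : CP.IsReal X) : IsDoubleSegre X := by
  obtain ⟨e, he, hc⟩ := h.exists_equiv
  refine ⟨hX, paramPoly P.toLinearMap, linearIndependent_paramPoly P, span_paramPoly P, e, he,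
    fun x => ?_⟩
  have : evalAtProd (paramPoly P.toLinearMap) x.1 = P (segre x.1.1.rep x.1.2.rep) :=
    evalPair_paramPoly P.toLinearMap _ _
  rw [this]
  exact hc x _ _ (HasCoords.rep _) (HasCoords.rep _)

theorem IsDoubleSegre.exists_param {X : Set (CP 8)} (h : IsDoubleSegre X) :
    ∃ P : Mat3 ≃ₗ[ℂ] (Fin 9 → ℂ), IsParam P X := by
  obtain ⟨-, F, hF, hs, e, he, hc⟩ := h
  have hd : ∀ k, F k ∈ bidegreeForms 1 1 (2, 2) := fun k => by
    rw [← hs]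
    exact Submodule.subset_span ⟨k, rfl⟩
  obtain ⟨P, hP⟩ := exists_param_of_basis hF hd
  refine ⟨P, fun p => ⟨fun hp => ?_, ?_⟩⟩
  · obtain ⟨x, hx⟩ := e.surjective ⟨p, hp⟩
    refine ⟨x.1.1.rep, x.1.2.rep, x.1.1.rep_nonzero, x.1.2.rep_nonzero, ?_⟩
    have := hc x
    rw [hx] at this
    rw [hP]
    exact this
  · rintro ⟨u, w, hu, hw, hp⟩
    set x : CP 1 × CP 1 := (Projectivization.mk ℂ u hu, Projectivization.mk ℂ w hw) with hx
    have h1 := hc ⟨x, trivial⟩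
    have h2 : evalAtProd F x = P (segre x.1.rep x.2.rep) := (hP _ _).symm
    rw [h2] at h1
    have h3 := hasCoords_param P h1 (HasCoords.rep _) (HasCoords.mk hu) (HasCoords.rep _)
      (HasCoords.mk hw)
    rw [hp.eq h3]
    exact (e ⟨x, trivial⟩).2

end parametrization

/-! ### Complex conjugation and automorphisms on the parameter space -/

/-- The entrywise complex conjugate of a matrix. -/
def conjMat (Y : Mat3) : Mat3 := Y.map (starRingEnd ℂ)

@[simp]
theorem conjMat_conjMat (Y : Mat3) : conjMat (conjMat Y) = Y := by
  ext i j
  simp [conjMat]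

theorem conjMat_segre (u w : Fin 2 → ℂ) : conjMat (segre u w) = segre (star u) (star w) :=
  segre_star u w

theorem conjMat_smul (c : ℂ) (Y : Mat3) : conjMat (c • Y) = star c • conjMat Y := by
  ext i j
  simp [conjMat]

theorem conjMat_add (Y Z : Mat3) : conjMat (Y + Z) = conjMat Y + conjMat Z := by
  ext i j
  simp [conjMat]

theorem conjMat_transpose (Y : Mat3) : conjMat Y.transpose = (conjMat Y).transpose := rfl

/-- The linear map of the parameter space that compares a parametrization with its complex
conjugate. -/
noncomputable def conjLin (P : Mat3 ≃ₗ[ℂ] (Fin 9 → ℂ)) : Mat3 →ₗ[ℂ] (Fin 9 → ℂ) where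
  toFun Y := star (P (conjMat Y))
  map_add' Y Z := by rw [conjMat_add, map_add, star_add]
  map_smul' c Y := by rw [conjMat_smul, map_smul, star_smul, star_star, RingHom.id_apply]

theorem conjLin_injective (P : Mat3 ≃ₗ[ℂ] (Fin 9 → ℂ)) : Function.Injective (conjLin P) := by
  intro Y Z h
  have := P.injective (star_injective h)
  rw [← conjMat_conjMat Y, this, conjMat_conjMat]

/-- The real structure of a parametrized real surface. -/
theorem IsParam.exists_real_structure {P : Mat3 ≃ₗ[ℂ] (Fin 9 → ℂ)} {X : Set (CP 8)}
    (h : IsParam P X) (hX : CP.IsReal X) :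
    ∃ a b : Matrix (Fin 2) (Fin 2) ℂ, IsUnit a.det ∧ IsUnit b.det ∧ ∃ c : ℂ, c ≠ 0 ∧
      ((∀ Y, star (P Y) = c • P (segreAct a b (conjMat Y))) ∨
        ∀ Y, star (P Y) = c • P (segreAct a b (conjMat Y).transpose)) := by
  obtain ⟨e, ⟨-, he₁, he₂⟩, hc⟩ := h.exists_equiv
  -- Composing the conjugation of X with that of ℙ¹ × ℙ¹ gives a regular map, so the antiholomorphic
  -- structure becomes an algebraic automorphism `f`.
  let s : ↥(Set.univ : Set (CP 1 × CP 1)) → X := fun x =>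
    ⟨CP.conj (e ⟨(CP.conj x.1.1, CP.conj x.1.2), trivial⟩).1, hX _ (Subtype.coe_prop _)⟩
  have hs : ∀ x u w, HasCoords x.1.1 u → HasCoords x.1.2 w →
      HasCoords (s x).1 (star (P (segre (star u) (star w)))) := fun x u w hu hw =>
    (hc ⟨(CP.conj x.1.1, CP.conj x.1.2), trivial⟩ _ _ hu.conj hw.conj).conj
  have hsreg : IsRegularMapProd Set.univ (fun x => (s x).1) := by
    have hpoly : ∀ x : CP 1 × CP 1, evalAtProd (conjPoly (paramPoly P.toLinearMap)) x =
        star (P (segre (star x.1.rep) (star x.2.rep))) := fun x =>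
      (evalPair_conjPoly _ _ _).trans (by rw [evalPair_paramPoly]; rfl)
    refine fun x => ⟨(2, 2), conjPoly (paramPoly P.toLinearMap), conjPoly_mem (paramPoly_mem _),
      ?_, fun y _ => ?_⟩
    · rw [hpoly]
      exact (hs x _ _ (HasCoords.rep _) (HasCoords.rep _)).ne_zero
    · rw [hpoly]
      exact hs y _ _ (HasCoords.rep _) (HasCoords.rep _)
  let f : CP 1 × CP 1 → CP 1 × CP 1 := fun x => (e.symm (s ⟨x, trivial⟩)).1
  have hf₁ : ∃ d F, IsGlobalRep (fun x => (f x).1) d F :=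
    IsRegularMapProd.exists_globalRep (IsRegularMapProd.comp he₁ hsreg)
  have hf₂ : ∃ d F, IsGlobalRep (fun x => (f x).2) d F :=
    IsRegularMapProd.exists_globalRep (IsRegularMapProd.comp he₂ hsreg)
  have hef : ∀ x, (e ⟨f x, trivial⟩).1 = CP.conj (e ⟨(CP.conj x.1, CP.conj x.2), trivial⟩).1 :=
    fun x => congrArg Subtype.val (e.apply_symm_apply (s ⟨x, trivial⟩))
  -- Since the real structure is an involution, the complex conjugate of `f` is the inverse of `f`.
  -- It is again regular, as the classification of automorphisms requires.
  have hff : ∀ x, f (CP.conj (f x).1, CP.conj (f x).2) = (CP.conj x.1, CP.conj x.2) := by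
    intro x
    have h1 : ((CP.conj (CP.conj (f x).1), CP.conj (CP.conj (f x).2)) : CP 1 × CP 1) = f x := by
      rw [CP.conj_conj, CP.conj_conj]
    have h2 : ∀ z, z = f x → CP.conj (e ⟨z, trivial⟩).1 =
        (e ⟨(CP.conj x.1, CP.conj x.2), trivial⟩).1 := by
      rintro _ rfl
      rw [hef, CP.conj_conj]
    exact congrArg Subtype.val (e.injective (Subtype.ext
      ((hef (CP.conj (f x).1, CP.conj (f x).2)).trans (h2 _ h1))))
  obtain ⟨d₁, F₁, hF₁⟩ := hf₁
  obtain ⟨d₂, F₂, hF₂⟩ := hf₂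
  obtain ⟨a, b, ha, hb, H⟩ := exists_unit_matrices_of_inverse ⟨_, _, hF₁⟩ ⟨_, _, hF₂⟩
    ⟨_, _, hF₁.conj⟩ ⟨_, _, hF₂.conj⟩ (fun x => by simp [hff, CP.conj_conj])
    (fun x => by simp [hff, CP.conj_conj])
  have hcoord : ∀ p q u w, HasCoords p u → HasCoords q w → ∀ u' w', HasCoords (f (p, q)).1 u' →
      HasCoords (f (p, q)).2 w' → ∃ c : ℂ, conjLin P (segre u w) = c • P (segre u' w') := by
    intro p q u w hu hw u' w' hu' hw'
    have h1 := hc ⟨f (p, q), trivial⟩ u' w' hu' hw'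
    rw [hef (p, q)] at h1
    obtain ⟨c, -, e'⟩ := h1.exists_smul
      (hc ⟨(CP.conj p, CP.conj q), trivial⟩ _ _ hu.conj hw.conj).conj
    refine ⟨c, ?_⟩
    rw [← e', ← conjMat_segre]
    rfl
  have hv := exists_ne_zero_vec
  have hconj : ∀ Y, star (P Y) = conjLin P (conjMat Y) := fun Y => by
    simp [conjLin]
  have hc0 : ∀ (c : ℂ) (L : Mat3 →ₗ[ℂ] (Fin 9 → ℂ)), (∀ Y, conjLin P Y = c • L Y) → c ≠ 0 := by
    rintro c L hL rfl
    have h1 : conjLin P (segre (fun _ => 1) (fun _ => 1)) = 0 := by simp [hL]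
    exact segre_ne_zero hv hv ((map_eq_zero_iff _ (conjLin_injective P)).1 h1)
  refine ⟨a, b, ha, hb, ?_⟩
  rcases H with H | H
  · obtain ⟨c, hc'⟩ := exists_eq_smul_of_segre (L := P.toLinearMap ∘ₗ segreAct a b)
      (L' := conjLin P) (P.injective.comp (segreActEquiv ha hb).injective) (fun u w hu hw => by
        have hk := H _ _ _ _ (HasCoords.mk hu) (HasCoords.mk hw)
        rw [LinearMap.comp_apply, segreAct_segre]
        exact hcoord _ _ _ _ (HasCoords.mk hu) (HasCoords.mk hw) _ _ hk.1 hk.2)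
    exact ⟨c, hc0 c _ hc', Or.inl fun Y => (hconj Y).trans (hc' _)⟩
  · obtain ⟨c, hc'⟩ := exists_eq_smul_of_segre
      (L := P.toLinearMap ∘ₗ segreAct a b ∘ₗ (Matrix.transposeLinearEquiv _ _ ℂ ℂ).toLinearMap)
      (L' := conjLin P) (P.injective.comp ((segreActEquiv ha hb).injective.comp
        (LinearEquiv.injective _))) (fun u w hu hw => by
        have hk := H _ _ _ _ (HasCoords.mk hu) (HasCoords.mk hw)
        have : (P.toLinearMap ∘ₗ segreAct a b ∘ₗ
            (Matrix.transposeLinearEquiv _ _ ℂ ℂ).toLinearMap) (segre u w) =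
          P (segreAct a b (segre u w).transpose) := rfl
        rw [this, segre_transpose, segreAct_segre]
        exact hcoord _ _ _ _ (HasCoords.mk hu) (HasCoords.mk hw) _ _ hk.1 hk.2)
    exact ⟨c, hc0 c _ hc', Or.inr fun Y => (hconj Y).trans (hc' _)⟩

/-- The biregular automorphisms of a parametrized surface are restrictions of linear maps that
preserve the invariant form up to a factor. -/
theorem IsParam.exists_linear_of_biregular {P : Mat3 ≃ₗ[ℂ] (Fin 9 → ℂ)} {X : Set (CP 8)}
    (h : IsParam P X) {φ : X ≃ X} (hφ : IsBiregular φ) :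
    ∃ τ : Mat3 ≃ₗ[ℂ] Mat3,
      (∃ c : ℂ, c ≠ 0 ∧ ∀ Y Z, segreForm (τ Y) (τ Z) = c * segreForm Y Z) ∧
      ∀ x v, HasCoords x.1 v → HasCoords (φ x).1 (P (τ (P.symm v))) := by
  obtain ⟨e, ⟨he, he₁, he₂⟩, hc⟩ := h.exists_equiv
  let f : CP 1 × CP 1 → CP 1 × CP 1 := fun x => (e.symm (φ (e ⟨x, trivial⟩))).1
  let g : CP 1 × CP 1 → CP 1 × CP 1 := fun x => (e.symm (φ.symm (e ⟨x, trivial⟩))).1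
  have hfr : IsRegularMapProd Set.univ (fun x => (φ (e x)).1) :=
    IsRegularMapProd.comp hφ.1 he
  have hgr : IsRegularMapProd Set.univ (fun x => (φ.symm (e x)).1) :=
    IsRegularMapProd.comp hφ.2 he
  have hf₁ : ∃ d F, IsGlobalRep (fun x => (f x).1) d F :=
    IsRegularMapProd.exists_globalRep (IsRegularMapProd.comp (f := fun x => φ (e x)) he₁ hfr)
  have hf₂ : ∃ d F, IsGlobalRep (fun x => (f x).2) d F :=
    IsRegularMapProd.exists_globalRep (IsRegularMapProd.comp (f := fun x => φ (e x)) he₂ hfr)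
  have hg₁ : ∃ d F, IsGlobalRep (fun x => (g x).1) d F :=
    IsRegularMapProd.exists_globalRep (IsRegularMapProd.comp (f := fun x => φ.symm (e x)) he₁ hgr)
  have hg₂ : ∃ d F, IsGlobalRep (fun x => (g x).2) d F :=
    IsRegularMapProd.exists_globalRep (IsRegularMapProd.comp (f := fun x => φ.symm (e x)) he₂ hgr)
  have hgf : ∀ x, g (f x) = x := by
    intro x
    have h1 : e ⟨f x, trivial⟩ = φ (e ⟨x, trivial⟩) := e.apply_symm_apply _
    change (e.symm (φ.symm (e ⟨f x, trivial⟩))).1 = x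
    rw [h1, φ.symm_apply_apply, e.symm_apply_apply]
  obtain ⟨a, b, ha, hb, H⟩ := exists_unit_matrices_of_inverse hf₁ hf₂ hg₁ hg₂
    (fun x => congrArg Prod.fst (hgf x)) (fun x => congrArg Prod.snd (hgf x))
  have hpt : ∀ (x : X) v, HasCoords x.1 v → ∃ p q u w, ∃ c : ℂ, c ≠ 0 ∧ HasCoords p u ∧
      HasCoords q w ∧ x = e ⟨(p, q), trivial⟩ ∧ P.symm v = c • segre u w := by
    intro x v hv
    have h1 := hc (e.symm x) _ _ (HasCoords.rep _) (HasCoords.rep _)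
    rw [e.apply_symm_apply] at h1
    obtain ⟨c, hc, e'⟩ := h1.exists_smul hv
    refine ⟨_, _, _, _, c, hc, HasCoords.rep (e.symm x).1.1, HasCoords.rep (e.symm x).1.2,
      (e.apply_symm_apply x).symm, ?_⟩
    rw [e', map_smul, P.symm_apply_apply]
  have hef : ∀ x, φ (e ⟨x, trivial⟩) = e ⟨f x, trivial⟩ := fun x => (e.apply_symm_apply _).symm
  have hne : a.det ^ 2 * b.det ^ 2 ≠ 0 :=
    mul_ne_zero (pow_ne_zero _ ha.ne_zero) (pow_ne_zero _ hb.ne_zero)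
  rcases H with H | H
  · refine ⟨segreActEquiv ha hb, ⟨_, hne, fun Y Z => segreForm_segreAct a b Y Z⟩,
      fun x v hv => ?_⟩
    obtain ⟨p, q, u, w, c, hc0, hu, hw, rfl, e'⟩ := hpt x v hv
    have hk := H _ _ _ _ hu hw
    rw [hef, e', map_smul, map_smul, segreActEquiv_apply, segreAct_segre]
    exact (hc _ _ _ hk.1 hk.2).smul hc0
  · refine ⟨(Matrix.transposeLinearEquiv _ _ ℂ ℂ).trans (segreActEquiv ha hb),
      ⟨_, hne, fun Y Z => ?_⟩, fun x v hv => ?_⟩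
    · rw [← segreForm_transpose Y Z]
      exact segreForm_segreAct a b Y.transpose Z.transpose
    · obtain ⟨p, q, u, w, c, hc0, hu, hw, rfl, e'⟩ := hpt x v hv
      have hk := H _ _ _ _ hu hw
      have : (Matrix.transposeLinearEquiv (Fin 3) (Fin 3) ℂ ℂ).trans (segreActEquiv ha hb)
        (segre u w) = segreAct a b (segre u w).transpose := rfl
      rw [hef, e', map_smul, map_smul, this, segre_transpose, segreAct_segre]
      exact (hc _ _ _ hk.1 hk.2).smul hc0

/-! ### Real projective transformations -/

/-- Hilbert 90 for ℂ over ℝ: a square root `μ` of the unimodular number `c` satisfies `star μ * μ =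
1`. -/
theorem exists_star_mul_eq {c : ℂ} (h : star c * c = 1) : ∃ μ : ℂ, μ ≠ 0 ∧ star μ * c = μ := by
  obtain ⟨μ, hμ⟩ := IsAlgClosed.exists_pow_nat_eq c (n := 2) two_pos
  have h1 : star μ * μ = (Complex.normSq μ : ℂ) := Complex.normSq_eq_conj_mul_self.symm
  have h2 : (Complex.normSq μ : ℂ) ^ 2 = 1 := by
    rw [← h1, mul_pow, ← star_pow, hμ, h]
  have h3 : Complex.normSq μ = 1 := by
    have : Complex.normSq μ ^ 2 = 1 := by exact_mod_cast h2
    nlinarith [Complex.normSq_nonneg μ]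
  rw [h3] at h1
  refine ⟨μ, ?_, ?_⟩
  · rintro rfl; simp at h1
  · rw [← hμ, sq, ← mul_assoc, h1]; simp

theorem exists_real_matrix {n : ℕ} {L : (Fin n → ℂ) →ₗ[ℂ] (Fin n → ℂ)}
    (hL : Function.Injective L) (h : ∀ v, star (L v) = L (star v)) :
    ∃ M : GL (Fin n) ℝ, ∀ v, (M.1.map Complex.ofReal).mulVec v = L v := by
  let N : Matrix (Fin n) (Fin n) ℝ := Matrix.of fun i j => (L (Pi.single j 1) i).re
  have hN : ∀ v, (N.map Complex.ofReal).mulVec v = L v := by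
    have : N.map Complex.ofReal = LinearMap.toMatrix' L := by
      ext i j
      have h1 := congrFun (h (Pi.single j 1)) i
      rw [Pi.star_apply, ← starRingEnd_apply] at h1
      have h2 : star (Pi.single j (1 : ℂ) : Fin n → ℂ) = Pi.single j 1 := by
        rw [Pi.star_single, star_one]
      rw [h2] at h1
      rw [LinearMap.toMatrix'_apply]
      simpa [N, Pi.single_apply] using Complex.conj_eq_iff_re.1 h1
    intro v
    rw [this, LinearMap.toMatrix'_mulVec]
  have hdet : N.det ≠ 0 := by
    intro h0
    have h1 : (N.map Complex.ofReal).det = 0 := by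
      have := RingHom.map_det Complex.ofRealHom N
      rw [h0, map_zero] at this
      exact this.symm
    obtain ⟨v, hv, e⟩ := Matrix.exists_mulVec_eq_zero_iff.2 h1
    rw [hN] at e
    exact hv ((map_eq_zero_iff L hL).1 e)
  exact ⟨Matrix.GeneralLinearGroup.mkOfDetNeZero N hdet, hN⟩

/-- Conjugating twice shows that `c` is unimodular, and rescaling `L` by the number from
`exists_star_mul_eq` makes it commute with conjugation, that is, real. -/
theorem exists_real_matrix_of_smul {n : ℕ} {L : (Fin n → ℂ) →ₗ[ℂ] (Fin n → ℂ)}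
    (hL : Function.Injective L) {c : ℂ} (h : ∀ v, star (L v) = c • L (star v)) :
    ∃ M : GL (Fin n) ℝ, ∃ μ : ℂ, μ ≠ 0 ∧ ∀ v, (M.1.map Complex.ofReal).mulVec v = μ • L v := by
  rcases isEmpty_or_nonempty (Fin n) with hn | ⟨⟨i⟩⟩
  · exact ⟨1, 1, one_ne_zero, fun v => Subsingleton.elim _ _⟩
  have hv : L (Pi.single i 1) ≠ 0 := by
    rw [Ne, map_eq_zero_iff L hL]
    exact fun h => one_ne_zero (Pi.single_eq_zero_iff.1 h)
  have h1 : (star c * c) • L (Pi.single i 1) = L (Pi.single i 1) := by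
    have h3 := h (star (Pi.single i 1))
    have h4 := congrArg star (h (Pi.single i 1))
    rw [star_star] at h3
    rw [star_star, star_smul, h3, smul_smul] at h4
    exact h4.symm
  have h2 : star c * c = 1 := by
    have : (star c * c - 1) • L (Pi.single i 1) = 0 := by rw [sub_smul, one_smul, h1, sub_self]
    exact sub_eq_zero.1 ((smul_eq_zero.1 this).resolve_right hv)
  obtain ⟨μ, hμ, e⟩ := exists_star_mul_eq h2
  obtain ⟨M, hM⟩ := exists_real_matrix (L := μ • L)
    (fun v w h => hL (smul_right_injective _ hμ h)) (fun v => by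
      rw [LinearMap.smul_apply, LinearMap.smul_apply, star_smul, h, smul_smul, e])
  exact ⟨M, μ, hμ, hM⟩

namespace CP

theorem transf_conj {n : ℕ} (M : GL (Fin (n + 1)) ℝ) (p : CP n) :
    transf M (conj p) = conj (transf M p) := by
  have h := HasCoords.rep p
  have h1 := h.conj.transf M
  have h2 := (h.transf M).conj
  have : star ((M.1.map Complex.ofReal).mulVec p.rep) =
      (M.1.map Complex.ofReal).mulVec (star p.rep) := by
    ext i
    simp [Matrix.mulVec, dotProduct]
  rw [this] at h2
  exact h1.eq h2

theorem transf_mul {n : ℕ} (M N : GL (Fin (n + 1)) ℝ) (p : CP n) :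
    transf (M * N) p = transf M (transf N p) := by
  unfold transf
  rw [map_mul, mul_smul]

theorem transf_one {n : ℕ} (p : CP n) : transf (1 : GL (Fin (n + 1)) ℝ) p = p := by
  unfold transf
  rw [map_one, one_smul]

theorem transf_inv_transf {n : ℕ} (M : GL (Fin (n + 1)) ℝ) (p : CP n) :
    transf M⁻¹ (transf M p) = p := by
  rw [← transf_mul, inv_mul_cancel, transf_one]

theorem transf_transf_inv {n : ℕ} (M : GL (Fin (n + 1)) ℝ) (p : CP n) :
    transf M (transf M⁻¹ p) = p := by
  rw [← transf_mul, mul_inv_cancel, transf_one]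

theorem continuous_transf {n : ℕ} (M : GL (Fin (n + 1)) ℝ) : Continuous (transf M) :=
  continuous_of_coords (p := fun p => p) continuous_id
    (G := fun _ v => (M.1.map Complex.ofReal).mulVec v) (by
      simp only [Function.uncurry_def]
      fun_prop) (fun _ _ h => h.transf M)

/-- The restriction of a real projective transformation to a subset that it preserves. -/
noncomputable def transfMap {n : ℕ} (M : GL (Fin (n + 1)) ℝ) {S : Set (CP n)}
    (h : ∀ p, p ∈ S ↔ transf M p ∈ S) : C(S, S) where
  toFun p := ⟨transf M p.1, (h _).1 p.2⟩
  continuous_toFun := ((continuous_transf M).comp continuous_subtype_val).subtype_mk _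

theorem transfMap_mem_realAut {n : ℕ} (M : GL (Fin (n + 1)) ℝ) {S : Set (CP n)}
    (h : ∀ p, p ∈ S ↔ transf M p ∈ S) : transfMap M h ∈ realAut S := by
  let e : S ≃ S :=
    { toFun := fun p => ⟨transf M p.1, (h _).1 p.2⟩
      invFun := fun p => ⟨transf M⁻¹ p.1, (h _).2 (by rw [transf_transf_inv]; exact p.2)⟩
      left_inv := fun p => Subtype.ext (transf_inv_transf M _)
      right_inv := fun p => Subtype.ext (transf_transf_inv M _) }
  have reg : ∀ N : GL (Fin (n + 1)) ℝ, IsRegularMap S fun p => transf N p.1 := fun N =>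
    isRegularMap_of_linear fun a => ⟨(N.1.map Complex.ofReal).mulVecLin,
      fun v hv => (hv.transf N).ne_zero, fun b v hv _ => hv.transf N⟩
  refine ⟨e, ⟨reg M, reg M⁻¹⟩, fun x x' hx => ?_, fun x => rfl⟩
  change transf M x'.1 = conj (transf M x.1)
  rw [hx, transf_conj]

/-- A projective transformation depends continuously on the images of a projective frame. -/
theorem continuous_of_frame {n : ℕ} {T ι : Type*} [TopologicalSpace T] [Fintype ι] [DecidableEq ι]
    (E : (ι → ℂ) ≃ₗ[ℂ] (Fin (n + 1) → ℂ)) {c : ι → ℂ} (hc : ∀ k, c k ≠ 0) {x : ι → T → CP n}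
    (hx : ∀ k, Continuous (x k)) {y q f : T → CP n} (hy : Continuous y) (hq : Continuous q)
    (h : ∀ t, ∃ L : (Fin (n + 1) → ℂ) →ₗ[ℂ] (Fin (n + 1) → ℂ), Function.Injective L ∧
      (∀ k, HasCoords (x k t) (L (E (Pi.single k 1)))) ∧ HasCoords (y t) (L (E c)) ∧
      ∀ w, HasCoords (q t) w → HasCoords (f t) (L w)) : Continuous f := by
  rw [continuous_iff_continuousAt]
  intro t₀
  have lift : ∀ {z : T → CP n}, Continuous z → ∃ v : T → Fin (n + 1) → ℂ, ContinuousAt v t₀ ∧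
      ∀ᶠ t in 𝓝 t₀, HasCoords (z t) (v t) := by
    intro z hz
    obtain ⟨σ, hσ, hσ'⟩ := exists_lift (z t₀)
    exact ⟨fun t => σ (z t), ContinuousAt.comp (f := z) hσ hz.continuousAt,
      hz.continuousAt.eventually hσ'⟩
  choose v hv hv' using fun k => lift (hx k)
  obtain ⟨vy, hvy, hvy'⟩ := lift hy
  obtain ⟨w, hw, hw'⟩ := lift hq
  have hE : Continuous E := LinearMap.continuous_of_finiteDimensional E.toLinearMap
  have hE' : Continuous E.symm := LinearMap.continuous_of_finiteDimensional E.symm.toLinearMap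
  let V : T → Matrix ι ι ℂ := fun t => Matrix.of fun r k => E.symm (v k t) r
  have hV : ContinuousAt V t₀ := by
    refine continuousAt_pi.2 fun r => continuousAt_pi.2 fun k => ?_
    exact ((continuous_apply r).comp hE').continuousAt.comp (hv k)
  -- The columns of `V` are lifts of the frame images with unknown factors αₖ, and the lift of `y`
  -- has an unknown factor β. Solving V z = y by Cramer's rule yields zₖ = β cₖ / αₖ times det V.
  -- Division by cₖ thus balances the columns, and the result is a nonzero multiple of `L (w t)`
  -- that is continuous in `t`.
  have hr : ContinuousAt (fun t => E ((V t).mulVec fun k =>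
      Matrix.cramer (V t) (E.symm (vy t)) k / c k * E.symm (w t) k)) t₀ := by
    have hcr : Continuous fun a : Matrix ι ι ℂ × (ι → ℂ) × (ι → ℂ) =>
        E (a.1.mulVec fun k => Matrix.cramer a.1 a.2.1 k / c k * a.2.2 k) := by
      refine hE.comp (Continuous.matrix_mulVec continuous_fst (continuous_pi fun k => ?_))
      have h1 : Continuous fun a : Matrix ι ι ℂ × (ι → ℂ) × (ι → ℂ) =>
        Matrix.cramer a.1 a.2.1 := continuous_fst.matrix_cramer (continuous_fst.comp continuous_snd)
      have h2 := (continuous_apply k).comp h1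
      exact (h2.div_const _).mul
        ((continuous_apply k).comp (continuous_snd.comp continuous_snd))
    have h3 : ContinuousAt (fun t => (V t, E.symm (vy t), E.symm (w t))) t₀ :=
      hV.prodMk ((hE'.continuousAt.comp hvy).prodMk (hE'.continuousAt.comp hw))
    exact ContinuousAt.comp (f := fun t => (V t, E.symm (vy t), E.symm (w t)))
      hcr.continuousAt h3
  refine continuousAt_of_hasCoords hr ?_
  filter_upwards [eventually_all.2 hv', hvy', hw'] with t h1 h2 h3
  obtain ⟨L, hL, k1, k2, k3⟩ := h t
  choose α hα eα using fun k => (k1 k).exists_smul (h1 k)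
  obtain ⟨β, hβ, eβ⟩ := k2.exists_smul h2
  have hsum : ∀ z : ι → ℂ, E z = ∑ k, z k • E (Pi.single k 1) := by
    intro z
    conv_lhs => rw [pi_eq_sum_univ' z, map_sum]
    simp only [map_smul]
  have hVm : ∀ z : ι → ℂ, E ((V t).mulVec z) = L (E fun k => α k * z k) := by
    intro z
    have : (V t).mulVec z = ∑ k, z k • E.symm (v k t) := by
      ext r
      simp [V, Matrix.mulVec, dotProduct, mul_comm]
    rw [this, hsum fun k => α k * z k]
    simp only [map_sum, map_smul, E.apply_symm_apply, eα, smul_smul]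
    exact Finset.sum_congr rfl fun k _ => by rw [mul_comm]
  have hdet : (V t).det ≠ 0 := by
    intro h0
    obtain ⟨z, hz, e⟩ := Matrix.exists_mulVec_eq_zero_iff.2 h0
    have h4 := hVm z
    rw [e, map_zero, eq_comm, map_eq_zero_iff L hL, E.map_eq_zero_iff] at h4
    refine hz (funext fun k => ?_)
    exact (mul_eq_zero.1 (congrFun h4 k)).resolve_left (hα k)
  have hvyV : E.symm (vy t) = (V t).mulVec fun k => β * c k / α k := by
    rw [E.symm_apply_eq, hVm, eβ, ← map_smul, ← map_smul]
    congr 2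
    ext k
    have := hα k
    simp only [Pi.smul_apply, smul_eq_mul]
    field_simp
  have hcr : ∀ z, Matrix.cramer (V t) ((V t).mulVec z) = (V t).det • z := by
    intro z
    rw [Matrix.cramer_eq_adjugate_mulVec, Matrix.mulVec_mulVec, Matrix.adjugate_mul,
      Matrix.smul_mulVec, Matrix.one_mulVec]
  have hfin : E ((V t).mulVec fun k =>
      Matrix.cramer (V t) (E.symm (vy t)) k / c k * E.symm (w t) k) =
      ((V t).det * β) • L (w t) := by
    rw [hVm, hvyV, hcr, ← map_smul]
    congr 1
    conv_rhs => rw [← E.apply_symm_apply (w t), ← map_smul]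
    congr 1
    ext k
    have := hα k
    have := hc k
    simp only [Pi.smul_apply, smul_eq_mul]
    field_simp
  rw [hfin]
  exact (k3 _ h3).smul (mul_ne_zero hdet hβ)

end CP

/-! ### Automorphisms of the surface act on the invariant quadric -/

/-- The complex bilinear form of a real matrix. -/
noncomputable def cform {n : ℕ} (A : Matrix (Fin n) (Fin n) ℝ) (v w : Fin n → ℂ) : ℂ :=
  v ⬝ᵥ (A.map Complex.ofReal).mulVec w

theorem mem_quadric_param {A : Matrix (Fin 9) (Fin 9) ℝ} {P : Mat3 ≃ₗ[ℂ] (Fin 9 → ℂ)} {k : ℂ}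
    (hk : k ≠ 0) (hA : ∀ Y Z, cform A (P Y) (P Z) = k * segreForm Y Z) {p : CP 8}
    {v : Fin 9 → ℂ} (hv : HasCoords p v) :
    p ∈ quadric A ↔ segreForm (P.symm v) (P.symm v) = 0 := by
  have h := hA (P.symm v) (P.symm v)
  rw [P.apply_symm_apply] at h
  rw [CP.mem_quadric hv]
  change cform A v v = 0 ↔ _
  rw [h, mul_eq_zero, or_iff_right hk]

theorem IsParam.subset_quadric {A : Matrix (Fin 9) (Fin 9) ℝ} {P : Mat3 ≃ₗ[ℂ] (Fin 9 → ℂ)}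
    {X : Set (CP 8)} (h : IsParam P X) {k : ℂ}
    (hk : k ≠ 0) (hA : ∀ Y Z, cform A (P Y) (P Z) = k * segreForm Y Z) : X ⊆ quadric A := by
  intro p hp
  obtain ⟨u, w, -, -, hv⟩ := (h p).1 hp
  rw [mem_quadric_param hk hA hv, P.symm_apply_apply, segreForm_segre]

/-- Automorphisms of a parametrized real surface extend to real projective transformations that
preserve the quadric of the invariant form. -/
theorem IsParam.exists_transf {A : Matrix (Fin 9) (Fin 9) ℝ} {P : Mat3 ≃ₗ[ℂ] (Fin 9 → ℂ)}
    {X : Set (CP 8)} (h : IsParam P X) (hX : CP.IsReal X) {k : ℂ}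
    (hk : k ≠ 0) (hA : ∀ Y Z, cform A (P Y) (P Z) = k * segreForm Y Z) {φ : C(X, X)}
    (hφ : φ ∈ realAut X) : ∃ M : GL (Fin 9) ℝ, (∀ x : X, (φ x).1 = CP.transf M x.1) ∧
      ∀ p, p ∈ quadric A ↔ CP.transf M p ∈ quadric A := by
  obtain ⟨e, he, hcomm, hφe⟩ := hφ
  obtain ⟨τ, ⟨c, hc, hτ⟩, hL⟩ := h.exists_linear_of_biregular he
  let L : (Fin 9 → ℂ) ≃ₗ[ℂ] (Fin 9 → ℂ) := (P.symm.trans τ).trans P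
  let L' : Mat3 →ₗ[ℂ] (Fin 9 → ℂ) :=
    { toFun := fun Y => star (L (star (P Y)))
      map_add' := fun Y Z => by rw [map_add, star_add, map_add, star_add]
      map_smul' := fun c Y => by
        rw [map_smul, star_smul, map_smul, star_smul, star_star, RingHom.id_apply] }
  -- Because `φ` commutes with conjugation, `L` and its complex conjugate induce the same map on X.
  -- They are therefore proportional, and a multiple of `L` is real.
  obtain ⟨d, hd⟩ := exists_eq_smul_of_segre (L := L.toLinearMap ∘ₗ P.toLinearMap) (L' := L')
    (L.injective.comp P.injective) (fun u w hu hw => by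
      have hp : HasCoords _ (P (segre u w)) := HasCoords.mk (param_ne_zero P hu hw)
      have hm := h.mem hu hw hp
      have h1 := hL ⟨_, hm⟩ _ hp
      have h2 := (hL ⟨_, hX _ hm⟩ _ hp.conj).conj
      rw [hcomm ⟨_, hm⟩ ⟨_, hX _ hm⟩ rfl, CP.conj_conj] at h2
      obtain ⟨s, -, es⟩ := h1.exists_smul h2
      exact ⟨s, es⟩)
  have hstar : ∀ v, star (L v) = d • L (star v) := by
    intro v
    have := hd (P.symm (star v))
    change star (L (star (P (P.symm (star v))))) = d • L (P (P.symm (star v))) at this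
    rwa [P.apply_symm_apply, star_star] at this
  obtain ⟨M, μ, hμ, hM⟩ := exists_real_matrix_of_smul (L := L.toLinearMap) L.injective hstar
  have hMc : ∀ p v, HasCoords p v → HasCoords (CP.transf M p) (L v) := by
    intro p v hv
    have := hv.transf M
    rw [hM] at this
    exact this.of_smul
  refine ⟨M, fun x => ?_, fun p => ?_⟩
  · rw [hφe]
    exact (hL x _ (HasCoords.rep _)).eq (hMc _ _ (HasCoords.rep _))
  · rw [mem_quadric_param hk hA (HasCoords.rep p),
      mem_quadric_param hk hA (hMc _ _ (HasCoords.rep p))]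
    simp only [L, LinearEquiv.trans_apply, P.symm_apply_apply, hτ, mul_eq_zero, hc, false_or]

/-- The basis of `ℂ⁹` that is given by nine points of a parametrized surface. -/
noncomputable def paramFrame (P : Mat3 ≃ₗ[ℂ] (Fin 9 → ℂ)) :
    (Fin 3 × Fin 3 → ℂ) ≃ₗ[ℂ] (Fin 9 → ℂ) :=
  ((LinearEquiv.curry ℂ ℂ (Fin 3) (Fin 3)).trans (segreFrame : (Fin 3 → Fin 3 → ℂ) ≃ₗ[ℂ] Mat3)).trans P

theorem paramFrame_single (P : Mat3 ≃ₗ[ℂ] (Fin 9 → ℂ)) (k : Fin 3 × Fin 3) :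
    paramFrame P (Pi.single k 1) = P (segre (lineFrame k.1) (lineFrame k.2)) := by
  have : (LinearEquiv.curry ℂ ℂ (Fin 3) (Fin 3) (Pi.single k 1) : Mat3) =
      Matrix.single k.1 k.2 1 := by
    ext i j
    simp [Matrix.single_apply, Pi.single_apply, Prod.ext_iff, eq_comm]
  rw [← segreFrame_single, ← this]
  rfl

theorem paramFrame_unit (P : Mat3 ≃ₗ[ℂ] (Fin 9 → ℂ)) :
    paramFrame P (fun k => unitCoeff k.1 * unitCoeff k.2) = P (segre lineUnit lineUnit) := by
  rw [← segreFrame_unit]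
  rfl

/-- Fixing X pointwise means being proportional to the identity at every point of X, and the surface
contains a projective frame. -/
theorem IsParam.transf_eq_of_fixed {P : Mat3 ≃ₗ[ℂ] (Fin 9 → ℂ)}
    {X : Set (CP 8)} (h : IsParam P X) {M : GL (Fin 9) ℝ}
    (hM : ∀ x ∈ X, CP.transf M x = x) (p : CP 8) : CP.transf M p = p := by
  obtain ⟨d, hd⟩ := exists_eq_smul_of_segre (L := P.toLinearMap)
    (L' := (M.1.map Complex.ofReal).mulVecLin ∘ₗ P.toLinearMap) P.injective (fun u w hu hw => by
      have hp : HasCoords _ (P (segre u w)) := HasCoords.mk (param_ne_zero P hu hw)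
      have h1 := hp.transf M
      rw [hM _ (h.mem hu hw hp)] at h1
      obtain ⟨s, -, es⟩ := hp.exists_smul h1
      exact ⟨s, es⟩)
  have h1 := (HasCoords.rep p).transf M
  have h2 := hd (P.symm p.rep)
  simp only [LinearMap.comp_apply, LinearEquiv.coe_coe, P.apply_symm_apply,
    Matrix.mulVecLin_apply] at h2
  rw [h2] at h1
  exact h1.of_smul.eq (HasCoords.rep p)

/-- The identity component of the automorphism group of a parametrized real surface is contained
in that of the quadric of the invariant form. -/
theorem IsParam.autZeroSubset {A : Matrix (Fin 9) (Fin 9) ℝ} {P : Mat3 ≃ₗ[ℂ] (Fin 9 → ℂ)}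
    {X : Set (CP 8)} (h : IsParam P X) (hX : CP.IsReal X) {k : ℂ}
    (hk : k ≠ 0) (hA : ∀ Y Z, cform A (P Y) (P Z) = k * segreForm Y Z) :
    AutZeroSubset X (quadric A) := by
  classical
  -- The matrix `M φ` is an arbitrary choice, but the transformation of ℙ⁸ is determined by `φ`,
  -- which makes continuity of its restriction to the quadric possible.
  choose M hMX hMQ using fun φ : realAut X => h.exists_transf hX hk hA φ.2
  let Φ : realAut X → C(quadric A, quadric A) := fun φ => CP.transfMap (M φ) (hMQ φ)
  have hΦ : Continuous Φ := by
    refine ContinuousMap.continuous_of_continuous_uncurry _ ?_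
    refine Continuous.subtype_mk ?_ _
    have hpt : ∀ u w : Fin 2 → ℂ, u ≠ 0 → w ≠ 0 → ∃ x : X, HasCoords x.1 (P (segre u w)) :=
      fun u w hu hw => ⟨⟨_, h.mem hu hw (HasCoords.mk (param_ne_zero P hu hw))⟩,
        HasCoords.mk _⟩
    choose b hb using fun k : Fin 3 × Fin 3 =>
      hpt _ _ (lineFrame_ne_zero k.1) (lineFrame_ne_zero k.2)
    obtain ⟨b', hb'⟩ := hpt _ _ lineUnit_ne_zero lineUnit_ne_zero
    have hev : ∀ x : X, Continuous fun t : realAut X × quadric A => (t.1.1 x).1 := fun x =>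
      continuous_subtype_val.comp ((continuous_eval_const x).comp
        (continuous_subtype_val.comp continuous_fst))
    -- Evaluation of `φ` at the ten frame points is continuous for the compact-open topology, and
    -- their images determine the transformation.
    refine CP.continuous_of_frame (paramFrame P)
      (c := fun k => unitCoeff k.1 * unitCoeff k.2)
      (fun k => mul_ne_zero (unitCoeff_ne_zero _) (unitCoeff_ne_zero _))
      (x := fun k t => (t.1.1 (b k)).1) (y := fun t => (t.1.1 b').1) (q := fun t => t.2.1)
      (fun k => hev _) (hev _) (continuous_subtype_val.comp continuous_snd) fun t => ?_
    have hinj : Function.Injective ((M t.1).1.map Complex.ofReal).mulVecLin := by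
      rw [injective_iff_map_eq_zero]
      intro v hv
      by_contra h0
      exact ((HasCoords.mk h0).transf (M t.1)).ne_zero hv
    refine ⟨((M t.1).1.map Complex.ofReal).mulVecLin, hinj, fun k => ?_, ?_, fun w hw =>
      hw.transf _⟩
    · rw [paramFrame_single, hMX]
      exact (hb k).transf _
    · rw [paramFrame_unit, hMX]
      exact hb'.transf _
  intro φ hφ
  have hφ' := connectedComponentIn_subset _ _ hφ
  refine ⟨M ⟨φ, hφ'⟩, Φ ⟨φ, hφ'⟩, ?_, hMX ⟨φ, hφ'⟩, fun y => rfl⟩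
  -- `connectedComponentIn` is empty when its base point lies outside the set, so the membership of
  -- `φ` already puts the identity in `realAut X`.
  have hid : ContinuousMap.id X ∈ realAut X := by
    by_contra h0
    rw [realAutZero, connectedComponentIn_eq_empty h0] at hφ
    exact hφ
  have hsub : realAut X ∩ realAutZero X = realAutZero X :=
    Set.inter_eq_right.2 (connectedComponentIn_subset _ _)
  have hpre : IsPreconnected (Φ '' (Subtype.val ⁻¹' realAutZero X)) := by
    refine IsPreconnected.image ?_ _ hΦ.continuousOn
    rw [← Topology.IsInducing.subtypeVal.isPreconnected_image, Subtype.image_preimage_coe,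
      hsub]
    exact isPreconnected_connectedComponentIn
  have hΦid : Φ ⟨_, hid⟩ = ContinuousMap.id _ := by
    ext1 y
    refine Subtype.ext (h.transf_eq_of_fixed (fun x hx => ?_) y.1)
    exact (hMX ⟨_, hid⟩ ⟨x, hx⟩).symm
  refine hpre.subset_connectedComponentIn ?_ ?_ ⟨⟨φ, hφ'⟩, hφ, rfl⟩
  · exact ⟨⟨_, hid⟩, mem_connectedComponentIn hid, hΦid⟩
  · rintro _ ⟨ψ, -, rfl⟩
    exact CP.transfMap_mem_realAut _ _

/-! ### Uniqueness of the invariant form -/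

/-- A quadratic form that vanishes on a quadric of rank at least two is a multiple of its
equation. -/
theorem exists_eq_smul_of_vanishing {V : Type*} [AddCommGroup V] [Module ℂ V]
    {B B' : V →ₗ[ℂ] V →ₗ[ℂ] ℂ} (hB : ∀ v w, B v w = B w v) (hB' : ∀ v w, B' v w = B' w v)
    {v v' : V} (hv : B v v ≠ 0) (hv' : B v' v ^ 2 - B v v * B v' v' ≠ 0)
    (h : ∀ w, B w w = 0 → B' w w = 0) : ∃ c, ∀ w w', B' w w' = c * B w w' := by
  have expand : ∀ (b : V →ₗ[ℂ] V →ₗ[ℂ] ℂ), (∀ v w, b v w = b w v) → ∀ (t : ℂ) (x y : V),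
      b (x + t • y) (x + t • y) = b x x + 2 * t * b x y + t ^ 2 * b y y := by
    intro b hb t x y
    simp only [map_add, LinearMap.add_apply, map_smul, LinearMap.smul_apply, smul_eq_mul, hb y x]
    ring
  set c := B' v v / B v v with hc
  -- If the discriminant is nonzero, the line w + t v meets the quadric in two distinct points. Both
  -- forms vanish at both points, so their restrictions to the line are proportional, with ratio `c`
  -- fixed by the value at `v`.
  have step1 : ∀ w, B w v ^ 2 - B v v * B w w ≠ 0 → B' w w - c * B w w = 0 := by
    intro w hw
    obtain ⟨s, hs⟩ := IsAlgClosed.exists_pow_nat_eq (B w v ^ 2 - B v v * B w w) (n := 2) two_pos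
    have hs0 : s ≠ 0 := by rintro rfl; exact hw (by rw [← hs]; ring)
    have root : ∀ r : ℂ, r ^ 2 = s ^ 2 →
        B' w w + 2 * ((-B w v + r) / B v v) * B' w v + ((-B w v + r) / B v v) ^ 2 * B' v v = 0 := by
      intro r hr
      rw [← expand B' hB']
      apply h
      rw [expand B hB]
      field_simp
      linear_combination hr + hs
    have h1 := root s rfl
    have h2 := root (-s) (by ring)
    have h3 : B' w v * B v v = B w v * B' v v := by
      have h4 : s * (B' w v * B v v - B w v * B' v v) = 0 := by
        field_simp at h1 h2
        linear_combination (h1 - h2) / 4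
      exact sub_eq_zero.1 ((mul_eq_zero.1 h4).resolve_left hs0)
    field_simp at h1
    rw [hc]
    field_simp
    have h5 : B v v * (B' w w * B v v - B' v v * B w w) = 0 := by
      linear_combination h1 - 2 * (-B w v + s) * h3 - B' v v * hs
    linear_combination ((mul_eq_zero.1 h5).resolve_left hv)
  -- An arbitrary `w` is moved along `v'`. The discriminant `q` is a nonzero polynomial in t, its
  -- leading coefficient being the one in `hv'`, so the defect `p` vanishes identically, in
  -- particular at t = 0.
  have step2 : ∀ w, B' w w - c * B w w = 0 := by
    intro w
    let p : Polynomial ℂ := Polynomial.C (B' w w - c * B w w) +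
      Polynomial.C (2 * (B' w v' - c * B w v')) * Polynomial.X +
      Polynomial.C (B' v' v' - c * B v' v') * Polynomial.X ^ 2
    let q : Polynomial ℂ := Polynomial.C (B w v ^ 2 - B v v * B w w) +
      Polynomial.C (2 * (B w v * B v' v - B v v * B w v')) * Polynomial.X +
      Polynomial.C (B v' v ^ 2 - B v v * B v' v') * Polynomial.X ^ 2
    have hp : ∀ t, p.eval t = B' (w + t • v') (w + t • v') - c * B (w + t • v') (w + t • v') := by
      intro t
      rw [expand B hB, expand B' hB']
      simp [p]
      ring
    have hq : ∀ t, q.eval t = B (w + t • v') v ^ 2 - B v v * B (w + t • v') (w + t • v') := by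
      intro t
      rw [expand B hB]
      simp [q]
      ring
    have hpq : p * q = 0 := by
      apply Polynomial.funext
      intro t
      rw [Polynomial.eval_mul, Polynomial.eval_zero]
      by_cases h0 : q.eval t = 0
      · rw [h0, mul_zero]
      · rw [hp, step1 _ (by rw [← hq]; exact h0), zero_mul]
    have hq0 : q ≠ 0 := by
      intro h0
      have := congrArg (fun r => Polynomial.coeff r 2) h0
      simp only [q, Polynomial.coeff_add, Polynomial.coeff_C_mul, Polynomial.coeff_X_pow,
        Polynomial.coeff_C, Polynomial.coeff_X] at this
      exact hv' (by simpa using this)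
    have hp0 := (mul_eq_zero.1 hpq).resolve_right hq0
    have := hp 0
    rw [hp0] at this
    simpa using this.symm
  refine ⟨c, fun w w' => ?_⟩
  have h1 := step2 (w + (1 : ℂ) • w')
  rw [expand B hB, expand B' hB'] at h1
  have h2 := step2 w
  have h3 := step2 w'
  linear_combination (h1 - h2 - h3) / 2

/-! ### Infinitesimal symmetries and semi-invariant forms -/

/-- The derivative of `sym2` at the identity. -/
def dsym2 (g : Matrix (Fin 2) (Fin 2) ℂ) : Mat3 :=
  !![g 0 0 + g 1 1, g 0 0 - g 1 1, g 0 1 + g 1 0;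
    g 0 0 - g 1 1, g 0 0 + g 1 1, g 0 1 - g 1 0;
    g 0 1 + g 1 0, g 1 0 - g 0 1, g 0 0 + g 1 1]

theorem sym2_one_add_smul (t : ℂ) (g : Matrix (Fin 2) (Fin 2) ℂ) :
    sym2 (1 + t • g) = 1 + t • dsym2 g + t ^ 2 • sym2 g := by
  ext i j
  fin_cases i <;> fin_cases j <;> simp [sym2, dsym2] <;> ring

theorem dsym2_add (g h : Matrix (Fin 2) (Fin 2) ℂ) : dsym2 (g + h) = dsym2 g + dsym2 h := by
  ext i j
  fin_cases i <;> fin_cases j <;> simp [dsym2] <;> ring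

theorem dsym2_smul (c : ℂ) (g : Matrix (Fin 2) (Fin 2) ℂ) : dsym2 (c • g) = c • dsym2 g := by
  ext i j
  fin_cases i <;> fin_cases j <;> simp [dsym2] <;> ring

/-- The infinitesimal action of a pair of matrices. -/
def segreLie (W : Matrix (Fin 2) (Fin 2) ℂ × Matrix (Fin 2) (Fin 2) ℂ) (Y : Mat3) : Mat3 :=
  dsym2 W.1 * Y + Y * (dsym2 W.2).transpose

theorem segreLie_add (W W' : Matrix (Fin 2) (Fin 2) ℂ × Matrix (Fin 2) (Fin 2) ℂ) (Y : Mat3) :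
    segreLie (W + W') Y = segreLie W Y + segreLie W' Y := by
  simp only [segreLie, Prod.fst_add, Prod.snd_add, dsym2_add, add_mul, mul_add,
    Matrix.transpose_add]
  abel

theorem segreLie_smul (c : ℂ) (W : Matrix (Fin 2) (Fin 2) ℂ × Matrix (Fin 2) (Fin 2) ℂ)
    (Y : Mat3) : segreLie (c • W) Y = c • segreLie W Y := by
  simp [segreLie, Prod.smul_fst, Prod.smul_snd, dsym2_smul]

/-- The form `a` is multiplied by a factor under the infinitesimal action of `W`. -/
def IsSemiInvariant (a : Mat3 →ₗ[ℂ] Mat3 →ₗ[ℂ] ℂ)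
    (W : Matrix (Fin 2) (Fin 2) ℂ × Matrix (Fin 2) (Fin 2) ℂ) : Prop :=
  ∃ c : ℂ, ∀ Y Z, a (segreLie W Y) Z + a Y (segreLie W Z) = c * a Y Z

theorem IsSemiInvariant.add {a : Mat3 →ₗ[ℂ] Mat3 →ₗ[ℂ] ℂ}
    {W W' : Matrix (Fin 2) (Fin 2) ℂ × Matrix (Fin 2) (Fin 2) ℂ} (h : IsSemiInvariant a W)
    (h' : IsSemiInvariant a W') : IsSemiInvariant a (W + W') := by
  obtain ⟨c, hc⟩ := h
  obtain ⟨c', hc'⟩ := h'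
  refine ⟨c + c', fun Y Z => ?_⟩
  simp only [segreLie_add, map_add, LinearMap.add_apply]
  linear_combination hc Y Z + hc' Y Z

theorem IsSemiInvariant.smul {a : Mat3 →ₗ[ℂ] Mat3 →ₗ[ℂ] ℂ}
    {W : Matrix (Fin 2) (Fin 2) ℂ × Matrix (Fin 2) (Fin 2) ℂ} (h : IsSemiInvariant a W)
    (s : ℂ) : IsSemiInvariant a (s • W) := by
  obtain ⟨c, hc⟩ := h
  refine ⟨s * c, fun Y Z => ?_⟩
  simp only [segreLie_smul, map_smul, LinearMap.smul_apply, smul_eq_mul]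
  linear_combination s * hc Y Z

/-- The first-order term of the invariance of a form under a one-parameter family. -/
theorem isSemiInvariant_of_family {a : Mat3 →ₗ[ℂ] Mat3 →ₗ[ℂ] ℂ} (ha : a ≠ 0)
    {W : Matrix (Fin 2) (Fin 2) ℂ × Matrix (Fin 2) (Fin 2) ℂ} {s : Set ℂ} (hs : s.Infinite)
    (h : ∀ t ∈ s, ∃ c, ∀ Y Z, a (segreAct (1 + t • W.1) (1 + t • W.2) Y)
      (segreAct (1 + t • W.1) (1 + t • W.2) Z) = c * a Y Z) : IsSemiInvariant a W := by
  -- The coefficients of the expansion of the action in powers of t: it has degree two in t on each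
  -- side, hence degree four.
  let U : Mat3 → ℕ → Mat3 := fun Y => ![Y, segreLie W Y,
    sym2 W.1 * Y + dsym2 W.1 * Y * (dsym2 W.2).transpose + Y * (sym2 W.2).transpose,
    sym2 W.1 * Y * (dsym2 W.2).transpose + dsym2 W.1 * Y * (sym2 W.2).transpose,
    sym2 W.1 * Y * (sym2 W.2).transpose] ∘ Fin.ofNat 5
  have hU : ∀ (t : ℂ) (Y : Mat3), segreAct (1 + t • W.1) (1 + t • W.2) Y = ∑ i ∈ Finset.range 5, t ^ i • U Y i := by
    intro t Y
    simp only [Finset.sum_range_succ, Finset.sum_range_zero, segreAct, sandwich_apply,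
      sym2_one_add_smul, Matrix.transpose_add, Matrix.transpose_smul, Matrix.transpose_one,
      add_mul, mul_add, one_mul, mul_one, Matrix.smul_mul, Matrix.mul_smul, smul_smul]
    have e0 : U Y 0 = Y := rfl
    have e1 : U Y 1 = segreLie W Y := rfl
    have e2 : U Y 2 = sym2 W.1 * Y + dsym2 W.1 * Y * (dsym2 W.2).transpose +
      Y * (sym2 W.2).transpose := rfl
    have e3 : U Y 3 = sym2 W.1 * Y * (dsym2 W.2).transpose +
      dsym2 W.1 * Y * (sym2 W.2).transpose := rfl
    have e4 : U Y 4 = sym2 W.1 * Y * (sym2 W.2).transpose := rfl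
    rw [e0, e1, e2, e3, e4, segreLie]
    module
  let p : Mat3 → Mat3 → Polynomial ℂ := fun Y Z => ∑ i ∈ Finset.range 5, ∑ j ∈ Finset.range 5,
    Polynomial.C (a (U Y i) (U Z j)) * Polynomial.X ^ (i + j)
  have hp : ∀ Y Z t, (p Y Z).eval t = a (segreAct (1 + t • W.1) (1 + t • W.2) Y)
      (segreAct (1 + t • W.1) (1 + t • W.2) Z) := by
    intro Y Z t
    rw [hU, hU]
    simp only [p, Polynomial.eval_finsetSum, Polynomial.eval_mul, Polynomial.eval_C,
      Polynomial.eval_pow, Polynomial.eval_X, map_sum, LinearMap.sum_apply, map_smul,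
      LinearMap.smul_apply, smul_eq_mul]
    rw [Finset.sum_comm]
    refine Finset.sum_congr rfl fun i _ => ?_
    rw [Finset.mul_sum]
    exact Finset.sum_congr rfl fun j _ => by ring
  have hp1 : ∀ Y Z, (p Y Z).coeff 1 = a (segreLie W Y) Z + a Y (segreLie W Z) := by
    intro Y Z
    have e0 : ∀ Y, U Y 0 = Y := fun Y => rfl
    have e1 : ∀ Y, U Y 1 = segreLie W Y := fun Y => rfl
    simp only [p, Finset.sum_range_succ, Finset.sum_range_zero]
    simp [e0, e1]
    ring
  obtain ⟨Y₀, Z₀, h0⟩ : ∃ Y Z, a Y Z ≠ 0 := by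
    by_contra! h0
    exact ha (LinearMap.ext₂ h0)
  -- The factor `c` may depend on t in an arbitrary way. Cross-multiplication with a fixed nonzero
  -- value eliminates it and leaves polynomial identities, valid for infinitely many t and hence for
  -- all coefficients.
  have key : ∀ Y Z, p Y Z * Polynomial.C (a Y₀ Z₀) - p Y₀ Z₀ * Polynomial.C (a Y Z) = 0 := by
    intro Y Z
    refine Polynomial.eq_zero_of_infinite_isRoot _ (hs.mono fun t ht => ?_)
    obtain ⟨c, hc⟩ := h t ht
    change Polynomial.IsRoot _ _
    simp only [Polynomial.IsRoot.def, Polynomial.eval_sub, Polynomial.eval_mul,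
      Polynomial.eval_C, hp, hc]
    ring
  refine ⟨(p Y₀ Z₀).coeff 1 / a Y₀ Z₀, fun Y Z => ?_⟩
  have := congrArg (fun r => Polynomial.coeff r 1) (key Y Z)
  simp only [Polynomial.coeff_sub, Polynomial.coeff_mul_C, Polynomial.coeff_zero, hp1 Y Z] at this
  field_simp
  linear_combination this

/-- Scalars commute, so the two factors cancel in the commutator: a one-dimensional character
vanishes on brackets. -/
theorem invariant_of_commutator {a : Mat3 →ₗ[ℂ] Mat3 →ₗ[ℂ] ℂ} {L₁ L₂ L : Mat3 → Mat3} {c₁ c₂ : ℂ}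
    (h₁ : ∀ Y Z, a (L₁ Y) Z + a Y (L₁ Z) = c₁ * a Y Z)
    (h₂ : ∀ Y Z, a (L₂ Y) Z + a Y (L₂ Z) = c₂ * a Y Z)
    (hL : ∀ Y, L Y = L₁ (L₂ Y) - L₂ (L₁ Y)) (Y Z : Mat3) : a (L Y) Z + a Y (L Z) = 0 := by
  simp only [hL, map_sub, LinearMap.sub_apply]
  linear_combination h₁ (L₂ Y) Z - h₂ (L₁ Y) Z + h₁ Y (L₂ Z) - h₂ Y (L₁ Z) + c₁ * h₂ Y Z -
    c₂ * h₁ Y Z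

/-- The first hyperbolic generator of the symmetries of the conic. -/
def boost₁ : Mat3 := !![0, 1, 0; 1, 0, 0; 0, 0, 0]

/-- The second hyperbolic generator of the symmetries of the conic. -/
def boost₂ : Mat3 := !![0, 0, 1; 0, 0, 0; 1, 0, 0]

/-- The elliptic generator of the symmetries of the conic. -/
def conicRotation : Mat3 := !![0, 0, 0; 0, 0, 1; 0, -1, 0]

theorem dsym2_boost₁ : dsym2 !![1 / 2, 0; 0, -1 / 2] = boost₁ := by
  ext i j
  fin_cases i <;> fin_cases j <;> simp [dsym2, boost₁] <;> norm_num

theorem dsym2_boost₂ : dsym2 !![0, 1 / 2; 1 / 2, 0] = boost₂ := by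
  ext i j
  fin_cases i <;> fin_cases j <;> simp [dsym2, boost₂] <;> norm_num

theorem dsym2_conicRotation : dsym2 !![0, 1 / 2; -1 / 2, 0] = conicRotation := by
  ext i j
  fin_cases i <;> fin_cases j <;> simp [dsym2, conicRotation] <;> norm_num

theorem dsym2_zero : dsym2 0 = 0 := by
  ext i j
  fin_cases i <;> fin_cases j <;> simp [dsym2]

theorem boost₁_eq : boost₁ = conicRotation * boost₂ - boost₂ * conicRotation := by
  ext i j
  fin_cases i <;> fin_cases j <;> simp [boost₁, boost₂, conicRotation]

theorem boost₂_eq : boost₂ = boost₁ * conicRotation - conicRotation * boost₁ := by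
  ext i j
  fin_cases i <;> fin_cases j <;> simp [boost₁, boost₂, conicRotation]

/-- A bilinear form on `ℂ³` that is invariant under the rotations of the conic is a multiple of
the equation of the conic. -/
theorem eq_conicSign_of_invariant {N : Fin 3 → Fin 3 → ℂ}
    (h₁ : ∀ i k, ∑ m, boost₁ m i * N m k + ∑ m, boost₁ m k * N i m = 0)
    (h₂ : ∀ i k, ∑ m, boost₂ m i * N m k + ∑ m, boost₂ m k * N i m = 0) (i k : Fin 3) :
    N i k = if i = k then conicSign i * N 1 1 else 0 := by
  simp only [Fin.sum_univ_three, boost₁, boost₂] at h₁ h₂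
  have a01 := h₁ 0 1
  have a02 := h₁ 0 2
  have a12 := h₁ 1 2
  have a20 := h₁ 2 0
  have a21 := h₁ 2 1
  have b02 := h₂ 0 2
  have b12 := h₂ 1 2
  have b10 := h₂ 1 0
  have b21 := h₂ 2 1
  simp at a01 a02 a12 a20 a21 b02 b12 b10 b21
  fin_cases i <;> fin_cases k <;> simp [conicSign] <;>
    first
    | assumption
    | linear_combination a01
    | linear_combination b02 - a01

/-- A bilinear form on the ambient space of the double Segre surface that is semi-invariant under
all infinitesimal automorphisms is a multiple of the invariant form. -/
theorem eq_segreForm_of_semiInvariant {a : Mat3 →ₗ[ℂ] Mat3 →ₗ[ℂ] ℂ}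
    (h : ∀ W, IsSemiInvariant a W) : ∃ k : ℂ, ∀ Y Z, a Y Z = k * segreForm Y Z := by
  have left : ∀ g, ∃ c : ℂ, ∀ Y Z, a (dsym2 g * Y) Z + a Y (dsym2 g * Z) = c * a Y Z := by
    intro g
    obtain ⟨c, hc⟩ := h (g, 0)
    exact ⟨c, fun Y Z => by simpa [segreLie, dsym2_zero] using hc Y Z⟩
  have right : ∀ g, ∃ c : ℂ, ∀ Y Z, a (Y * (dsym2 g).transpose) Z +
      a Y (Z * (dsym2 g).transpose) = c * a Y Z := by
    intro g
    obtain ⟨c, hc⟩ := h (0, g)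
    exact ⟨c, fun Y Z => by simpa [segreLie, dsym2_zero] using hc Y Z⟩
  obtain ⟨c₁, l₁⟩ := left !![1 / 2, 0; 0, -1 / 2]
  obtain ⟨c₂, l₂⟩ := left !![0, 1 / 2; 1 / 2, 0]
  obtain ⟨c₃, l₃⟩ := left !![0, 1 / 2; -1 / 2, 0]
  obtain ⟨d₁, r₁⟩ := right !![1 / 2, 0; 0, -1 / 2]
  obtain ⟨d₂, r₂⟩ := right !![0, 1 / 2; 1 / 2, 0]
  obtain ⟨d₃, r₃⟩ := right !![0, 1 / 2; -1 / 2, 0]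
  rw [dsym2_boost₁] at l₁ r₁
  rw [dsym2_boost₂] at l₂ r₂
  rw [dsym2_conicRotation] at l₃ r₃
  -- Both boosts are commutators of generators, so the form is strictly invariant under them on
  -- either side, and these two suffice.
  have L₁ := invariant_of_commutator (L := fun Y => boost₁ * Y) l₃ l₂ fun Y => by
    simp only [← mul_assoc, ← sub_mul, ← boost₁_eq]
  have L₂ := invariant_of_commutator (L := fun Y => boost₂ * Y) l₁ l₃ fun Y => by
    simp only [← mul_assoc, ← sub_mul, ← boost₂_eq]
  have R₁ := invariant_of_commutator (L := fun Y => Y * boost₁.transpose) r₃ r₂ fun Y => by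
    simp only [mul_assoc, ← mul_sub, ← Matrix.transpose_mul, ← Matrix.transpose_sub, ← boost₁_eq]
  have R₂ := invariant_of_commutator (L := fun Y => Y * boost₂.transpose) r₁ r₃ fun Y => by
    simp only [mul_assoc, ← mul_sub, ← Matrix.transpose_mul, ← Matrix.transpose_sub, ← boost₂_eq]
  have lmul : ∀ (E : Mat3) i j, E * Matrix.single i j 1 =
      ∑ m, E m i • Matrix.single m j (1 : ℂ) := by
    intro E i j
    ext p q
    rw [Matrix.sum_apply]
    by_cases hq : j = q
    · subst hq
      simp [Matrix.single_apply]
    · simp [Matrix.mul_apply, hq]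
  have rmul : ∀ (E : Mat3) i j, Matrix.single i j 1 * E.transpose =
      ∑ m, E m j • Matrix.single i m (1 : ℂ) := by
    intro E i j
    ext p q
    rw [Matrix.sum_apply]
    by_cases hp : i = p
    · subst hp
      simp [Matrix.single_apply]
    · simp [Matrix.mul_apply, hp]
  let N : Fin 3 → Fin 3 → Fin 3 → Fin 3 → ℂ := fun i j k l =>
    a (Matrix.single i j 1) (Matrix.single k l 1)
  -- For fixed `j` and `l`, invariance under left multiplication makes the form in `i` and `k` a
  -- multiple of the equation of the conic. Right multiplication does the same for `j` and `l`.
  have hl : ∀ i j k l, N i j k l = if i = k then conicSign i * N 1 j 1 l else 0 := by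
    intro i j k l
    refine eq_conicSign_of_invariant (N := fun i k => N i j k l) (fun i k => ?_) (fun i k => ?_) i k
    · have := L₁ (Matrix.single i j 1) (Matrix.single k l 1)
      simpa only [lmul, map_sum, LinearMap.sum_apply, map_smul, LinearMap.smul_apply,
        smul_eq_mul] using this
    · have := L₂ (Matrix.single i j 1) (Matrix.single k l 1)
      simpa only [lmul, map_sum, LinearMap.sum_apply, map_smul, LinearMap.smul_apply,
        smul_eq_mul] using this
  have hr : ∀ i j k l, N i j k l = if j = l then conicSign j * N i 1 k 1 else 0 := by
    intro i j k l
    refine eq_conicSign_of_invariant (N := fun j l => N i j k l) (fun j l => ?_) (fun j l => ?_) j l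
    · have := R₁ (Matrix.single i j 1) (Matrix.single k l 1)
      simpa only [rmul, map_sum, LinearMap.sum_apply, map_smul, LinearMap.smul_apply,
        smul_eq_mul] using this
    · have := R₂ (Matrix.single i j 1) (Matrix.single k l 1)
      simpa only [rmul, map_sum, LinearMap.sum_apply, map_smul, LinearMap.smul_apply,
        smul_eq_mul] using this
  obtain ⟨k₀, hN⟩ : ∃ k₀, ∀ i j k l, N i j k l =
      if i = k then (if j = l then conicSign i * conicSign j * k₀ else 0) else 0 := by
    refine ⟨N 1 1 1 1, fun i j k l => ?_⟩
    rw [hl, hr 1 j 1 l]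
    split_ifs <;> ring
  refine ⟨k₀, fun Y Z => ?_⟩
  have expand : a Y Z = ∑ i, ∑ j, ∑ k, ∑ l, Y i j * Z k l * N i j k l := by
    have e₁ : a Y Z = ∑ i, ∑ j, Y i j * a (Matrix.single i j 1) Z := by
      conv_lhs => rw [Mat3.eq_sum_single Y]
      simp only [map_sum, LinearMap.sum_apply, map_smul, LinearMap.smul_apply, smul_eq_mul]
    have e₂ : ∀ X, a X Z = ∑ k, ∑ l, Z k l * a X (Matrix.single k l 1) := by
      intro X
      conv_lhs => rw [Mat3.eq_sum_single Z]
      simp only [map_sum, map_smul, smul_eq_mul]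
    rw [e₁]
    refine Finset.sum_congr rfl fun i _ => Finset.sum_congr rfl fun j _ => ?_
    rw [e₂, Finset.mul_sum]
    refine Finset.sum_congr rfl fun k _ => ?_
    rw [Finset.mul_sum]
    exact Finset.sum_congr rfl fun l _ => by ring
  rw [expand, segreForm, Finset.mul_sum]
  refine Finset.sum_congr rfl fun i _ => ?_
  rw [Finset.mul_sum]
  refine Finset.sum_congr rfl fun j _ => ?_
  simp only [hN]
  simp
  ring

/-! ### Quadrics preserved by the identity component -/

/-- The pairs of `2 × 2` matrices. -/
abbrev Mat2Pair : Type := Matrix (Fin 2) (Fin 2) ℂ × Matrix (Fin 2) (Fin 2) ℂ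

theorem IsParam.mem_iff_transf_mem {P : Mat3 ≃ₗ[ℂ] (Fin 9 → ℂ)} {X : Set (CP 8)} (h : IsParam P X)
    {g g' : Matrix (Fin 2) (Fin 2) ℂ} (hg : IsUnit g.det) (hg' : IsUnit g'.det)
    {M : GL (Fin 9) ℝ}
    (hM : ∀ v, (M.1.map Complex.ofReal).mulVec v = P (segreAct g g' (P.symm v))) (p : CP 8) :
    p ∈ X ↔ CP.transf M p ∈ X := by
  have hne : ∀ {k : Matrix (Fin 2) (Fin 2) ℂ}, IsUnit k.det → ∀ {u : Fin 2 → ℂ}, u ≠ 0 →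
      k.mulVec u ≠ 0 := by
    intro k hk u hu h0
    exact hu (Matrix.eq_zero_of_mulVec_eq_zero hk.ne_zero h0)
  constructor
  · intro hp
    obtain ⟨u, w, hu, hw, hv⟩ := (h p).1 hp
    refine (h _).2 ⟨_, _, hne hg hu, hne hg' hw, ?_⟩
    have := hv.transf M
    rwa [hM, P.symm_apply_apply, segreAct_segre] at this
  · intro hp
    obtain ⟨u, w, hu, hw, hv⟩ := (h _).1 hp
    refine (h _).2 ⟨_, _, hne (Matrix.isUnit_nonsing_inv_det _ hg) hu,
      hne (Matrix.isUnit_nonsing_inv_det _ hg') hw, ?_⟩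
    obtain ⟨c, hc, e⟩ := ((HasCoords.rep p).transf M).exists_smul hv
    rw [hM, ← map_smul, P.injective.eq_iff] at e
    have e2 := congrArg (segreAct g⁻¹ g'⁻¹) e
    rw [map_smul, segreAct_segreAct, Matrix.nonsing_inv_mul _ hg, Matrix.nonsing_inv_mul _ hg',
      segreAct_one, segreAct_segre] at e2
    rw [e2, map_smul, P.apply_symm_apply]
    exact (HasCoords.rep p).smul hc

/-- The bilinear form of a real matrix in the coordinates of a parametrization. -/
noncomputable def paramBilin (A : Matrix (Fin 9) (Fin 9) ℝ) (P : Mat3 ≃ₗ[ℂ] (Fin 9 → ℂ)) :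
    Mat3 →ₗ[ℂ] Mat3 →ₗ[ℂ] ℂ :=
  (Matrix.toLinearMap₂' ℂ (A.map Complex.ofReal)).compl₁₂ P.toLinearMap P.toLinearMap

theorem paramBilin_apply (A : Matrix (Fin 9) (Fin 9) ℝ) (P : Mat3 ≃ₗ[ℂ] (Fin 9 → ℂ)) (Y Z : Mat3) :
    paramBilin A P Y Z = cform A (P Y) (P Z) := by
  simp [paramBilin, cform, Matrix.toLinearMap₂'_apply']

theorem cform_comm {n : ℕ} {A : Matrix (Fin n) (Fin n) ℝ} (hA : A.IsSymm) (v w : Fin n → ℂ) :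
    cform A v w = cform A w v := by
  have h : (A.map Complex.ofReal).transpose = A.map Complex.ofReal := by
    rw [← Matrix.transpose_map, hA]
  rw [cform, Matrix.dotProduct_mulVec, dotProduct_comm, ← Matrix.mulVec_transpose, h, cform]

theorem cform_ofReal {n : ℕ} (A : Matrix (Fin n) (Fin n) ℝ) (x y : Fin n → ℝ) :
    cform A (fun i => (x i : ℂ)) (fun i => (y i : ℂ)) = ((x ⬝ᵥ A.mulVec y : ℝ) : ℂ) := by
  simp [cform, dotProduct, Matrix.mulVec]

theorem cform_star {n : ℕ} (A : Matrix (Fin n) (Fin n) ℝ) (v w : Fin n → ℂ) :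
    cform A (star v) (star w) = star (cform A v w) := by
  simp [cform, dotProduct, Matrix.mulVec]

/-- An infinitesimal real automorphism of a parametrized real surface preserves the equation of
a quadric whose automorphism group contains that of the surface. -/
theorem IsParam.isSemiInvariant {A : Matrix (Fin 9) (Fin 9) ℝ} {P : Mat3 ≃ₗ[ℂ] (Fin 9 → ℂ)}
    {X : Set (CP 8)} (h : IsParam P X) (hA : A.IsSymm)
    {x y : Fin 9 → ℝ} (hx : 0 < x ⬝ᵥ A.mulVec x) (hy : y ⬝ᵥ A.mulVec y < 0)
    {κ : Mat3 → Mat3} (hP : ∀ Y, star (P Y) = P (κ Y)) {W : Mat2Pair}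
    (hW : ∀ (t : ℝ) Y, κ (segreAct (1 + (t : ℂ) • W.1) (1 + (t : ℂ) • W.2) Y) =
      segreAct (1 + (t : ℂ) • W.1) (1 + (t : ℂ) • W.2) (κ Y))
    (haut : AutZeroSubset X (quadric A)) : IsSemiInvariant (paramBilin A P) W := by
  have ha0 : paramBilin A P ≠ 0 := by
    intro h0
    have := paramBilin_apply A P (P.symm fun i => (x i : ℂ)) (P.symm fun i => (x i : ℂ))
    rw [P.apply_symm_apply, cform_ofReal, h0, LinearMap.zero_apply, LinearMap.zero_apply] at this
    exact hx.ne (by exact_mod_cast this)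
  -- On a small interval both matrices stay invertible. The interval is connected and contains 0, so
  -- the resulting path of automorphisms stays in the identity component.
  obtain ⟨ε, hε, hdet⟩ : ∃ ε > 0, ∀ t ∈ Metric.ball (0 : ℝ) ε,
      (1 + (t : ℂ) • W.1).det ≠ 0 ∧ (1 + (t : ℂ) • W.2).det ≠ 0 := by
    have hc : ∀ V : Matrix (Fin 2) (Fin 2) ℂ, ∀ᶠ t : ℝ in 𝓝 0, (1 + (t : ℂ) • V).det ≠ 0 := by
      intro V
      have : Continuous fun t : ℝ => (1 + (t : ℂ) • V).det := by
        refine Continuous.matrix_det ?_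
        fun_prop
      exact this.continuousAt.eventually_ne (by simp)
    exact Metric.eventually_nhds_iff_ball.1 ((hc W.1).and (hc W.2))
  have hdet₁ := fun t ht => isUnit_iff_ne_zero.2 (hdet t ht).1
  have hdet₂ := fun t ht => isUnit_iff_ne_zero.2 (hdet t ht).2
  have hreal : ∀ t : Metric.ball (0 : ℝ) ε, ∃ M : GL (Fin 9) ℝ, ∀ v,
      (M.1.map Complex.ofReal).mulVec v =
        P (segreAct (1 + (t.1 : ℂ) • W.1) (1 + (t.1 : ℂ) • W.2) (P.symm v)) := by
    intro t
    refine exists_real_matrix (L := P.toLinearMap ∘ₗ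
      segreAct (1 + (t.1 : ℂ) • W.1) (1 + (t.1 : ℂ) • W.2) ∘ₗ P.symm.toLinearMap)
      (P.injective.comp ((segreActEquiv (hdet₁ _ t.2) (hdet₂ _ t.2)).injective.comp
        P.symm.injective)) fun v => ?_
    have hv : κ (P.symm v) = P.symm (star v) := by
      rw [← P.injective.eq_iff, ← hP, P.apply_symm_apply, P.apply_symm_apply]
    change star (P (segreAct _ _ (P.symm v))) = P (segreAct _ _ (P.symm (star v)))
    rw [hP, hW, hv]
  choose M hM using hreal
  have hMX := fun t => h.mem_iff_transf_mem (hdet₁ _ t.2) (hdet₂ _ t.2) (hM t)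
  let Φ : Metric.ball (0 : ℝ) ε → C(X, X) := fun t => CP.transfMap (M t) (hMX t)
  have hΦ : Continuous Φ := by
    refine ContinuousMap.continuous_of_continuous_uncurry _ (Continuous.subtype_mk ?_ _)
    refine CP.continuous_of_coords (p := fun s : Metric.ball (0 : ℝ) ε × X => s.2.1)
      (continuous_subtype_val.comp continuous_snd)
      (G := fun s v => P (segreAct (1 + (s.1.1 : ℂ) • W.1) (1 + (s.1.1 : ℂ) • W.2) (P.symm v)))
      ?_ ?_
    · have hPc : Continuous P := LinearMap.continuous_of_finiteDimensional P.toLinearMap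
      have hPc' : Continuous P.symm := LinearMap.continuous_of_finiteDimensional P.symm.toLinearMap
      simp only [Function.uncurry_def, segreAct, sandwich_apply, sym2_one_add_smul]
      refine hPc.comp ?_
      have h1 : Continuous fun s : (Metric.ball (0 : ℝ) ε × X) × (Fin 9 → ℂ) => (s.1.1.1 : ℂ) := by
        fun_prop
      have h2 : Continuous fun s : (Metric.ball (0 : ℝ) ε × X) × (Fin 9 → ℂ) => P.symm s.2 :=
        hPc'.comp continuous_snd
      have h3 : ∀ V : Matrix (Fin 2) (Fin 2) ℂ,
          Continuous fun s : (Metric.ball (0 : ℝ) ε × X) × (Fin 9 → ℂ) =>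
            1 + (s.1.1.1 : ℂ) • dsym2 V + (s.1.1.1 : ℂ) ^ 2 • sym2 V := fun V =>
        (continuous_const.add (h1.smul continuous_const)).add
          ((h1.pow 2).smul continuous_const)
      exact ((h3 _).matrix_mul h2).matrix_mul (h3 _).matrix_transpose
    · intro s v hv
      rw [← hM]
      exact hv.transf _
  have h0 : (0 : ℝ) ∈ Metric.ball (0 : ℝ) ε := Metric.mem_ball_self hε
  have hΦ0 : Φ ⟨0, h0⟩ = ContinuousMap.id X := by
    ext1 p
    refine Subtype.ext ?_
    have := (HasCoords.rep p.1).transf (M ⟨0, h0⟩)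
    rw [hM] at this
    simp only [Complex.ofReal_zero, zero_smul, add_zero, segreAct_one, P.apply_symm_apply] at this
    exact this.eq (HasCoords.rep p.1)
  have hzero : ∀ t, Φ t ∈ realAutZero X := by
    intro t
    have hpre : IsPreconnected (Set.range Φ) := by
      have : PreconnectedSpace (Metric.ball (0 : ℝ) ε) :=
        isPreconnected_iff_preconnectedSpace.1 (convex_ball _ _).isPreconnected
      exact isPreconnected_range hΦ
    refine hpre.subset_connectedComponentIn ⟨⟨0, h0⟩, hΦ0⟩ ?_ ⟨t, rfl⟩
    rintro _ ⟨s, rfl⟩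
    exact CP.transfMap_mem_realAut _ _
  -- The hypothesis provides some real extension `N` that preserves the quadric. It agrees with `M
  -- t` on X, hence on all of ℙ⁸.
  have hQ : ∀ t p, p ∈ quadric A → CP.transf (M t) p ∈ quadric A := by
    intro t p hp
    obtain ⟨N, ψ, -, hN, hψ⟩ := haut _ (hzero t)
    have hfix := h.transf_eq_of_fixed (M := N⁻¹ * M t) (fun q hq => by
      have : CP.transf (M t) q = CP.transf N q := hN ⟨q, hq⟩
      rw [CP.transf_mul, this, CP.transf_inv_transf]) p
    rw [CP.transf_mul] at hfix
    have := congrArg (CP.transf N) hfix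
    rw [CP.transf_transf_inv] at this
    rw [this, ← hψ ⟨p, hp⟩]
    exact (ψ ⟨p, hp⟩).2
  refine isSemiInvariant_of_family ha0 (s := (fun t : ℝ => (t : ℂ)) '' Metric.ball 0 ε) ?_ ?_
  · refine Set.Infinite.image Complex.ofReal_injective.injOn ?_
    rw [Real.ball_eq_Ioo]
    exact Set.Ioo_infinite (by linarith)
  · rintro _ ⟨t, ht, rfl⟩
    set ρ := segreAct (1 + (t : ℂ) • W.1) (1 + (t : ℂ) • W.2) with hρ
    have hnull : ∀ Y, paramBilin A P Y Y = 0 →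
        ((paramBilin A P).compl₁₂ ρ ρ) Y Y = 0 := by
      intro Y hY
      rw [LinearMap.compl₁₂_apply]
      rcases eq_or_ne Y 0 with rfl | hY0
      · simp
      rw [paramBilin_apply] at hY ⊢
      have hp := HasCoords.mk (P.map_ne_zero_iff.2 hY0)
      have h1 := hQ ⟨t, ht⟩ _ ((CP.mem_quadric hp).2 hY)
      have h2 := hp.transf (M ⟨t, ht⟩)
      rw [hM, P.symm_apply_apply] at h2
      exact (CP.mem_quadric h2).1 h1
    refine exists_eq_smul_of_vanishing (v := P.symm fun i => (x i : ℂ))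
      (v' := P.symm fun i => (y i : ℂ)) (fun Y Z => ?_) (fun Y Z => ?_) ?_ ?_ hnull
    · rw [paramBilin_apply, paramBilin_apply, cform_comm hA]
    · rw [LinearMap.compl₁₂_apply, LinearMap.compl₁₂_apply, paramBilin_apply, paramBilin_apply,
        cform_comm hA]
    · rw [paramBilin_apply, P.apply_symm_apply, cform_ofReal]
      exact_mod_cast hx.ne'
    · simp only [paramBilin_apply, P.apply_symm_apply, cform_ofReal]
      -- The restriction of the form to the plane of `x` and `y` is indefinite and therefore
      -- nondegenerate; this is the rank condition of `exists_eq_smul_of_vanishing`.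
      have : 0 < (y ⬝ᵥ A.mulVec x) ^ 2 - (x ⬝ᵥ A.mulVec x) * (y ⬝ᵥ A.mulVec y) := by
        nlinarith [sq_nonneg (y ⬝ᵥ A.mulVec x), mul_pos hx (neg_pos.2 hy)]
      exact_mod_cast this.ne'

/-- If the identity component of the automorphism group of a parametrized real surface is contained
in that of an indefinite quadric, then the equation of the quadric is a multiple of the invariant
form. -/
theorem IsParam.exists_cform_eq {A : Matrix (Fin 9) (Fin 9) ℝ} {P : Mat3 ≃ₗ[ℂ] (Fin 9 → ℂ)}
    {X : Set (CP 8)} (h : IsParam P X) (hA : A.IsSymm)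
    {x y : Fin 9 → ℝ} (hx : 0 < x ⬝ᵥ A.mulVec x) (hy : y ⬝ᵥ A.mulVec y < 0)
    {κ : Mat3 → Mat3} (hP : ∀ Y, star (P Y) = P (κ Y))
    (θ : Mat2Pair →ₛₗ[starRingEnd ℂ] Mat2Pair) (hθ : ∀ W, θ (θ W) = W) (hθ1 : θ 1 = 1)
    (hκ : ∀ (W : Mat2Pair) Y, κ (segreAct W.1 W.2 Y) = segreAct (θ W).1 (θ W).2 (κ Y))
    (hs : ∀ Y Z, segreForm (κ Y) (κ Z) = star (segreForm Y Z))
    (haut : AutZeroSubset X (quadric A)) :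
    ∃ k : ℝ, k ≠ 0 ∧ ∀ Y Z, cform A (P Y) (P Z) = k * segreForm Y Z := by
  have hfix : ∀ W, θ W = W → IsSemiInvariant (paramBilin A P) W := by
    intro W hW
    refine h.isSemiInvariant hA hx hy hP (fun t Y => ?_) haut
    have h1 : θ (1 + (t : ℂ) • W) = 1 + (t : ℂ) • W := by
      rw [map_add, hθ1, map_smulₛₗ, hW, Complex.conj_ofReal]
    have h2 := hκ (1 + (t : ℂ) • W) Y
    rw [h1] at h2
    exact h2
  -- The pairs fixed by the antilinear involution `θ` are a real form: every `W` is a complex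
  -- combination of the fixed pairs `W + θ W` and `I • W + θ (I • W)`.
  have hall : ∀ W, IsSemiInvariant (paramBilin A P) W := by
    intro W
    have h1 := hfix (W + θ W) (by rw [map_add, hθ, add_comm])
    have h2 := hfix (Complex.I • W + θ (Complex.I • W)) (by rw [map_add, hθ, add_comm])
    have e : W = (1 / 2 : ℂ) • ((W + θ W) +
        (-Complex.I) • (Complex.I • W + θ (Complex.I • W))) := by
      have e' : (-Complex.I) • (Complex.I • W + θ (Complex.I • W)) = W - θ W := by
        rw [map_smulₛₗ, Complex.conj_I, smul_add, smul_smul, smul_smul, neg_mul, neg_mul_neg,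
          Complex.I_mul_I, neg_neg, one_smul, neg_one_smul, sub_eq_add_neg]
      rw [e']
      module
    rw [e]
    exact (h1.add (h2.smul _)).smul _
  obtain ⟨k, hk⟩ := eq_segreForm_of_semiInvariant hall
  simp only [paramBilin_apply] at hk
  -- Take a matrix unit of norm 1. The value of the real matrix `A` at its conjugate is `star k`,
  -- while invariance of `segreForm` under `κ` gives `k`.
  have hreal : star k = k := by
    have h1 : segreForm (Matrix.single 0 0 1) (Matrix.single 0 0 1) = 1 := by
      simp [segreForm, Fin.sum_univ_three, conicSign]
    have h2 := hk (κ (Matrix.single 0 0 1)) (κ (Matrix.single 0 0 1))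
    rw [hs, ← hP, cform_star, hk, h1] at h2
    simpa using h2
  have hkre : ((k.re : ℝ) : ℂ) = k := Complex.conj_eq_iff_re.1 hreal
  refine ⟨k.re, fun h0 => ?_, fun Y Z => by rw [hkre, hk]⟩
  have := hk (P.symm fun i => (x i : ℂ)) (P.symm fun i => (x i : ℂ))
  rw [P.apply_symm_apply, cform_ofReal, ← hkre, h0, Complex.ofReal_zero, zero_mul] at this
  exact hx.ne' (by exact_mod_cast this)

/-! ### Real structures of double Segre surfaces -/

/-- The matrix of the quaternionic structure of `ℂ²`. -/
def quat : Matrix (Fin 2) (Fin 2) ℂ := !![0, -1; 1, 0]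

theorem quat_mul_quat : quat * quat = -1 := by
  ext i j
  fin_cases i <;> fin_cases j <;> simp [quat]

theorem quat_map_star : quat.map (starRingEnd ℂ) = quat := by
  ext i j
  fin_cases i <;> fin_cases j <;> simp [quat]

theorem det_quat : quat.det = 1 := by simp [quat, Matrix.det_fin_two]

theorem sym2_smul (c : ℂ) (g : Matrix (Fin 2) (Fin 2) ℂ) : sym2 (c • g) = c ^ 2 • sym2 g := by
  ext i j
  fin_cases i <;> fin_cases j <;> simp [sym2] <;> ring

theorem sym2_quat : sym2 quat = Matrix.diagonal ![1, -1, -1] := by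
  ext i j
  fin_cases i <;> fin_cases j <;> simp [sym2, quat] <;> norm_num

theorem segreAct_smul_smul (s t : ℂ) (g h : Matrix (Fin 2) (Fin 2) ℂ) (Y : Mat3) :
    segreAct (s • g) (t • h) Y = (s ^ 2 * t ^ 2) • segreAct g h Y := by
  simp only [segreAct, sandwich_apply, sym2_smul, Matrix.transpose_smul, Matrix.smul_mul,
    Matrix.mul_smul, smul_smul]
  rw [mul_comm]

/-- The involution of the ambient space of the double Segre surface that is composed of the complex
conjugation and a pair of matrices. -/
noncomputable def twistedConj (g h : Matrix (Fin 2) (Fin 2) ℂ) (Y : Mat3) : Mat3 :=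
  segreAct g h (conjMat Y)

/-- The involution of the ambient space of the double Segre surface that is composed of the complex
conjugation and the interchange of the factors. -/
def swapConj (Y : Mat3) : Mat3 := (conjMat Y).transpose

theorem twistedConj_one_one (Y : Mat3) : twistedConj 1 1 Y = conjMat Y := segreAct_one _

/-- The properties of a real structure on the ambient space of the double Segre surface. -/
structure IsRealStructure (κ : Mat3 → Mat3) : Prop where
  map_add : ∀ Y Z, κ (Y + Z) = κ Y + κ Z
  map_smul : ∀ (c : ℂ) Y, κ (c • Y) = star c • κ Y
  involutive : ∀ Y, κ (κ Y) = Y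
  segreForm_map : ∀ Y Z, segreForm (κ Y) (κ Z) = star (segreForm Y Z)
  exists_pair : ∃ θ : Mat2Pair →ₛₗ[starRingEnd ℂ] Mat2Pair, (∀ W, θ (θ W) = W) ∧ θ 1 = 1 ∧
    ∀ (W : Mat2Pair) Y, κ (segreAct W.1 W.2 Y) = segreAct (θ W).1 (θ W).2 (κ Y)

theorem segreForm_conjMat (Y Z : Mat3) :
    segreForm (conjMat Y) (conjMat Z) = star (segreForm Y Z) := by
  have : ∀ i, star (conicSign i) = conicSign i := by
    intro i
    fin_cases i <;> simp [conicSign]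
  simp [segreForm, conjMat, this]

theorem conjMat_segreAct (g h : Matrix (Fin 2) (Fin 2) ℂ) (Y : Mat3) :
    conjMat (segreAct g h Y) =
      segreAct (g.map (starRingEnd ℂ)) (h.map (starRingEnd ℂ)) (conjMat Y) :=
  segreAct_map_star g h Y

theorem isRealStructure_swapConj : IsRealStructure swapConj where
  map_add Y Z := by simp [swapConj, conjMat_add]
  map_smul c Y := by simp [swapConj, conjMat_smul]
  involutive Y := by simp [swapConj, conjMat_transpose]
  segreForm_map Y Z := by rw [swapConj, swapConj, segreForm_transpose, segreForm_conjMat]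
  exists_pair := by
    refine ⟨{ toFun := fun W => (W.2.map (starRingEnd ℂ), W.1.map (starRingEnd ℂ))
              map_add' := fun W W' => ?_
              map_smul' := fun c W => ?_ }, fun W => ?_, ?_, fun W Y => ?_⟩
    · ext <;> simp
    · ext <;> simp
    · ext <;> simp
    · refine Prod.ext ?_ ?_ <;> exact Matrix.map_one _ (map_zero _) (map_one _)
    · rw [swapConj, conjMat_segreAct, segreAct_transpose]
      rfl

/-- A matrix that is either the identity or the quaternionic structure. -/
def IsTwist (g : Matrix (Fin 2) (Fin 2) ℂ) : Prop := g = 1 ∨ g = quat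

namespace IsTwist

variable {g : Matrix (Fin 2) (Fin 2) ℂ}

theorem map_star (h : IsTwist g) : g.map (starRingEnd ℂ) = g := by
  rcases h with rfl | rfl
  · exact Matrix.map_one _ (map_zero _) (map_one _)
  · exact quat_map_star

theorem exists_mul_self (h : IsTwist g) : ∃ ε : ℂ, ε ^ 2 = 1 ∧ g * g = ε • 1 := by
  rcases h with rfl | rfl
  · exact ⟨1, by norm_num, by simp⟩
  · exact ⟨-1, by norm_num, by rw [quat_mul_quat, neg_one_smul]⟩

theorem det_eq_one (h : IsTwist g) : g.det = 1 := by
  rcases h with rfl | rfl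
  · exact Matrix.det_one
  · exact det_quat

theorem isUnit_det (h : IsTwist g) : IsUnit g.det := by rw [h.det_eq_one]; exact isUnit_one

theorem inv_map_star (h : IsTwist g) : g⁻¹.map (starRingEnd ℂ) = g⁻¹ := by
  refine (Matrix.inv_eq_left_inv ?_).symm
  calc g⁻¹.map (starRingEnd ℂ) * g = g⁻¹.map (starRingEnd ℂ) * g.map (starRingEnd ℂ) := by
        rw [h.map_star]
    _ = 1 := by
        rw [← Matrix.map_mul, Matrix.nonsing_inv_mul _ h.isUnit_det]
        exact Matrix.map_one _ (map_zero _) (map_one _)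

theorem conj_conj (h : IsTwist g) (W : Matrix (Fin 2) (Fin 2) ℂ) :
    g * (g * W * g⁻¹) * g⁻¹ = W := by
  obtain ⟨ε, hε, e⟩ := h.exists_mul_self
  have h1 : g⁻¹ * g⁻¹ = (g * g)⁻¹ := (Matrix.mul_inv_rev _ _).symm
  have h2 : (ε • 1 : Matrix (Fin 2) (Fin 2) ℂ)⁻¹ = ε • 1 := by
    refine Matrix.inv_eq_left_inv ?_
    rw [smul_mul_smul_comm, ← sq, hε, one_smul, mul_one]
  rw [mul_assoc, mul_assoc (g * W), h1, mul_assoc g W, ← mul_assoc g g, e, h2,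
    Matrix.mul_smul, Matrix.smul_mul, mul_one, one_mul, smul_smul, ← sq, hε, one_smul]

end IsTwist

theorem twistedConj_twistedConj {g h : Matrix (Fin 2) (Fin 2) ℂ} (hg : IsTwist g)
    (hh : IsTwist h) (Y : Mat3) : twistedConj g h (twistedConj g h Y) = Y := by
  obtain ⟨ε, hε, e⟩ := hg.exists_mul_self
  obtain ⟨η, hη, f⟩ := hh.exists_mul_self
  rw [twistedConj, twistedConj, conjMat_segreAct, conjMat_conjMat, segreAct_segreAct, hg.map_star,
    hh.map_star, e, f, segreAct_smul_smul, hε, hη, segreAct_one, mul_one, one_smul]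

theorem isRealStructure_twistedConj {g h : Matrix (Fin 2) (Fin 2) ℂ} (hg : IsTwist g)
    (hh : IsTwist h) : IsRealStructure (twistedConj g h) where
  map_add Y Z := by simp [twistedConj, conjMat_add]
  map_smul c Y := by simp [twistedConj, conjMat_smul]
  involutive := twistedConj_twistedConj hg hh
  segreForm_map Y Z := by
    rw [twistedConj, twistedConj, segreForm_segreAct, segreForm_conjMat, hg.det_eq_one,
      hh.det_eq_one]
    simp
  exists_pair := by
    refine ⟨{ toFun := fun W =>
                (g * W.1.map (starRingEnd ℂ) * g⁻¹, h * W.2.map (starRingEnd ℂ) * h⁻¹)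
              map_add' := fun W W' => ?_
              map_smul' := fun c W => ?_ }, fun W => ?_, ?_, fun W Y => ?_⟩
    · refine Prod.ext ?_ ?_ <;>
      simp [Matrix.map_add, mul_add, add_mul]
    · have : ∀ V : Matrix (Fin 2) (Fin 2) ℂ, (c • V).map (starRingEnd ℂ) =
          star c • V.map (starRingEnd ℂ) := fun V => by ext; simp
      refine Prod.ext ?_ ?_ <;> simp [this]
    · have hm : ∀ V : Matrix (Fin 2) (Fin 2) ℂ,
          (V.map (starRingEnd ℂ)).map (starRingEnd ℂ) = V := fun V => by ext; simp
      refine Prod.ext ?_ ?_ <;>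
      simp [Matrix.map_mul, hm, hg.map_star, hh.map_star, hg.inv_map_star, hh.inv_map_star,
        hg.conj_conj, hh.conj_conj]
    · have h1 := Matrix.map_one (n := Fin 2) (starRingEnd ℂ) (map_zero _) (map_one _)
      refine Prod.ext ?_ ?_
      · simp [h1, Matrix.mul_nonsing_inv _ hg.isUnit_det]
      · simp [h1, Matrix.mul_nonsing_inv _ hh.isUnit_det]
    · simp only [twistedConj, conjMat_segreAct, segreAct_segreAct, LinearMap.coe_mk,
        AddHom.coe_mk, mul_assoc, Matrix.nonsing_inv_mul _ hg.isUnit_det,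
        Matrix.nonsing_inv_mul _ hh.isUnit_det, mul_one]

/-! ### Change of the parametrization -/

theorem IsParam.act {P : Mat3 ≃ₗ[ℂ] (Fin 9 → ℂ)} {X : Set (CP 8)} (h : IsParam P X)
    {g g' : Matrix (Fin 2) (Fin 2) ℂ} (hg : IsUnit g.det) (hg' : IsUnit g'.det) :
    IsParam ((segreActEquiv hg hg').trans P) X := by
  have hne : ∀ {k : Matrix (Fin 2) (Fin 2) ℂ}, IsUnit k.det → ∀ {u : Fin 2 → ℂ}, u ≠ 0 →
      k.mulVec u ≠ 0 := fun hk _ hu h0 => hu (Matrix.eq_zero_of_mulVec_eq_zero hk.ne_zero h0)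
  intro p
  rw [h p]
  constructor
  · rintro ⟨u, w, hu, hw, hp⟩
    refine ⟨_, _, hne (Matrix.isUnit_nonsing_inv_det _ hg) hu,
      hne (Matrix.isUnit_nonsing_inv_det _ hg') hw, ?_⟩
    rw [LinearEquiv.trans_apply, segreActEquiv_apply, segreAct_segre, Matrix.mulVec_mulVec,
      Matrix.mulVec_mulVec, Matrix.mul_nonsing_inv _ hg, Matrix.mul_nonsing_inv _ hg',
      Matrix.one_mulVec, Matrix.one_mulVec]
    exact hp
  · rintro ⟨u, w, hu, hw, hp⟩
    refine ⟨_, _, hne hg hu, hne hg' hw, ?_⟩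
    rwa [LinearEquiv.trans_apply, segreActEquiv_apply, segreAct_segre] at hp

theorem IsParam.transpose {P : Mat3 ≃ₗ[ℂ] (Fin 9 → ℂ)} {X : Set (CP 8)} (h : IsParam P X) :
    IsParam ((Matrix.transposeLinearEquiv _ _ ℂ ℂ).trans P) X := by
  intro p
  have : ∀ u w, ((Matrix.transposeLinearEquiv _ _ ℂ ℂ).trans P) (segre u w) = P (segre w u) :=
    fun u w => congrArg P (segre_transpose u w)
  simp only [this]
  rw [h p]
  constructor <;> exact fun ⟨u, w, hu, hw, hp⟩ => ⟨w, u, hw, hu, hp⟩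

/-- Applying conjugation twice gives `star c * c = 1`, and a scalar multiple of `P` absorbs `c` by
`exists_star_mul_eq`; the projective image is unchanged. -/
theorem IsParam.exists_rescale {P : Mat3 ≃ₗ[ℂ] (Fin 9 → ℂ)} {X : Set (CP 8)} (h : IsParam P X)
    {κ : Mat3 → Mat3} (hκ : ∀ Y, κ (κ Y) = Y) {c : ℂ} (hc : ∀ Y, star (P Y) = c • P (κ Y)) :
    ∃ P' : Mat3 ≃ₗ[ℂ] (Fin 9 → ℂ), IsParam P' X ∧ ∀ Y, star (P' Y) = P' (κ Y) := by
  have h1 : star c * c = 1 := by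
    have hY : P (Matrix.single 0 0 1) ≠ 0 := by
      rw [P.map_ne_zero_iff]
      intro h0
      simpa using congrFun (congrFun h0 0) 0
    have h2 := congrArg star (hc (Matrix.single 0 0 1))
    rw [star_star, star_smul, hc, hκ, smul_smul] at h2
    have h3 : (1 - star c * c) • P (Matrix.single 0 0 1) = 0 := by
      rw [sub_smul, one_smul, ← h2, sub_self]
    exact (sub_eq_zero.1 ((smul_eq_zero.1 h3).resolve_right hY)).symm
  obtain ⟨μ, hμ, e⟩ := exists_star_mul_eq h1
  refine ⟨P.trans (LinearEquiv.smulOfNeZero ℂ _ μ hμ), fun p => ?_, fun Y => ?_⟩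
  · rw [h p]
    constructor
    · rintro ⟨u, w, hu, hw, hp⟩
      exact ⟨u, w, hu, hw, hp.smul hμ⟩
    · rintro ⟨u, w, hu, hw, hp⟩
      exact ⟨u, w, hu, hw, hp.of_smul⟩
  · change star (μ • P Y) = μ • P (κ Y)
    rw [star_smul, hc, smul_smul, e]

theorem conicVec_zero : conicVec 0 = 0 := by
  ext i
  fin_cases i <;> simp [conicVec]

/-- The two basis vectors make `m` diagonal, and their sum makes the eigenvalues equal. -/
theorem eq_smul_one_of_mulVec {m : Matrix (Fin 2) (Fin 2) ℂ}
    (h : ∀ u, u ≠ 0 → ∃ s : ℂ, m.mulVec u = s • u) : ∃ μ : ℂ, m = μ • 1 := by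
  obtain ⟨a, ha⟩ := h ![1, 0] (Function.ne_iff.2 ⟨0, one_ne_zero⟩)
  obtain ⟨b, hb⟩ := h ![0, 1] (Function.ne_iff.2 ⟨1, one_ne_zero⟩)
  obtain ⟨c, hc⟩ := h ![1, 1] (Function.ne_iff.2 ⟨0, one_ne_zero⟩)
  have a0 := congrFun ha 0
  have a1 := congrFun ha 1
  have b0 := congrFun hb 0
  have b1 := congrFun hb 1
  have c0 := congrFun hc 0
  have c1 := congrFun hc 1
  simp [Matrix.mulVec, dotProduct, Fin.sum_univ_two] at a0 a1 b0 b1 c0 c1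
  refine ⟨a, ?_⟩
  ext i j
  fin_cases i <;> fin_cases j <;> simp [a0, a1, b0, b1]
  rw [a0, b0, add_zero] at c0
  rw [a1, b1, zero_add] at c1
  rw [c0, c1]

/-- A pair acting as a scalar on `Mat3` fixes every point of the surface. The surface determines
both factors, so each matrix fixes every point of the line. -/
theorem eq_smul_one_of_segreAct {m n : Matrix (Fin 2) (Fin 2) ℂ} {s : ℂ} (hs : s ≠ 0)
    (h : ∀ Y, s • segreAct m n Y = Y) : (∃ μ : ℂ, m = μ • 1) ∧ ∃ ν : ℂ, n = ν • 1 := by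
  have h1 : ∀ u w, u ≠ 0 → w ≠ 0 →
      (∃ s : ℂ, m.mulVec u = s • u) ∧ ∃ s : ℂ, n.mulVec w = s • w := by
    intro u w hu hw
    have e : segre (m.mulVec u) (n.mulVec w) = s⁻¹ • segre u w := by
      rw [← segreAct_segre, ← h (segre u w), map_smul, smul_smul, inv_mul_cancel₀ hs, one_smul, h]
    have hne : segre (m.mulVec u) (n.mulVec w) ≠ 0 := by
      rw [e]
      exact smul_ne_zero (inv_ne_zero hs) (segre_ne_zero hu hw)
    refine exists_smul_of_segre_eq hu hw ?_ ?_ e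
    · intro h0
      exact hne (by ext; simp [segre_apply, h0, conicVec_zero])
    · intro h0
      exact hne (by ext; simp [segre_apply, h0, conicVec_zero])
  have h0 : (![1, 0] : Fin 2 → ℂ) ≠ 0 := Function.ne_iff.2 ⟨0, one_ne_zero⟩
  exact ⟨eq_smul_one_of_mulVec fun u hu => (h1 u _ hu h0).1,
    eq_smul_one_of_mulVec fun w hw => (h1 _ w h0 hw).2⟩

/-- The Hilbert 90 theorem for the complex conjugation of projective transformations of the line. -/
theorem exists_twist {a : Matrix (Fin 2) (Fin 2) ℂ} (ha : IsUnit a.det) {μ : ℂ}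
    (h : a * a.map (starRingEnd ℂ) = μ • 1) : ∃ k g : Matrix (Fin 2) (Fin 2) ℂ, IsUnit k.det ∧
      IsTwist g ∧ ∃ s : ℂ, s ≠ 0 ∧ a * k.map (starRingEnd ℂ) = s • (k * g) := by
  have e00 := congrFun (congrFun h 0) 0
  have e01 := congrFun (congrFun h 0) 1
  have e10 := congrFun (congrFun h 1) 0
  have e11 := congrFun (congrFun h 1) 1
  simp [Matrix.mul_apply, Fin.sum_univ_two] at e00 e01 e10 e11
  have hdet := ha.ne_zero
  rw [Matrix.det_fin_two] at hdet
  -- The relation makes `a` commute with its conjugate, and comparison of the two products shows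
  -- that `μ` is real; its sign distinguishes the two twists.
  have hreal : star μ = μ := by
    have h1 : a.map (starRingEnd ℂ) * a = μ • 1 := by
      have hdet' : IsUnit (a.map (starRingEnd ℂ)).det := by
        rw [← RingHom.mapMatrix_apply, ← RingHom.map_det]
        exact ha.map _
      have h2 : a * (a.map (starRingEnd ℂ) * a) = a * (μ • 1) := by
        rw [← mul_assoc, h, Matrix.smul_mul, Matrix.mul_smul, one_mul, mul_one]
      have := congrArg (fun m => a⁻¹ * m) h2
      simpa only [← mul_assoc, Matrix.nonsing_inv_mul _ ha, one_mul] using this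
    have h2 := congrFun (congrFun h1 0) 0
    simp [Matrix.mul_apply, Fin.sum_univ_two] at h2
    have h3 := congrArg (starRingEnd ℂ) e00
    simp only [map_add, map_mul, Complex.conj_conj] at h3
    rw [h2] at h3
    exact h3.symm
  have hμ : ((μ.re : ℝ) : ℂ) = μ := Complex.conj_eq_iff_re.1 hreal
  have hμ0 : μ.re ≠ 0 := by
    intro h0
    rw [← hμ, h0, Complex.ofReal_zero, zero_smul] at h
    have := congrArg Matrix.det h
    rw [Matrix.det_mul, Matrix.det_zero, ← RingHom.mapMatrix_apply, ← RingHom.map_det] at this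
    exact (mul_ne_zero ha.ne_zero ((map_ne_zero _).2 ha.ne_zero)) this
  rcases hμ0.lt_or_gt with hneg | hpos
  · set r : ℝ := Real.sqrt (-μ.re) with hr
    have hr0 : (r : ℂ) ≠ 0 := Complex.ofReal_ne_zero.2 (Real.sqrt_pos.2 (neg_pos.2 hneg)).ne'
    have hr2 : (r : ℂ) * r = -μ := by
      rw [← hμ, ← Complex.ofReal_mul, hr, Real.mul_self_sqrt (neg_pos.2 hneg).le,
        Complex.ofReal_neg]
    have ha10 : a 1 0 ≠ 0 := by
      intro h0
      rw [h0, map_zero, mul_zero, add_zero, Complex.mul_conj, ← hμ] at e00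
      have : Complex.normSq (a 0 0) = μ.re := by exact_mod_cast e00
      linarith [Complex.normSq_nonneg (a 0 0)]
    -- The columns are `r` times the first basis vector and its image under u ↦ a ū. In these
    -- columns that antilinear map is the quaternionic one up to `r`, since its square is μ = -r².
    refine ⟨!![(r : ℂ), a 0 0; 0, a 1 0], quat, ?_, Or.inr rfl, r, hr0, ?_⟩
    · rw [isUnit_iff_ne_zero, Matrix.det_fin_two]
      simp [hr0, ha10]
    · ext i j
      fin_cases i <;> fin_cases j <;>
        simp [Matrix.mul_apply, Fin.sum_univ_two, quat, e00, e10, hr2, mul_comm]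
  · set r : ℝ := Real.sqrt μ.re with hr
    have hr0 : (r : ℂ) ≠ 0 := Complex.ofReal_ne_zero.2 (Real.sqrt_pos.2 hpos).ne'
    have hr2 : (r : ℂ) * r = μ := by
      rw [← Complex.ofReal_mul, hr, Real.mul_self_sqrt hpos.le, hμ]
    -- Averaging in the manner of Hilbert 90: α r + ᾱ a is sent to `r` times itself. Its determinant
    -- is a quadratic polynomial in α and ᾱ whose α² coefficient r² is isolated by the values at 1,
    -- I and 1 + I.
    obtain ⟨α, hα⟩ : ∃ α : ℂ, ((α * r) • 1 + star α • a).det ≠ 0 := by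
      by_contra! h0
      have d1 := h0 1
      have d2 := h0 Complex.I
      have d3 := h0 (1 + Complex.I)
      simp [Matrix.det_fin_two] at d1 d2 d3
      have : Complex.I * (r * r) = 0 := by
        linear_combination (norm := (ring_nf; simp; ring_nf))
          (d3 - (1 - Complex.I) * d1 - (1 + Complex.I) * d2) / 4
      exact mul_ne_zero Complex.I_ne_zero (mul_ne_zero hr0 hr0) this
    refine ⟨_, 1, isUnit_iff_ne_zero.2 hα, Or.inl rfl, r, hr0, ?_⟩
    have : ((α * r) • 1 + star α • a).map (starRingEnd ℂ) =
        (star α * r) • 1 + α • a.map (starRingEnd ℂ) := by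
      ext i j
      fin_cases i <;> fin_cases j <;> simp
    rw [this, mul_add, Matrix.mul_smul, Matrix.mul_smul, h, mul_one, mul_one, ← hr2]
    module

/-- The parametrization of a real double Segre surface can be chosen so that its real structure
is one of four. -/
theorem IsParam.exists_normal_form {P : Mat3 ≃ₗ[ℂ] (Fin 9 → ℂ)} {X : Set (CP 8)}
    (h : IsParam P X) (hX : CP.IsReal X) : ∃ P' : Mat3 ≃ₗ[ℂ] (Fin 9 → ℂ), IsParam P' X ∧
      ((∀ Y, star (P' Y) = P' (twistedConj 1 1 Y)) ∨
        (∀ Y, star (P' Y) = P' (twistedConj quat 1 Y)) ∨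
        (∀ Y, star (P' Y) = P' (twistedConj quat quat Y)) ∨
        ∀ Y, star (P' Y) = P' (swapConj Y)) := by
  have hmm : ∀ V : Matrix (Fin 2) (Fin 2) ℂ,
      (V.map (starRingEnd ℂ)).map (starRingEnd ℂ) = V := fun V => by ext; simp
  obtain ⟨a, b, ha, hb, c, hc, H | H⟩ := h.exists_real_structure hX
  -- The conjugation of ℂ⁹ is an involution, so `a` and `b` times their conjugates act together as a
  -- scalar, which is the hypothesis of `exists_twist` for each factor.
  · have hid : ∀ Y, (star c * c) • segreAct (a * a.map (starRingEnd ℂ))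
        (b * b.map (starRingEnd ℂ)) Y = Y := by
      intro Y
      have h1 := congrArg star (H Y)
      rw [star_star, star_smul, H, conjMat_segreAct, conjMat_conjMat, segreAct_segreAct, smul_smul,
        ← map_smul, P.injective.eq_iff] at h1
      exact h1.symm
    obtain ⟨⟨μ, hμ⟩, ν, hν⟩ := eq_smul_one_of_segreAct (mul_ne_zero (star_ne_zero.2 hc) hc) hid
    obtain ⟨k, g, hk, hg, s, hs, ek⟩ := exists_twist ha hμ
    obtain ⟨l, g', hl, hg', t, ht, el⟩ := exists_twist hb hν
    obtain ⟨P', hP', e⟩ := (h.act hk hl).exists_rescale (κ := twistedConj g g')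
      (c := c * (s ^ 2 * t ^ 2)) (twistedConj_twistedConj hg hg') (fun Y => by
        rw [LinearEquiv.trans_apply, LinearEquiv.trans_apply, segreActEquiv_apply,
          segreActEquiv_apply, H, conjMat_segreAct, segreAct_segreAct, ek, el, segreAct_smul_smul,
          map_smul, smul_smul, twistedConj, segreAct_segreAct])
    rcases hg with rfl | rfl <;> rcases hg' with rfl | rfl
    · exact ⟨P', hP', Or.inl e⟩
    -- Exchanging the factors moves the quaternionic twist to the first one.
    · refine ⟨_, hP'.transpose, Or.inr (Or.inl fun Y => ?_)⟩
      change star (P' Y.transpose) = P' (twistedConj quat 1 Y).transpose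
      rw [e, twistedConj, twistedConj, segreAct_transpose, conjMat_transpose]
    · exact ⟨P', hP', Or.inr (Or.inl e)⟩
    · exact ⟨P', hP', Or.inr (Or.inr (Or.inl e))⟩
  · have hid : ∀ Y, (star c * c) • segreAct (a * b.map (starRingEnd ℂ))
        (b * a.map (starRingEnd ℂ)) Y = Y := by
      intro Y
      have h1 := congrArg star (H Y)
      rw [star_star, star_smul, H, conjMat_segreAct, segreAct_transpose, ← conjMat_transpose,
        Matrix.transpose_transpose, conjMat_conjMat, segreAct_segreAct, smul_smul,
        ← map_smul, P.injective.eq_iff] at h1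
      exact h1.symm
    -- With exchanged factors the involution property says that `a` is inverse to the conjugate of
    -- `b` up to a scalar. Reparametrizing by `b` on the second factor alone therefore removes both
    -- matrices.
    obtain ⟨⟨μ, hμ⟩, -⟩ := eq_smul_one_of_segreAct (mul_ne_zero (star_ne_zero.2 hc) hc) hid
    have h1 : IsUnit (1 : Matrix (Fin 2) (Fin 2) ℂ).det := by rw [Matrix.det_one]; exact isUnit_one
    obtain ⟨P', hP', e⟩ := (h.act h1 hb).exists_rescale (κ := swapConj)
      (c := c * μ ^ 2) isRealStructure_swapConj.involutive (fun Y => by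
        rw [LinearEquiv.trans_apply, LinearEquiv.trans_apply, segreActEquiv_apply,
          segreActEquiv_apply, H, conjMat_segreAct, segreAct_transpose, segreAct_segreAct, hμ,
          Matrix.map_one _ (map_zero _) (map_one _), mul_one, ← one_smul ℂ b, segreAct_smul_smul,
          map_smul, smul_smul, one_pow, mul_one, one_smul, swapConj])
    exact ⟨P', hP', Or.inr (Or.inr (Or.inr e))⟩

/-! ### Signatures -/

theorem toQuadraticForm'_apply {n : ℕ} (A : Matrix (Fin n) (Fin n) ℝ) (x : Fin n → ℝ) :
    A.toQuadraticForm' x = x ⬝ᵥ A.mulVec x := by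
  simp [Matrix.toQuadraticForm', Matrix.toLinearMap₂'_apply']

/-- Orthogonality with nonzero norms makes the vectors a basis in which the form is diagonal, and
Sylvester's law of inertia counts the signs. -/
theorem signature_of_orthogonal {n : ℕ} {ι : Type*} [Fintype ι] [DecidableEq ι]
    (hι : Fintype.card ι = n) {A : Matrix (Fin n) (Fin n) ℝ} {x : ι → Fin n → ℝ} {w : ι → ℝ}
    (hw : ∀ i, w i ≠ 0) (h : ∀ i j, x i ⬝ᵥ A.mulVec (x j) = if i = j then w i else 0) :
    sigPos A.toQuadraticForm' = {i | 0 < w i}.ncard ∧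
      sigNeg A.toQuadraticForm' = {i | w i < 0}.ncard := by
  have hB : ∀ i j, Matrix.toLinearMap₂' ℝ A (x i) (x j) = if i = j then w i else 0 := fun i j => by
    rw [Matrix.toLinearMap₂'_apply', h]
  have hli : LinearIndependent ℝ x := by
    refine LinearMap.linearIndependent_of_isOrthoᵢ (B := Matrix.toLinearMap₂' ℝ A)
      (LinearMap.isOrthoᵢ_def.2 fun i j hij => ?_) fun i => ?_
    · rw [hB, if_neg hij]
    · rw [hB, if_pos rfl]
      exact hw i
  rcases isEmpty_or_nonempty ι with hι' | hι'
  · have hn : n = 0 := by rw [← hι, Fintype.card_eq_zero]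
    subst hn
    have h0 := sigPos_le_finrank A.toQuadraticForm'
    have h1 := sigPos_le_finrank (-A.toQuadraticForm')
    simp only [Module.finrank_fin_fun, Nat.le_zero] at h0 h1
    rw [← sigPos_neg, h0, h1]
    simp [Set.eq_empty_of_isEmpty]
  let b := basisOfLinearIndependentOfCardEqFinrank hli (by simp [hι])
  have hb : ∀ i, b i = x i := fun i => by simp [b]
  have hQ : QuadraticMap.Equivalent (QuadraticMap.weightedSumSquares ℝ w) A.toQuadraticForm' := by
    refine ⟨{ b.equivFun.symm with map_app' := fun c => ?_ }⟩
    change A.toQuadraticForm' (b.equivFun.symm c) = _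
    rw [toQuadraticForm'_apply, ← Matrix.toLinearMap₂'_apply', Module.Basis.equivFun_symm_apply,
      QuadraticMap.weightedSumSquares_apply]
    simp only [map_sum, LinearMap.sum_apply, map_smul, LinearMap.smul_apply, hb, hB]
    refine Finset.sum_congr rfl fun i _ => ?_
    simp
    ring
  exact ⟨QuadraticForm.sigPos_of_equiv_weightedSumSquares hQ.symm,
    QuadraticForm.sigNeg_of_equiv_weightedSumSquares hQ.symm⟩

theorem card_filter_sign {ι : Type*} [Fintype ι] (c : Bool) {w : ι → ℝ} (hw : ∀ i, w i ≠ 0) :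
    (Finset.univ.filter fun i => decide (0 < w i) = c).card =
      if c then {i | 0 < w i}.ncard else {i | w i < 0}.ncard := by
  split_ifs with hc
  · rw [Set.ncard_eq_toFinset_card']
    congr 1
    ext i
    simp [hc]
  · rw [Set.ncard_eq_toFinset_card']
    congr 1
    ext i
    have := hw i
    simp [hc]
    grind

/-- The counts exhaust the index set, so no `w'` is zero, and a bijection can be chosen separately
on the positive and the negative indices. -/
theorem exists_equiv_of_sign {ι ι' : Type*} [Fintype ι] [Fintype ι'] {w : ι → ℝ}
    {w' : ι' → ℝ} (hw : ∀ i, w i ≠ 0) (hpos : {i | 0 < w i}.ncard = {i | 0 < w' i}.ncard)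
    (hneg : {i | w i < 0}.ncard = {i | w' i < 0}.ncard)
    (hcard : Fintype.card ι = Fintype.card ι') : ∃ e : ι ≃ ι', ∀ i, 0 < w i / w' (e i) := by
  classical
  have hsum : {i | 0 < w i}.ncard + {i | w i < 0}.ncard = Fintype.card ι := by
    rw [← Set.ncard_union_eq, ← Nat.card_eq_fintype_card, ← Set.ncard_univ]
    · congr 1
      ext i
      simpa using (hw i).lt_or_gt.symm
    · exact Set.disjoint_left.2 fun i (h : 0 < w i) (h' : w i < 0) => h.not_gt h'
  have hne : ∀ i, w' i ≠ 0 := by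
    have h1 : {i | 0 < w' i} ∪ {i | w' i < 0} = Set.univ := by
      refine Set.eq_of_subset_of_ncard_le (Set.subset_univ _) ?_
      rw [Set.ncard_union_eq, ← hpos, ← hneg, hsum, hcard, Set.ncard_univ,
        Nat.card_eq_fintype_card]
      exact Set.disjoint_left.2 fun i (h : 0 < w' i) (h' : w' i < 0) => h.not_gt h'
    intro i h0
    have : i ∈ {i | 0 < w' i} ∪ {i | w' i < 0} := by rw [h1]; trivial
    rcases this with (h : 0 < w' i) | (h : w' i < 0) <;> exact h.ne (by rw [h0])
  have hfib : ∀ c : Bool, Nonempty ({i // decide (0 < w i) = c} ≃ {i // decide (0 < w' i) = c}) := by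
    intro c
    rw [← Fintype.card_eq, Fintype.card_subtype, Fintype.card_subtype]
    rw [card_filter_sign c hw, card_filter_sign c hne, hpos, hneg]
  let e := Equiv.ofFiberEquiv (f := fun i => decide (0 < w i))
    (g := fun i => decide (0 < w' i)) fun c => (hfib c).some
  refine ⟨e, fun i => ?_⟩
  have h1 : decide (0 < w' (e i)) = decide (0 < w i) := Equiv.ofFiberEquiv_map (f := fun i => decide (0 < w i))
    (g := fun i => decide (0 < w' i)) _ i
  rw [decide_eq_decide] at h1
  rcases (hw i).lt_or_gt with h | h
  · refine div_pos_of_neg_of_neg h ((hne _).lt_or_gt.resolve_right fun h' => ?_)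
    exact h.not_gt (h1.1 h')
  · exact div_pos h (h1.2 h)

/-- A converse to Sylvester's law: diagonalize the form, match the diagonal entries with the
prescribed weights of the same sign, and rescale by square roots of the positive ratios. -/
theorem HasSignature.exists_orthogonal {n r s : ℕ} {A : Matrix (Fin n) (Fin n) ℝ}
    (hA : HasSignature A r s) {ι : Type*} [Fintype ι] [DecidableEq ι] {w : ι → ℝ}
    (hw : ∀ i, w i ≠ 0) (hcard : Fintype.card ι = n)
    (hpos : {i | 0 < w i}.ncard = r) (hneg : {i | w i < 0}.ncard = s) :
    ∃ x : ι → Fin n → ℝ, ∀ i j, x i ⬝ᵥ A.mulVec (x j) = if i = j then w i else 0 := by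
  obtain ⟨hsymm, -, hr, hs⟩ := hA
  obtain ⟨w', ⟨φ⟩⟩ := QuadraticForm.equivalent_weightedSumSquares A.toQuadraticForm'
  have h1 := QuadraticForm.sigPos_of_equiv_weightedSumSquares ⟨φ⟩
  have h2 := QuadraticForm.sigNeg_of_equiv_weightedSumSquares ⟨φ⟩
  obtain ⟨e, he⟩ := exists_equiv_of_sign (w := w) (w' := w') hw (by rw [hpos, ← h1, hr])
    (by rw [hneg, ← h2, hs]) (by simp [hcard])
  let v : Fin (Module.finrank ℝ (Fin n → ℝ)) → Fin n → ℝ := fun i => φ.symm (Pi.single i 1)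
  have hQ : ∀ c, (φ.symm c) ⬝ᵥ A.mulVec (φ.symm c) = ∑ i, w' i * (c i * c i) := by
    intro c
    rw [← toQuadraticForm'_apply, φ.symm.map_app, QuadraticMap.weightedSumSquares_apply]
    rfl
  have hcomm : ∀ y z : Fin n → ℝ, z ⬝ᵥ A.mulVec y = y ⬝ᵥ A.mulVec z := by
    intro y z
    rw [Matrix.dotProduct_mulVec, dotProduct_comm, ← Matrix.mulVec_transpose, hsymm]
  -- Only the quadratic form is transported by `φ`; its bilinear form is recovered by polarization.
  have hv : ∀ i j, v i ⬝ᵥ A.mulVec (v j) = if i = j then w' i else 0 := by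
    intro i j
    have h3 := hQ (Pi.single i 1 + Pi.single j 1)
    have h4 := hQ (Pi.single i 1)
    have h5 := hQ (Pi.single j 1)
    have h6 : φ.symm (Pi.single i 1 + Pi.single j 1) = v i + v j :=
      map_add φ.symm.toLinearEquiv _ _
    rw [h6, Matrix.mulVec_add, add_dotProduct, dotProduct_add, dotProduct_add,
      hcomm (v i) (v j)] at h3
    change v i ⬝ᵥ A.mulVec (v i) = _ at h4
    change v j ⬝ᵥ A.mulVec (v j) = _ at h5
    rw [h4, h5] at h3
    simp only [Pi.add_apply, add_mul, mul_add, Finset.sum_add_distrib] at h3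
    simp [Pi.single_apply] at h3
    split_ifs with hij
    · subst hij
      simpa [Pi.single_apply] using h4
    · simp [hij, Ne.symm hij] at h3
      linarith
  refine ⟨fun i => Real.sqrt (w i / w' (e i)) • v (e i), fun i j => ?_⟩
  rw [Matrix.mulVec_smul, smul_dotProduct, dotProduct_smul, hv]
  by_cases hij : i = j
  · subst hij
    rw [if_pos rfl, if_pos rfl, smul_eq_mul, smul_eq_mul, ← mul_assoc,
      Real.mul_self_sqrt (he i).le]
    refine div_mul_cancel₀ _ fun h0 => ?_
    have := he i
    simp [h0] at this
  · rw [if_neg hij, if_neg fun h => hij (e.injective h), smul_zero, smul_zero]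

/-! ### Real frames -/

/-- A frame of the ambient space of the double Segre surface that consists of real points and is
orthogonal for the invariant form. -/
structure IsRealFrame (κ : Mat3 → Mat3) (B : Fin 3 × Fin 3 → Mat3) (w : Fin 3 × Fin 3 → ℤ) :
    Prop where
  fixed : ∀ i, κ (B i) = B i
  ne_zero : ∀ i, w i ≠ 0
  segreForm_eq : ∀ i j, segreForm (B i) (B j) = if i = j then (w i : ℂ) else 0

/-- The signs of the equation of the conic. -/
def intSign : Fin 3 → ℤ := ![-1, 1, 1]

theorem conicSign_eq (i : Fin 3) : conicSign i = (intSign i : ℂ) := by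
  fin_cases i <;> simp [conicSign, intSign]

theorem segreForm_single (Y : Mat3) (i j : Fin 3) :
    segreForm (Matrix.single i j 1) Y = conicSign i * conicSign j * Y i j := by
  simp only [segreForm, Matrix.single_apply]
  rw [Finset.sum_eq_single i, Finset.sum_eq_single j] <;> simp +contextual [eq_comm]

theorem segreForm_smul_left (c : ℂ) (Y Z : Mat3) : segreForm (c • Y) Z = c * segreForm Y Z := by
  simp only [segreForm, Finset.mul_sum, Matrix.smul_apply, smul_eq_mul]
  exact Finset.sum_congr rfl fun i _ => Finset.sum_congr rfl fun j _ => by ring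

/-- The real points are the real matrices; the weights give signature (5,4). -/
theorem isRealFrame_one_one : IsRealFrame (twistedConj 1 1)
    (fun i => Matrix.single i.1 i.2 1) (fun i => intSign i.1 * intSign i.2) where
  fixed i := by
    rw [twistedConj_one_one]
    ext a b
    simp [conjMat, Matrix.single_apply, apply_ite (starRingEnd ℂ)]
  ne_zero := by decide
  segreForm_eq i j := by
    rw [segreForm_single, Matrix.single_apply, conicSign_eq, conicSign_eq]
    by_cases h : i = j
    · subst h
      simp
    · rw [if_neg h, if_neg fun h' => h (Prod.ext h'.1.symm h'.2.symm), mul_zero]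

theorem twistedConj_quat_one_apply (Y : Mat3) (i j : Fin 3) :
    twistedConj quat 1 Y i j = (-intSign i : ℂ) * star (Y i j) := by
  rw [twistedConj, segreAct, sandwich_apply, sym2_quat, sym2_one, Matrix.transpose_one, mul_one,
    Matrix.diagonal_mul]
  fin_cases i <;> simp [conjMat, intSign]

theorem twistedConj_quat_quat_apply (Y : Mat3) (i j : Fin 3) :
    twistedConj quat quat Y i j = (intSign i * intSign j : ℂ) * star (Y i j) := by
  rw [twistedConj, segreAct, sandwich_apply, sym2_quat, Matrix.diagonal_transpose,
    Matrix.mul_diagonal, Matrix.diagonal_mul]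
  fin_cases i <;> fin_cases j <;> simp [conjMat, intSign]

/-- Real points have a real first row and imaginary other rows. The factor `I` reverses the sign of
these rows, which gives signature (3,6). -/
theorem isRealFrame_quat_one : IsRealFrame (twistedConj quat 1)
    (fun i => (if i.1 = 0 then 1 else Complex.I) • Matrix.single i.1 i.2 1)
    (fun i => - intSign i.2) where
  fixed i := by
    ext a b
    rw [twistedConj_quat_one_apply]
    by_cases h : i.1 = a ∧ i.2 = b
    · obtain ⟨rfl, rfl⟩ := h
      obtain ⟨a, b⟩ := i
      fin_cases a <;> simp [intSign]
    · simp [h]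
  ne_zero := by decide
  segreForm_eq i j := by
    rw [segreForm_smul_left, segreForm_single, conicSign_eq, conicSign_eq, Matrix.smul_apply,
      Matrix.single_apply]
    by_cases h : i = j
    · subst h
      obtain ⟨a, b⟩ := i
      generalize intSign b = s
      fin_cases a <;> simp [intSign]
      all_goals linear_combination (s : ℂ) * Complex.I_mul_I
    · have h' : ¬(j.1 = i.1 ∧ j.2 = i.2) := fun h' => h (Prod.ext h'.1.symm h'.2.symm)
      rw [if_neg h, if_neg h', smul_zero, mul_zero, mul_zero]

/-- The entries with a negative sign are exactly the imaginary ones, so the form becomes positive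
definite. -/
theorem isRealFrame_quat_quat : IsRealFrame (twistedConj quat quat)
    (fun i => (if i.1 = 0 ↔ i.2 = 0 then 1 else Complex.I) • Matrix.single i.1 i.2 1)
    (fun _ => 1) where
  fixed i := by
    ext a b
    rw [twistedConj_quat_quat_apply]
    by_cases h : i.1 = a ∧ i.2 = b
    · obtain ⟨rfl, rfl⟩ := h
      obtain ⟨a, b⟩ := i
      fin_cases a <;> fin_cases b <;> simp [intSign]
    · simp [h]
  ne_zero := by decide
  segreForm_eq i j := by
    rw [segreForm_smul_left, segreForm_single, conicSign_eq, conicSign_eq, Matrix.smul_apply,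
      Matrix.single_apply]
    by_cases h : i = j
    · subst h
      obtain ⟨a, b⟩ := i
      fin_cases a <;> fin_cases b <;> simp [intSign]
    · have h' : ¬(j.1 = i.1 ∧ j.2 = i.2) := fun h' => h (Prod.ext h'.1.symm h'.2.symm)
      rw [if_neg h, if_neg h', smul_zero, mul_zero, mul_zero]

/-- The real frame for the interchange of the factors. -/
noncomputable def swapFrame (i : Fin 3 × Fin 3) : Mat3 :=
  if i.1 = i.2 then Matrix.single i.1 i.2 1
  else if i.1 < i.2 then Matrix.single i.1 i.2 1 + Matrix.single i.2 i.1 1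
  else Complex.I • (Matrix.single i.1 i.2 1 - Matrix.single i.2 i.1 1)

/-- The norms of the real frame for the interchange of the factors. -/
def swapWeight (i : Fin 3 × Fin 3) : ℤ :=
  if i.1 = i.2 then 1 else if i.1 < i.2 then 2 * intSign i.1 * intSign i.2
  else -2 * intSign i.1 * intSign i.2

/-- The real points are the Hermitian matrices. The diagonal contributes three positive signs and
each off-diagonal pair two equal norms up to sign, as `swapWeight` records; the total signature is
(6,3). -/
theorem isRealFrame_swapConj : IsRealFrame swapConj swapFrame swapWeight where
  fixed i := by
    obtain ⟨a, b⟩ := i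
    ext p q
    fin_cases a <;> fin_cases b <;> fin_cases p <;> fin_cases q <;>
      simp [swapFrame, swapConj, conjMat]
  ne_zero := by decide
  segreForm_eq i j := by
    obtain ⟨a, b⟩ := i
    obtain ⟨p, q⟩ := j
    fin_cases a <;> fin_cases b <;> fin_cases p <;> fin_cases q <;>
      simp [swapFrame, swapWeight, segreForm, Fin.sum_univ_three, intSign, conicSign, Matrix.single_apply]  <;> norm_num

theorem IsRealFrame.exists_real {κ : Mat3 → Mat3} {B : Fin 3 × Fin 3 → Mat3}
    {w : Fin 3 × Fin 3 → ℤ} (hB : IsRealFrame κ B w) {P : Mat3 ≃ₗ[ℂ] (Fin 9 → ℂ)}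
    (hP : ∀ Y, star (P Y) = P (κ Y)) :
    ∃ x : Fin 3 × Fin 3 → Fin 9 → ℝ, ∀ i, P (B i) = fun k => (x i k : ℂ) := by
  refine ⟨fun i k => (P (B i) k).re, fun i => funext fun k => ?_⟩
  have h := congrFun (hP (B i)) k
  rw [hB.fixed] at h
  exact (Complex.conj_eq_iff_re.1 h).symm

/-- The number of positive entries. -/
def posCount (w : Fin 3 × Fin 3 → ℤ) : ℕ := (Finset.univ.filter fun i => 0 < w i).card

/-- The number of negative entries. -/
def negCount (w : Fin 3 × Fin 3 → ℤ) : ℕ := (Finset.univ.filter fun i => w i < 0).card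

theorem ncard_pos (w : Fin 3 × Fin 3 → ℤ) : {i | 0 < w i}.ncard = posCount w := by
  rw [Set.ncard_eq_toFinset_card', posCount]
  congr 1
  ext i
  simp

theorem ncard_neg (w : Fin 3 × Fin 3 → ℤ) : {i | w i < 0}.ncard = negCount w := by
  rw [Set.ncard_eq_toFinset_card', negCount]
  congr 1
  ext i
  simp

/-- The signature of the multiples of the invariant form. -/
theorem IsRealFrame.signature {κ : Mat3 → Mat3} {B : Fin 3 × Fin 3 → Mat3}
    {w : Fin 3 × Fin 3 → ℤ} (hB : IsRealFrame κ B w) {P : Mat3 ≃ₗ[ℂ] (Fin 9 → ℂ)}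
    (hP : ∀ Y, star (P Y) = P (κ Y)) {A : Matrix (Fin 9) (Fin 9) ℝ} {k : ℝ} (hk : k ≠ 0)
    (hA : ∀ Y Z, cform A (P Y) (P Z) = k * segreForm Y Z) :
    (sigPos A.toQuadraticForm' = posCount w ∧ sigNeg A.toQuadraticForm' = negCount w) ∨
      (sigPos A.toQuadraticForm' = negCount w ∧ sigNeg A.toQuadraticForm' = posCount w) := by
  obtain ⟨x, hx⟩ := hB.exists_real hP
  have h := signature_of_orthogonal (A := A) (x := x) (w := fun i => k * w i) (by simp)
    (fun i => mul_ne_zero hk (Int.cast_ne_zero.2 (hB.ne_zero i))) (fun i j => by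
      have := hA (B i) (B j)
      rw [hx, hx, cform_ofReal, hB.segreForm_eq] at this
      split_ifs with hij
      · rw [if_pos hij] at this
        exact_mod_cast this
      · rw [if_neg hij, mul_zero] at this
        exact_mod_cast this)
  rcases hk.lt_or_gt with hk | hk
  · right
    rw [← ncard_pos, ← ncard_neg]
    have h1 : ∀ i, 0 < k * (w i : ℝ) ↔ w i < 0 := fun i => by
      rw [mul_pos_iff]; simp [hk, hk.not_gt]
    have h2 : ∀ i, k * (w i : ℝ) < 0 ↔ 0 < w i := fun i => by
      rw [mul_neg_iff]; simp [hk, hk.not_gt]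
    simpa only [h1, h2] using h
  · left
    rw [← ncard_pos, ← ncard_neg]
    have h1 : ∀ i, 0 < k * (w i : ℝ) ↔ 0 < w i := fun i => by
      rw [mul_pos_iff]; simp [hk, hk.not_gt]
    have h2 : ∀ i, k * (w i : ℝ) < 0 ↔ w i < 0 := fun i => by
      rw [mul_neg_iff]; simp [hk, hk.not_gt]
    simpa only [h1, h2] using h

/-- The invariant form as a bilinear map. -/
noncomputable def segreBilin : Mat3 →ₗ[ℂ] Mat3 →ₗ[ℂ] ℂ :=
  LinearMap.mk₂ ℂ segreForm
    (fun Y Y' Z => by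
      simp only [segreForm, ← Finset.sum_add_distrib, Matrix.add_apply]
      exact Finset.sum_congr rfl fun i _ => Finset.sum_congr rfl fun j _ => by ring)
    (fun c Y Z => segreForm_smul_left c Y Z)
    (fun Y Z Z' => by
      simp only [segreForm, ← Finset.sum_add_distrib, Matrix.add_apply]
      exact Finset.sum_congr rfl fun i _ => Finset.sum_congr rfl fun j _ => by ring)
    (fun c Y Z => by
      simp only [segreForm, Finset.mul_sum, Matrix.smul_apply, smul_eq_mul]
      exact Finset.sum_congr rfl fun i _ => Finset.sum_congr rfl fun j _ => by ring)

theorem segreBilin_apply (Y Z : Mat3) : segreBilin Y Z = segreForm Y Z := rfl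

/-- A real quadratic form with the opposite signature of the invariant form is, up to the sign,
the invariant form in suitable coordinates. -/
theorem IsRealFrame.exists_param {κ : Mat3 → Mat3} (hκ : IsRealStructure κ)
    {B : Fin 3 × Fin 3 → Mat3} {w : Fin 3 × Fin 3 → ℤ} (hB : IsRealFrame κ B w)
    {A : Matrix (Fin 9) (Fin 9) ℝ} (hA : HasSignature A (negCount w) (posCount w)) :
    ∃ P : Mat3 ≃ₗ[ℂ] (Fin 9 → ℂ), (∀ Y, star (P Y) = P (κ Y)) ∧
      ∀ Y Z, cform A (P Y) (P Z) = (-1 : ℝ) * segreForm Y Z := by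
  have hw0 : ∀ i, (w i : ℂ) ≠ 0 := fun i => Int.cast_ne_zero.2 (hB.ne_zero i)
  -- The weights are negated because `A` has the opposite signature. The isomorphism sends the frame
  -- `B` to these real vectors, and compatibility with conjugation and with the forms is checked on
  -- this basis.
  obtain ⟨x, hx⟩ := hA.exists_orthogonal (w := fun i => -(w i : ℝ))
    (fun i => neg_ne_zero.2 (Int.cast_ne_zero.2 (hB.ne_zero i))) (by simp)
    (by simpa only [neg_pos, Int.cast_lt_zero] using ncard_neg w)
    (by simpa only [neg_lt_zero, Int.cast_pos] using ncard_pos w)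
  have hB' : LinearIndependent ℂ B := by
    refine LinearMap.linearIndependent_of_isOrthoᵢ (B := segreBilin)
      (LinearMap.isOrthoᵢ_def.2 fun i j hij => ?_) fun i => ?_
    · rw [segreBilin_apply, hB.segreForm_eq, if_neg hij]
    · rw [segreBilin_apply, hB.segreForm_eq, if_pos rfl]
      exact hw0 i
  let y : Fin 3 × Fin 3 → Fin 9 → ℂ := fun i k => (x i k : ℂ)
  have hy : ∀ i j, cform A (y i) (y j) = if i = j then -(w i : ℂ) else 0 := by
    intro i j
    rw [cform_ofReal, hx]
    split_ifs <;> simp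
  have hy' : LinearIndependent ℂ y := by
    refine LinearMap.linearIndependent_of_isOrthoᵢ
      (B := Matrix.toLinearMap₂' ℂ (A.map Complex.ofReal))
      (LinearMap.isOrthoᵢ_def.2 fun i j hij => ?_) fun i => ?_
    · rw [Matrix.toLinearMap₂'_apply']
      exact (hy i j).trans (if_neg hij)
    · rw [Matrix.toLinearMap₂'_apply']
      change cform A (y i) (y i) ≠ 0
      rw [hy, if_pos rfl]
      exact neg_ne_zero.2 (hw0 i)
  let b := basisOfLinearIndependentOfCardEqFinrank hB' (by rw [finrank_mat3]; simp)
  let b' := basisOfLinearIndependentOfCardEqFinrank hy' (by simp)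
  have hb : ∀ i, b i = B i := fun i => by simp [b]
  have hb' : ∀ i, b' i = y i := fun i => by simp [b']
  have hbP : ∀ i, b.equiv b' (Equiv.refl _) (B i) = y i := fun i => by
    rw [← hb, Module.Basis.equiv_apply, Equiv.refl_apply, hb']
  refine ⟨b.equiv b' (Equiv.refl _), fun Y => ?_, fun Y Z => ?_⟩
  · let L₁ : Mat3 →ₛₗ[starRingEnd ℂ] (Fin 9 → ℂ) :=
      { toFun := fun Y => star (b.equiv b' (Equiv.refl _) Y)
        map_add' := fun Y Z => by rw [map_add, star_add]
        map_smul' := fun c Y => by rw [map_smul, star_smul]; rfl }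
    let L₂ : Mat3 →ₛₗ[starRingEnd ℂ] (Fin 9 → ℂ) :=
      { toFun := fun Y => b.equiv b' (Equiv.refl _) (κ Y)
        map_add' := fun Y Z => by rw [hκ.map_add, map_add]
        map_smul' := fun c Y => by rw [hκ.map_smul, map_smul]; rfl }
    have : L₁ = L₂ := by
      refine b.ext fun i => ?_
      change star (b.equiv b' (Equiv.refl _) (b i)) = b.equiv b' (Equiv.refl _) (κ (b i))
      rw [hb, hB.fixed, hbP]
      ext k
      simp [y]
    exact LinearMap.congr_fun this Y
  · have : paramBilin A (b.equiv b' (Equiv.refl _)) = (-1 : ℂ) • segreBilin := by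
      refine b.ext fun i => b.ext fun j => ?_
      rw [paramBilin_apply, hb, hb, hbP, hbP, hy, LinearMap.smul_apply, LinearMap.smul_apply,
        segreBilin_apply, hB.segreForm_eq]
      split_ifs <;> simp
    have h1 := LinearMap.congr_fun₂ this Y Z
    rw [paramBilin_apply, LinearMap.smul_apply, LinearMap.smul_apply, segreBilin_apply] at h1
    rw [h1]
    simp

/-! ### Projective equivalence and real points -/

/-- Two parametrized surfaces with the same real structure on quadrics of the invariant form are
projectively equivalent. -/
theorem IsParam.equivalentIn {A : Matrix (Fin 9) (Fin 9) ℝ} {P P' : Mat3 ≃ₗ[ℂ] (Fin 9 → ℂ)}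
    {X X' : Set (CP 8)} (h : IsParam P X) (h' : IsParam P' X') {κ : Mat3 → Mat3}
    (hP : ∀ Y, star (P Y) = P (κ Y)) (hP' : ∀ Y, star (P' Y) = P' (κ Y)) {k k' : ℝ}
    (hk : k ≠ 0) (hk' : k' ≠ 0) (hA : ∀ Y Z, cform A (P Y) (P Z) = k * segreForm Y Z)
    (hA' : ∀ Y Z, cform A (P' Y) (P' Z) = k' * segreForm Y Z) :
    EquivalentIn (quadric A) X X' := by
  -- The map P' ∘ P⁻¹ is real because both parametrizations turn conjugation into the same `κ`. The
  -- multiples `k` and `k'` may differ, since only the zero set of the form matters.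
  obtain ⟨M, hM⟩ := exists_real_matrix (L := (P.symm.trans P').toLinearMap)
    (P.symm.trans P').injective (fun v => by
      have hv : κ (P.symm v) = P.symm (star v) := by
        rw [← P.injective.eq_iff, ← hP, P.apply_symm_apply, P.apply_symm_apply]
      change star (P' (P.symm v)) = P' (P.symm (star v))
      rw [hP', hv])
  have hM' : ∀ p v, HasCoords p (P v) → HasCoords (CP.transf M p) (P' v) := by
    intro p v hp
    have := hp.transf M
    rw [hM] at this
    change HasCoords _ (P' (P.symm (P v))) at this
    rwa [P.symm_apply_apply] at this
  have hrep : ∀ p : CP 8, HasCoords p (P (P.symm p.rep)) := fun p => by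
    rw [P.apply_symm_apply]
    exact HasCoords.rep p
  have hQ : ∀ p, CP.transf M p ∈ quadric A ↔ p ∈ quadric A := by
    intro p
    rw [mem_quadric_param (Complex.ofReal_ne_zero.2 hk) hA (hrep p),
      mem_quadric_param (Complex.ofReal_ne_zero.2 hk') hA' (hM' _ _ (hrep p)),
      P.symm_apply_apply, P'.symm_apply_apply]
  have hS : ∀ p, CP.transf M p ∈ X' ↔ p ∈ X := by
    intro p
    rw [h p, h' _]
    refine exists_congr fun u => exists_congr fun w => and_congr_right fun _ =>
      and_congr_right fun _ => ⟨fun hp => ?_, fun hp => hM' _ _ hp⟩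
    obtain ⟨c, hc, e⟩ := (hM' _ _ (hrep p)).exists_smul hp
    rw [← map_smul, P'.injective.eq_iff] at e
    rw [e, map_smul, P.apply_symm_apply]
    exact (HasCoords.rep p).smul hc
  have himg : ∀ {S T : Set (CP 8)}, (∀ p, CP.transf M p ∈ T ↔ p ∈ S) → CP.transf M '' S = T := by
    intro S T hST
    ext q
    constructor
    · rintro ⟨p, hp, rfl⟩
      exact (hST p).2 hp
    · intro hq
      rw [← CP.transf_transf_inv M q] at hq
      exact ⟨_, (hST _).1 hq, CP.transf_transf_inv M q⟩
  exact ⟨M, himg hQ, himg hS⟩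

theorem exists_pos_of_sigPos {n : ℕ} {A : Matrix (Fin n) (Fin n) ℝ}
    (h : sigPos A.toQuadraticForm' ≠ 0) : ∃ x : Fin n → ℝ, 0 < x ⬝ᵥ A.mulVec x := by
  obtain ⟨V, hV, hpos⟩ := exists_finrank_eq_sigPos_and_posDef A.toQuadraticForm'
  have : Nontrivial V := Module.nontrivial_of_finrank_pos (R := ℝ) (by omega)
  obtain ⟨x, hx⟩ := exists_ne (0 : V)
  refine ⟨x, ?_⟩
  rw [← toQuadraticForm'_apply]
  exact hpos x hx

theorem exists_neg_of_sigNeg {n : ℕ} {A : Matrix (Fin n) (Fin n) ℝ}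
    (h : sigNeg A.toQuadraticForm' ≠ 0) : ∃ x : Fin n → ℝ, x ⬝ᵥ A.mulVec x < 0 := by
  obtain ⟨V, hV, hpos⟩ := exists_finrank_eq_sigNeg_and_negDef A.toQuadraticForm'
  have : Nontrivial V := Module.nontrivial_of_finrank_pos (R := ℝ) (by omega)
  obtain ⟨x, hx⟩ := exists_ne (0 : V)
  refine ⟨x, ?_⟩
  rw [← toQuadraticForm'_apply]
  have := hpos x hx
  exact neg_pos.1 this

/-- The invariant quadrics of double Segre surfaces are multiples of the invariant form in suitable
coordinates. -/
theorem IsDoubleSegre.exists_cform_eq {A : Matrix (Fin 9) (Fin 9) ℝ} (hA : A.IsSymm)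
    (hpos : sigPos A.toQuadraticForm' ≠ 0) (hneg : sigNeg A.toQuadraticForm' ≠ 0)
    {X : Set (CP 8)} (hX : IsDoubleSegre X) (haut : AutZeroSubset X (quadric A)) :
    ∃ P : Mat3 ≃ₗ[ℂ] (Fin 9 → ℂ), IsParam P X ∧
      (∃ k : ℝ, k ≠ 0 ∧ ∀ Y Z, cform A (P Y) (P Z) = k * segreForm Y Z) ∧
      ((∀ Y, star (P Y) = P (twistedConj 1 1 Y)) ∨
        (∀ Y, star (P Y) = P (twistedConj quat 1 Y)) ∨
        (∀ Y, star (P Y) = P (twistedConj quat quat Y)) ∨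
        ∀ Y, star (P Y) = P (swapConj Y)) := by
  obtain ⟨x, hx⟩ := exists_pos_of_sigPos hpos
  obtain ⟨y, hy⟩ := exists_neg_of_sigNeg hneg
  obtain ⟨P₀, h₀⟩ := hX.exists_param
  obtain ⟨P, hP, hκ⟩ := h₀.exists_normal_form hX.1
  have key : ∀ {κ : Mat3 → Mat3}, IsRealStructure κ → (∀ Y, star (P Y) = P (κ Y)) →
      ∃ k : ℝ, k ≠ 0 ∧ ∀ Y Z, cform A (P Y) (P Z) = k * segreForm Y Z := by
    intro κ h hs
    obtain ⟨θ, hθ, hθ1, hθκ⟩ := h.exists_pair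
    exact hP.exists_cform_eq hA hx hy hs θ hθ hθ1 hθκ h.segreForm_map haut
  refine ⟨P, hP, ?_, hκ⟩
  rcases hκ with h | h | h | h
  · exact key (isRealStructure_twistedConj (Or.inl rfl) (Or.inl rfl)) h
  · exact key (isRealStructure_twistedConj (Or.inr rfl) (Or.inl rfl)) h
  · exact key (isRealStructure_twistedConj (Or.inr rfl) (Or.inr rfl)) h
  · exact key isRealStructure_swapConj h

/-- A real point would give a `u` proportional to its quaternionic conjugate (-ū₁, ū₀), hence |u₀|²
+ |u₁|² = 0. The twist of the second factor plays no role. -/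
theorem IsParam.not_hasRealPoint {P : Mat3 ≃ₗ[ℂ] (Fin 9 → ℂ)} {X : Set (CP 8)} (h : IsParam P X)
    {g : Matrix (Fin 2) (Fin 2) ℂ} (hg : IsTwist g)
    (hs : ∀ Y, star (P Y) = P (twistedConj quat g Y)) : ¬CP.HasRealPoint X := by
  rintro ⟨p, hp, hpc⟩
  obtain ⟨u, w, hu, hw, hv⟩ := (h p).1 hp
  have hv' := hv.conj
  rw [hpc] at hv'
  obtain ⟨c, hc, e⟩ := hv.exists_smul hv'
  rw [hs, ← map_smul, P.injective.eq_iff, twistedConj, conjMat_segre, segreAct_segre] at e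
  have hne : ∀ {k : Matrix (Fin 2) (Fin 2) ℂ}, IsTwist k → ∀ {u : Fin 2 → ℂ}, u ≠ 0 →
      k.mulVec (star u) ≠ 0 := fun hk _ hu h0 =>
    star_ne_zero.2 hu (Matrix.eq_zero_of_mulVec_eq_zero hk.isUnit_det.ne_zero h0)
  obtain ⟨⟨s, es⟩, -⟩ := exists_smul_of_segre_eq hu hw (hne (Or.inr rfl) hu) (hne hg hw) e
  have e0 := congrFun es 0
  have e1 := congrFun es 1
  simp [quat, Matrix.mulVec, dotProduct, Fin.sum_univ_two] at e0 e1
  have h0 : (Complex.normSq (u 0) : ℂ) + Complex.normSq (u 1) = 0 := by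
    rw [← Complex.mul_conj, ← Complex.mul_conj]
    linear_combination u 0 * e1 - u 1 * e0
  have h1 : Complex.normSq (u 0) + Complex.normSq (u 1) = 0 := by exact_mod_cast h0
  have h2 := Complex.normSq_nonneg (u 0)
  have h3 := Complex.normSq_nonneg (u 1)
  have z0 : u 0 = 0 := Complex.normSq_eq_zero.1 (by linarith)
  have z1 : u 1 = 0 := Complex.normSq_eq_zero.1 (by linarith)
  refine hu (funext fun i => ?_)
  fin_cases i
  · exact z0
  · exact z1

/-- The surface with a given parametrization. -/
def segreSurface (P : Mat3 ≃ₗ[ℂ] (Fin 9 → ℂ)) : Set (CP 8) :=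
  {p | ∃ u w, u ≠ 0 ∧ w ≠ 0 ∧ HasCoords p (P (segre u w))}

theorem isParam_segreSurface (P : Mat3 ≃ₗ[ℂ] (Fin 9 → ℂ)) : IsParam P (segreSurface P) :=
  fun _ => Iff.rfl

theorem isReal_segreSurface_of_conj {P : Mat3 ≃ₗ[ℂ] (Fin 9 → ℂ)}
    (h : ∀ Y, star (P Y) = P (twistedConj 1 1 Y)) : CP.IsReal (segreSurface P) := by
  rintro p ⟨u, w, hu, hw, hp⟩
  refine ⟨star u, star w, star_ne_zero.2 hu, star_ne_zero.2 hw, ?_⟩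
  rw [← conjMat_segre, ← twistedConj_one_one, ← h]
  exact hp.conj

theorem isReal_segreSurface_of_swap {P : Mat3 ≃ₗ[ℂ] (Fin 9 → ℂ)}
    (h : ∀ Y, star (P Y) = P (swapConj Y)) : CP.IsReal (segreSurface P) := by
  rintro p ⟨u, w, hu, hw, hp⟩
  refine ⟨star w, star u, star_ne_zero.2 hw, star_ne_zero.2 hu, ?_⟩
  rw [← segre_transpose, ← conjMat_segre]
  change HasCoords _ (P (swapConj _))
  rw [← h]
  exact hp.conj

theorem hasRealPoint_segreSurface_of_swap {P : Mat3 ≃ₗ[ℂ] (Fin 9 → ℂ)}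
    (h : ∀ Y, star (P Y) = P (swapConj Y)) : CP.HasRealPoint (segreSurface P) := by
  have hv := exists_ne_zero_vec
  have hp := HasCoords.mk (param_ne_zero P hv hv)
  refine ⟨_, ⟨_, _, hv, hv, hp⟩, ?_⟩
  refine HasCoords.eq (v := P (segre (fun _ => 1) fun _ => 1)) ?_ hp
  have := hp.conj
  have hs : star (fun _ => 1 : Fin 2 → ℂ) = fun _ => 1 := by ext; simp
  rwa [h, swapConj, conjMat_segre, segre_transpose, hs] at this

/-! ### Real isomorphisms with products of circles and with the sphere -/

theorem exists_smul_of_vecMulVec_eq {m n : Type*} {a a' : m → ℂ} {b b' : n → ℂ} (ha : a ≠ 0)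
    (hb : b ≠ 0) {c : ℂ} (h : Matrix.vecMulVec a b = c • Matrix.vecMulVec a' b') :
    (∃ s : ℂ, s ≠ 0 ∧ a = s • a') ∧ ∃ t : ℂ, t ≠ 0 ∧ b = t • b' := by
  have h' : ∀ i j, a i * b j = c * (a' i * b' j) := fun i j => congrFun (congrFun h i) j
  obtain ⟨i, hi⟩ := Function.ne_iff.1 ha
  obtain ⟨j, hj⟩ := Function.ne_iff.1 hb
  simp only [Pi.zero_apply] at hi hj
  have e₁ : a = (c * b' j / b j) • a' := by
    ext k
    simp only [Pi.smul_apply, smul_eq_mul]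
    field_simp
    linear_combination h' k j
  have e₂ : b = (c * a' i / a i) • b' := by
    ext k
    simp only [Pi.smul_apply, smul_eq_mul]
    field_simp
    linear_combination h' i k
  refine ⟨⟨_, fun h0 => ?_, e₁⟩, ⟨_, fun h0 => ?_, e₂⟩⟩
  · rw [h0, zero_smul] at e₁
    exact ha e₁
  · rw [h0, zero_smul] at e₂
    exact hb e₂

theorem vecMulVec_ne_zero {m n : Type*} {a : m → ℂ} {b : n → ℂ} (ha : a ≠ 0) (hb : b ≠ 0) :
    Matrix.vecMulVec a b ≠ 0 := by
  obtain ⟨i, hi⟩ := Function.ne_iff.1 ha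
  obtain ⟨j, hj⟩ := Function.ne_iff.1 hb
  intro h
  exact mul_ne_zero hi hj (congrFun (congrFun h i) j)

/-- Square roots of (v₀ + v₁)/2 and (v₀ - v₁)/2 serve as coordinates of `u`; the equation forces v₂
to be twice their product up to a sign, which the second root absorbs. -/
theorem mem_moebiusQuadric_one {y : CP 2} {v : Fin 3 → ℂ} (h : HasCoords y v) :
    y ∈ moebiusQuadric 1 ↔ ∃ u : Fin 2 → ℂ, u ≠ 0 ∧ v = conicVec u := by
  have key : y ∈ moebiusQuadric 1 ↔ -(v 0 * v 0) + (v 1 * v 1 + v 2 * v 2) = 0 := by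
    rw [moebiusQuadric, CP.mem_quadric h]
    simp [Matrix.diagonal_map, dotProduct, Matrix.mulVec_diagonal, Fin.sum_univ_succ]
  rw [key]
  constructor
  · intro hv
    obtain ⟨s, hs⟩ := IsAlgClosed.exists_pow_nat_eq ((v 0 + v 1) / 2) (n := 2) two_pos
    obtain ⟨t, ht⟩ := IsAlgClosed.exists_pow_nat_eq ((v 0 - v 1) / 2) (n := 2) two_pos
    have hst : (v 2 - 2 * s * t) * (v 2 + 2 * s * t) = 0 := by
      linear_combination hv - 4 * t ^ 2 * hs - 2 * (v 0 + v 1) * ht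
    have gen : ∀ t' : ℂ, t' ^ 2 = (v 0 - v 1) / 2 → v 2 = 2 * s * t' →
        ∃ u : Fin 2 → ℂ, u ≠ 0 ∧ v = conicVec u := by
      intro t' ht' h2
      have e : v = conicVec ![s, t'] := by
        ext i
        fin_cases i
        · simp [conicVec]; linear_combination -hs - ht'
        · simp [conicVec]; linear_combination -hs + ht'
        · simpa [conicVec] using h2
      refine ⟨_, fun h0 => ?_, e⟩
      rw [h0, conicVec_zero] at e
      exact h.ne_zero e
    rcases mul_eq_zero.1 hst with h0 | h0
    · exact gen t ht (by linear_combination h0)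
    · exact gen (-t) (by rw [neg_sq, ht]) (by linear_combination h0)
  · rintro ⟨u, -, rfl⟩
    simp [conicVec]
    ring

section regular

open MvPolynomial

/-- The forms of bidegree `(1, 1)` that are the components of a linear map of the rank one
matrices. -/
noncomputable def rankOnePoly (P : Mat3 →ₗ[ℂ] (Fin 9 → ℂ)) (k : Fin (8 + 1)) :
    MvPolynomial (Fin (2 + 1) ⊕ Fin (2 + 1)) ℂ :=
  ∑ i, ∑ j, C (P (Matrix.single i j 1) k) * (X (Sum.inl i) * X (Sum.inr j))

theorem rankOnePoly_mem (P : Mat3 →ₗ[ℂ] (Fin 9 → ℂ)) (k : Fin (8 + 1)) :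
    rankOnePoly P k ∈ bidegreeForms 2 2 (1, 1) := by
  have h : ∀ i j : Fin 3, C (P (Matrix.single i j 1) k) * (X (Sum.inl i) * X (Sum.inr j)) ∈
      bidegreeForms 2 2 ((1, 0) + (0, 1)) := fun i j =>
    IsWeightedHomogeneous.C_mul (IsWeightedHomogeneous.mul
      (isWeightedHomogeneous_X ℂ (biweight 2 2) (Sum.inl i))
      (isWeightedHomogeneous_X ℂ (biweight 2 2) (Sum.inr j))) _
  exact Submodule.sum_mem _ fun i _ => Submodule.sum_mem _ fun j _ => h i j

theorem evalPair_rankOnePoly (P : Mat3 →ₗ[ℂ] (Fin 9 → ℂ)) (y z : Fin 3 → ℂ) :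
    evalPair (rankOnePoly P) y z = P (Matrix.vecMulVec y z) := by
  ext k
  conv_rhs => rw [Mat3.eq_sum_single (Matrix.vecMulVec y z)]
  simp only [evalPair, rankOnePoly, map_sum, map_mul, eval_C, eval_X, map_smul, Finset.sum_apply,
    Pi.smul_apply, smul_eq_mul, Matrix.vecMulVec_apply, Sum.elim_inl, Sum.elim_inr]
  exact Finset.sum_congr rfl fun i _ => Finset.sum_congr rfl fun j _ => mul_comm _ _

/-- The double Segre surface with the real structure given by the complex conjugation is a product
of two circles. -/
theorem realIsomorphicProd_segreSurface {P : Mat3 ≃ₗ[ℂ] (Fin 9 → ℂ)}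
    (h : ∀ Y, star (P Y) = P (twistedConj 1 1 Y)) :
    RealIsomorphicProd (moebiusQuadric 1 ×ˢ moebiusQuadric 1) (segreSurface P) := by
  have hne : ∀ {y z : Fin 3 → ℂ}, y ≠ 0 → z ≠ 0 → P (Matrix.vecMulVec y z) ≠ 0 :=
    fun hy hz => P.map_ne_zero_iff.2 (vecMulVec_ne_zero hy hz)
  let f : CP 2 × CP 2 → CP 8 := fun x =>
    Projectivization.mk ℂ (P (Matrix.vecMulVec x.1.rep x.2.rep))
      (hne x.1.rep_nonzero x.2.rep_nonzero)
  have hf : ∀ x y z, HasCoords x.1 y → HasCoords x.2 z →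
      HasCoords (f x) (P (Matrix.vecMulVec y z)) := by
    intro x y z hy hz
    obtain ⟨s, hs, rfl⟩ := (HasCoords.rep _).exists_smul hy
    obtain ⟨t, ht, rfl⟩ := (HasCoords.rep _).exists_smul hz
    rw [Matrix.smul_vecMulVec, Matrix.vecMulVec_smul, map_smul, map_smul]
    exact ((HasCoords.mk _).smul ht).smul hs
  have hmem : ∀ x : ↥(moebiusQuadric 1 ×ˢ moebiusQuadric 1), f x.1 ∈ segreSurface P := by
    rintro ⟨x, hx₁, hx₂⟩
    obtain ⟨u, hu, e⟩ := (mem_moebiusQuadric_one (HasCoords.rep _)).1 hx₁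
    obtain ⟨w, hw, e'⟩ := (mem_moebiusQuadric_one (HasCoords.rep _)).1 hx₂
    refine ⟨u, w, hu, hw, ?_⟩
    have := hf x _ _ (HasCoords.rep _) (HasCoords.rep _)
    rw [e, e'] at this
    exact this
  let g : ↥(moebiusQuadric 1 ×ˢ moebiusQuadric 1) → segreSurface P := fun x => ⟨f x.1, hmem x⟩
  have hg : Function.Bijective g := by
    constructor
    · intro x x' hxx
      have h1 := hf x.1 _ _ (HasCoords.rep _) (HasCoords.rep _)
      have h2 := hf x'.1 _ _ (HasCoords.rep _) (HasCoords.rep _)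
      rw [← show f x.1 = f x'.1 from congrArg Subtype.val hxx] at h2
      obtain ⟨c, hc, e⟩ := h1.exists_smul h2
      rw [← map_smul, P.injective.eq_iff] at e
      obtain ⟨⟨s, hs, e₁⟩, t, ht, e₂⟩ := exists_smul_of_vecMulVec_eq
        x'.1.1.rep_nonzero x'.1.2.rep_nonzero e
      have k₁ : HasCoords x.1.1 x'.1.1.rep := by
        rw [e₁]
        exact (HasCoords.rep _).smul hs
      have k₂ : HasCoords x.1.2 x'.1.2.rep := by
        rw [e₂]
        exact (HasCoords.rep _).smul ht
      exact Subtype.ext (Prod.ext (k₁.eq (HasCoords.rep _)) (k₂.eq (HasCoords.rep _)))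
    · rintro ⟨p, u, w, hu, hw, hp⟩
      have h₁ := HasCoords.mk (conicVec_ne_zero hu)
      have h₂ := HasCoords.mk (conicVec_ne_zero hw)
      exact ⟨⟨(_, _), (mem_moebiusQuadric_one h₁).2 ⟨u, hu, rfl⟩,
        (mem_moebiusQuadric_one h₂).2 ⟨w, hw, rfl⟩⟩, Subtype.ext ((hf _ _ _ h₁ h₂).eq hp)⟩
  let e := Equiv.ofBijective g hg
  have hsymm : ∀ p : segreSurface P, ∃ y z, HasCoords (e.symm p).1.1 y ∧
      HasCoords (e.symm p).1.2 z ∧ ∀ v, HasCoords p.1 v →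
        ∃ c : ℂ, c ≠ 0 ∧ P.symm v = c • Matrix.vecMulVec y z := by
    intro p
    refine ⟨_, _, HasCoords.rep _, HasCoords.rep _, fun v hv => ?_⟩
    have h1 := hf (e.symm p).1 _ _ (HasCoords.rep _) (HasCoords.rep _)
    have h2 : f (e.symm p).1 = p.1 := congrArg Subtype.val (e.apply_symm_apply p)
    rw [h2] at h1
    obtain ⟨c, hc, e⟩ := h1.exists_smul hv
    exact ⟨c, hc, by rw [e, map_smul, P.symm_apply_apply]⟩
  have heval : ∀ x : CP 2 × CP 2, evalAtProd (rankOnePoly P.toLinearMap) x =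
      P (Matrix.vecMulVec x.1.rep x.2.rep) := fun x =>
    evalPair_rankOnePoly P.toLinearMap x.1.rep x.2.rep
  refine ⟨e, ⟨fun x => ⟨(1, 1), rankOnePoly P.toLinearMap, rankOnePoly_mem _, ?_, fun y _ => ?_⟩,
    ?_, ?_⟩, ?_⟩
  · rw [heval]
    exact hne x.1.1.rep_nonzero x.1.2.rep_nonzero
  · rw [heval]
    exact hf _ _ _ (HasCoords.rep _) (HasCoords.rep _)
  · refine isRegularMap_of_linear fun p => ?_
    obtain ⟨y, z, hy, hz, hyz⟩ := hsymm p
    obtain ⟨j, hj⟩ := Function.ne_iff.1 hz.ne_zero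
    -- The j-th column of a rank one matrix is a multiple of its left vector, nonzero when the j-th
    -- entry of the right vector is nonzero.
    let L : Mat3 →ₗ[ℂ] (Fin 3 → ℂ) := LinearMap.pi fun i => Matrix.entryLinearMap ℂ ℂ i j
    have hL : ∀ y z, L (Matrix.vecMulVec y z) = z j • y := fun y z => by
      ext i
      exact mul_comm _ _
    refine ⟨L ∘ₗ P.symm.toLinearMap, fun v hv => ?_, fun q v hv hq => ?_⟩
    · obtain ⟨c, hc, e⟩ := hyz v hv
      rw [LinearMap.comp_apply, LinearEquiv.coe_coe, e, map_smul, hL]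
      exact smul_ne_zero hc (smul_ne_zero hj hy.ne_zero)
    · obtain ⟨y, z, hy, -, hyz⟩ := hsymm q
      obtain ⟨c, hc, e⟩ := hyz v hv
      rw [LinearMap.comp_apply, LinearEquiv.coe_coe, e, map_smul, hL] at hq ⊢
      have h0 : z j ≠ 0 := fun h0 => hq (by rw [h0, zero_smul, smul_zero])
      exact (hy.smul h0).smul hc
  · refine isRegularMap_of_linear fun p => ?_
    obtain ⟨y, z, hy, hz, hyz⟩ := hsymm p
    obtain ⟨i, hi⟩ := Function.ne_iff.1 hy.ne_zero
    let L : Mat3 →ₗ[ℂ] (Fin 3 → ℂ) := LinearMap.pi fun j => Matrix.entryLinearMap ℂ ℂ i j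
    have hL : ∀ y z, L (Matrix.vecMulVec y z) = y i • z := fun y z => rfl
    refine ⟨L ∘ₗ P.symm.toLinearMap, fun v hv => ?_, fun q v hv hq => ?_⟩
    · obtain ⟨c, hc, e⟩ := hyz v hv
      rw [LinearMap.comp_apply, LinearEquiv.coe_coe, e, map_smul, hL]
      exact smul_ne_zero hc (smul_ne_zero hi hz.ne_zero)
    · obtain ⟨y, z, -, hz, hyz⟩ := hsymm q
      obtain ⟨c, hc, e⟩ := hyz v hv
      rw [LinearMap.comp_apply, LinearEquiv.coe_coe, e, map_smul, hL] at hq ⊢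
      have h0 : y i ≠ 0 := fun h0 => hq (by rw [h0, zero_smul, smul_zero])
      exact (hz.smul h0).smul hc
  · intro x x' hx
    change f x'.1 = CP.conj (f x.1)
    have h1 := (hf x.1 _ _ (HasCoords.rep _) (HasCoords.rep _)).conj
    have h2 := hf x'.1 (star x.1.1.rep) (star x.1.2.rep) (by
      rw [hx]; exact (HasCoords.rep x.1.1).conj) (by rw [hx]; exact (HasCoords.rep x.1.2).conj)
    have h3 : star (P (Matrix.vecMulVec x.1.1.rep x.1.2.rep)) =
        P (Matrix.vecMulVec (star x.1.1.rep) (star x.1.2.rep)) := by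
      rw [h, twistedConj_one_one]
      congr 1
      ext i j
      simp [conjMat, Matrix.vecMulVec_apply]
    rw [h3] at h1
    exact h2.eq h1

end regular

/-- The identification of `ℂ⁴` with the `2 × 2` matrices that maps the real vectors to the Hermitian
matrices. -/
noncomputable def hermEquiv : (Fin 4 → ℂ) ≃ₗ[ℂ] Matrix (Fin 2) (Fin 2) ℂ where
  toFun v := !![(v 0 + v 1) / 2, (v 2 - Complex.I * v 3) / 2;
    (v 2 + Complex.I * v 3) / 2, (v 0 - v 1) / 2]
  invFun m := ![m 0 0 + m 1 1, m 0 0 - m 1 1, m 0 1 + m 1 0, Complex.I * (m 0 1 - m 1 0)]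
  map_add' v w := by
    ext i j
    fin_cases i <;> fin_cases j <;> simp <;> ring
  map_smul' c v := by
    ext i j
    fin_cases i <;> fin_cases j <;> simp <;> ring
  left_inv v := by
    ext i
    fin_cases i
    · simp; ring
    · simp; ring
    · simp; ring
    · simp; linear_combination -v 3 * Complex.I_mul_I
  right_inv m := by
    ext i j
    fin_cases i <;> fin_cases j
    · simp
    · simp; linear_combination -(m 0 1 - m 1 0) / 2 * Complex.I_mul_I
    · simp; linear_combination (m 0 1 - m 1 0) / 2 * Complex.I_mul_I
    · simp

theorem hermEquiv_star (v : Fin 4 → ℂ) : hermEquiv (star v) = (hermEquiv v).conjTranspose := by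
  ext i j
  fin_cases i <;> fin_cases j <;> simp [hermEquiv] <;> ring

/-- A singular matrix with a nonzero entry is the product of the column and the row through that
entry, divided by the entry. -/
theorem exists_vecMulVec_of_det_eq_zero {m : Matrix (Fin 2) (Fin 2) ℂ} (h0 : m ≠ 0)
    (h : m.det = 0) : ∃ u w : Fin 2 → ℂ, u ≠ 0 ∧ w ≠ 0 ∧ m = Matrix.vecMulVec u w := by
  obtain ⟨i, hi⟩ := Function.ne_iff.1 h0
  obtain ⟨j, hj⟩ := Function.ne_iff.1 hi
  simp only [Matrix.zero_apply] at hj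
  rw [Matrix.det_fin_two] at h
  refine ⟨fun k => m k j, fun l => m i l / m i j, Function.ne_iff.2 ⟨i, hj⟩,
    Function.ne_iff.2 ⟨j, by simp [hj]⟩, ?_⟩
  ext k l
  rw [Matrix.vecMulVec_apply]
  field_simp
  fin_cases i <;> fin_cases j <;> fin_cases k <;> fin_cases l <;> simp <;>
    first | ring1 | linear_combination h | linear_combination -h

/-- The determinant of `hermEquiv v` is -1/4 times the equation of the sphere, so points of the
sphere correspond to rank one matrices. -/
theorem mem_moebiusQuadric_two {y : CP 3} {v : Fin 4 → ℂ} (h : HasCoords y v) :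
    y ∈ moebiusQuadric 2 ↔
      ∃ u w : Fin 2 → ℂ, u ≠ 0 ∧ w ≠ 0 ∧ hermEquiv v = Matrix.vecMulVec u w := by
  have key : y ∈ moebiusQuadric 2 ↔ (hermEquiv v).det = 0 := by
    have hdet : (hermEquiv v).det =
        -1 / 4 * (-(v 0 * v 0) + (v 1 * v 1 + (v 2 * v 2 + v 3 * v 3))) := by
      rw [Matrix.det_fin_two]
      simp [hermEquiv]
      linear_combination v 3 ^ 2 / 4 * Complex.I_mul_I
    rw [moebiusQuadric, CP.mem_quadric h, hdet, mul_eq_zero, or_iff_right (by norm_num)]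
    simp [Matrix.diagonal_map, dotProduct, Matrix.mulVec_diagonal, Fin.sum_univ_succ]
  rw [key]
  constructor
  · intro hv
    exact exists_vecMulVec_of_det_eq_zero (hermEquiv.map_ne_zero_iff.2 h.ne_zero) hv
  · rintro ⟨u, w, -, -, e⟩
    rw [e, Matrix.det_fin_two]
    simp only [Matrix.vecMulVec_apply]
    ring

/-- The coefficients of the coordinates of the conic. -/
def conicCoeff : Fin 3 → Matrix (Fin 2) (Fin 2) ℂ :=
  ![!![1, 0; 0, 1], !![1, 0; 0, -1], !![0, 1; 1, 0]]

theorem conicVec_eq_sum (u : Fin 2 → ℂ) (i : Fin 3) :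
    conicVec u i = ∑ a, ∑ b, conicCoeff i a b * (u a * u b) := by
  fin_cases i <;> simp [conicVec, conicCoeff, Fin.sum_univ_two] <;> ring

/-- The coefficients of the products of the coordinates of the line in terms of the conic. -/
noncomputable def lineCoeff (a b : Fin 2) : Fin 3 → ℂ :=
  !![![1 / 2, 1 / 2, 0], ![0, 0, 1 / 2]; ![0, 0, 1 / 2], ![1 / 2, -1 / 2, 0]] a b

theorem lineCoeff_dotProduct (a b : Fin 2) (u : Fin 2 → ℂ) :
    lineCoeff a b ⬝ᵥ conicVec u = u a * u b := by
  fin_cases a <;> fin_cases b <;>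
    simp [lineCoeff, conicVec, dotProduct, Fin.sum_univ_three] <;> ring

/-- The linear map that recovers the rank one matrix `u wᵀ` from the point of the double Segre
surface. -/
noncomputable def rankOneOfSegre (a c : Fin 2) : Mat3 →ₗ[ℂ] Matrix (Fin 2) (Fin 2) ℂ where
  toFun Y := Matrix.of fun b d => lineCoeff a b ⬝ᵥ Y.mulVec (lineCoeff c d)
  map_add' Y Z := by
    ext b d
    simp [Matrix.add_mulVec]
  map_smul' s Y := by
    ext b d
    simp [Matrix.smul_mulVec]

theorem rankOneOfSegre_segre (a c : Fin 2) (u w : Fin 2 → ℂ) :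
    rankOneOfSegre a c (segre u w) = (u a * w c) • Matrix.vecMulVec u w := by
  ext b d
  change lineCoeff a b ⬝ᵥ (Matrix.vecMulVec (conicVec u) (conicVec w)).mulVec (lineCoeff c d) = _
  rw [Matrix.vecMulVec_mulVec, Matrix.smul_apply, Matrix.vecMulVec_apply]
  have h1 := lineCoeff_dotProduct a b u
  have h2 := lineCoeff_dotProduct c d w
  rw [dotProduct_comm] at h2
  rw [h2, dotProduct_smul, h1]
  simp
  ring

section regular

open MvPolynomial

/-- The entries of the Hermitian matrix as polynomials. -/
noncomputable def hermPoly (a c : Fin 2) : MvPolynomial (Fin (3 + 1)) ℂ :=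
  linPoly (Matrix.entryLinearMap ℂ ℂ a c ∘ₗ hermEquiv.toLinearMap)

/-- The quadratic forms that map a point of the sphere to the double Segre surface. -/
noncomputable def spherePoly (P : Mat3 →ₗ[ℂ] (Fin 9 → ℂ)) (k : Fin (8 + 1)) :
    MvPolynomial (Fin (3 + 1)) ℂ :=
  ∑ i, ∑ j, C (P (Matrix.single i j 1) k) * ∑ a, ∑ b, ∑ c, ∑ d,
    C (conicCoeff i a b * conicCoeff j c d) * (hermPoly a c * hermPoly b d)

theorem isHomogeneous_spherePoly (P : Mat3 →ₗ[ℂ] (Fin 9 → ℂ)) (k : Fin (8 + 1)) :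
    (spherePoly P k).IsHomogeneous 2 := by
  refine IsHomogeneous.sum _ _ _ fun i _ => IsHomogeneous.sum _ _ _ fun j _ =>
    IsHomogeneous.C_mul (IsHomogeneous.sum _ _ _ fun a _ => IsHomogeneous.sum _ _ _ fun b _ =>
      IsHomogeneous.sum _ _ _ fun c _ => IsHomogeneous.sum _ _ _ fun d _ =>
        IsHomogeneous.C_mul ?_ _) _
  exact (isHomogeneous_linPoly _).mul (isHomogeneous_linPoly _)

/-- A monomial u_a u_b w_c w_d is the product of the entries (a,c) and (b,d) of the matrix u wᵀ, so
forms of bidegree (2,2) become quadratic forms in its entries. -/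
theorem eval_spherePoly (P : Mat3 →ₗ[ℂ] (Fin 9 → ℂ)) {v : Fin 4 → ℂ} {u w : Fin 2 → ℂ}
    (h : hermEquiv v = Matrix.vecMulVec u w) (k : Fin (8 + 1)) :
    eval v (spherePoly P k) = P (segre u w) k := by
  have hherm : ∀ a c, eval v (hermPoly a c) = u a * w c := fun a c => by
    rw [hermPoly, eval_linPoly]
    exact congrFun (congrFun h a) c
  conv_rhs => rw [Mat3.eq_sum_single (segre u w)]
  simp only [spherePoly, map_sum, map_mul, eval_C, hherm, map_smul, Finset.sum_apply,
    Pi.smul_apply, smul_eq_mul, segre_apply]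
  refine Finset.sum_congr rfl fun i _ => Finset.sum_congr rfl fun j _ => ?_
  rw [mul_comm, conicVec_eq_sum, conicVec_eq_sum]
  congr 1
  simp only [Fin.sum_univ_two]
  ring

theorem evalAt_spherePoly (P : Mat3 →ₗ[ℂ] (Fin 9 → ℂ)) {x : CP 3} {u w : Fin 2 → ℂ}
    (h : hermEquiv x.rep = Matrix.vecMulVec u w) : evalAt (spherePoly P) x = P (segre u w) := by
  ext k
  rw [evalAt, eval_spherePoly P h]

/-- The double Segre surface with the real structure given by the interchange of the factors is
a sphere. -/
theorem realIsomorphic_segreSurface {P : Mat3 ≃ₗ[ℂ] (Fin 9 → ℂ)}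
    (h : ∀ Y, star (P Y) = P (swapConj Y)) :
    RealIsomorphic (moebiusQuadric 2) (segreSurface P) := by
  have hrep : ∀ x : moebiusQuadric 2, ∃ u w : Fin 2 → ℂ, u ≠ 0 ∧ w ≠ 0 ∧
      hermEquiv x.1.rep = Matrix.vecMulVec u w := fun x =>
    (mem_moebiusQuadric_two (HasCoords.rep _)).1 x.2
  choose U W hU hW hUW using hrep
  let g : moebiusQuadric 2 → segreSurface P := fun x =>
    ⟨Projectivization.mk ℂ (P (segre (U x) (W x))) (param_ne_zero P (hU x) (hW x)),
      U x, W x, hU x, hW x, HasCoords.mk _⟩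
  have hg : ∀ x v u w, HasCoords x.1 v → hermEquiv v = Matrix.vecMulVec u w →
      HasCoords (g x).1 (P (segre u w)) := by
    intro x v u w hv e
    obtain ⟨c, hc, e'⟩ := hv.exists_smul (HasCoords.rep x.1)
    have e2 := hUW x
    rw [e', map_smul, e] at e2
    obtain ⟨⟨s, hs, es⟩, t, ht, et⟩ := exists_smul_of_vecMulVec_eq (hU x) (hW x) e2.symm
    have h1 : HasCoords (g x).1 (P (segre (U x) (W x))) := HasCoords.mk _
    rw [es, et, segre_smul, map_smul] at h1
    exact h1.of_smul
  have hbij : Function.Bijective g := by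
    constructor
    · intro x x' hxx
      have h1 := hg x _ _ _ (HasCoords.rep _) (hUW x)
      have h2 := hg x' _ _ _ (HasCoords.rep _) (hUW x')
      rw [← hxx] at h2
      obtain ⟨c, hc, e⟩ := h1.exists_smul h2
      rw [← map_smul, P.injective.eq_iff] at e
      obtain ⟨⟨s, es⟩, t, et⟩ := exists_smul_of_segre_eq (hU x) (hW x) (hU x') (hW x') e
      have e2 := hUW x'
      rw [es, et, Matrix.smul_vecMulVec, Matrix.vecMulVec_smul, ← hUW x, ← map_smul, ← map_smul,
        hermEquiv.injective.eq_iff] at e2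
      have h3 := HasCoords.rep x'.1
      rw [e2] at h3
      exact Subtype.ext ((HasCoords.rep x.1).eq h3.of_smul.of_smul)
    · rintro ⟨p, u, w, hu, hw, hp⟩
      have hne : hermEquiv.symm (Matrix.vecMulVec u w) ≠ 0 :=
        hermEquiv.symm.map_ne_zero_iff.2 (vecMulVec_ne_zero hu hw)
      have hc := HasCoords.mk hne
      exact ⟨⟨_, (mem_moebiusQuadric_two hc).2 ⟨u, w, hu, hw, hermEquiv.apply_symm_apply _⟩⟩,
        Subtype.ext ((hg _ _ _ _ hc (hermEquiv.apply_symm_apply _)).eq hp)⟩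
  let e := Equiv.ofBijective g hbij
  have hsymm : ∀ p : segreSurface P, ∃ u w : Fin 2 → ℂ, u ≠ 0 ∧ w ≠ 0 ∧
      HasCoords (e.symm p).1 (hermEquiv.symm (Matrix.vecMulVec u w)) ∧
      ∀ v, HasCoords p.1 v → ∃ c : ℂ, c ≠ 0 ∧ P.symm v = c • segre u w := by
    intro p
    refine ⟨_, _, hU (e.symm p), hW (e.symm p), ?_, fun v hv => ?_⟩
    · rw [← hUW, hermEquiv.symm_apply_apply]
      exact HasCoords.rep _
    · have h1 := hg (e.symm p) _ _ _ (HasCoords.rep _) (hUW _)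
      rw [show g (e.symm p) = p from e.apply_symm_apply p] at h1
      obtain ⟨c, hc, e⟩ := h1.exists_smul hv
      exact ⟨c, hc, by rw [e, map_smul, P.symm_apply_apply]⟩
  have heval : ∀ x : moebiusQuadric 2, evalAt (spherePoly P.toLinearMap) x.1 =
      P (segre (U x) (W x)) := fun x =>
    evalAt_spherePoly P.toLinearMap (hUW x)
  refine ⟨e, ⟨fun x => ⟨2, spherePoly P.toLinearMap, isHomogeneous_spherePoly _, ?_,
    fun y _ => ?_⟩, ?_⟩, ?_⟩
  · rw [heval]
    exact param_ne_zero P (hU x) (hW x)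
  · rw [heval]
    exact HasCoords.mk _
  · refine isRegularMap_of_linear fun p => ?_
    obtain ⟨u, w, hu, hw, hp, huw⟩ := hsymm p
    obtain ⟨i, hi⟩ := Function.ne_iff.1 hu
    obtain ⟨j, hj⟩ := Function.ne_iff.1 hw
    let L : (Fin 9 → ℂ) →ₗ[ℂ] (Fin 4 → ℂ) :=
      hermEquiv.symm.toLinearMap ∘ₗ rankOneOfSegre i j ∘ₗ P.symm.toLinearMap
    have hL : ∀ {v c u w}, P.symm v = c • segre u w →
        L v = (c * (u i * w j)) • hermEquiv.symm (Matrix.vecMulVec u w) := by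
      intro v c u w e
      change hermEquiv.symm (rankOneOfSegre i j (P.symm v)) = _
      rw [e, map_smul, rankOneOfSegre_segre, smul_smul, map_smul]
    refine ⟨L, fun v hv => ?_, fun q v hv hq => ?_⟩
    · obtain ⟨c, hc, e⟩ := huw v hv
      rw [hL e]
      exact smul_ne_zero (mul_ne_zero hc (mul_ne_zero hi hj)) hp.ne_zero
    · obtain ⟨u, w, -, -, hp, huw⟩ := hsymm q
      obtain ⟨c, hc, e⟩ := huw v hv
      rw [hL e] at hq ⊢
      exact hp.smul fun h0 => hq (by rw [h0, zero_smul])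
  · intro x x' hx
    change (g x').1 = CP.conj (g x).1
    have h1 := (hg x _ _ _ (HasCoords.rep _) (hUW x)).conj
    -- The adjoint of u wᵀ is w̄ ūᵀ, so conjugation on the sphere conjugates and exchanges the
    -- factors, exactly as `swapConj` does.
    have h2 := hg x' (star x.1.rep) (star (W x)) (star (U x)) (by
      rw [hx]; exact (HasCoords.rep x.1).conj) (by
      rw [hermEquiv_star, hUW, Matrix.conjTranspose_vecMulVec])
    rw [h, swapConj, conjMat_segre, segre_transpose] at h1
    exact h2.eq h1

end regular

/-! ### Existence and uniqueness in the two signatures -/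

theorem corollary2 (A : Matrix (Fin 9) (Fin 9) ℝ) :
    (HasSignature A 4 5 →
      ∃ X : Set (CP 8),
        (IsDoubleSegre X ∧ X ⊆ quadric A ∧ AutZeroSubset X (quadric A)) ∧
        RealIsomorphicProd (moebiusQuadric 1 ×ˢ moebiusQuadric 1) X ∧
        ∀ X' : Set (CP 8),
          IsDoubleSegre X' → X' ⊆ quadric A → AutZeroSubset X' (quadric A) →
            EquivalentIn (quadric A) X X') ∧
    (HasSignature A 3 6 →
      ∃ X : Set (CP 8),
        (IsDoubleSegre X ∧ CP.HasRealPoint X ∧ X ⊆ quadric A ∧ AutZeroSubset X (quadric A)) ∧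
        RealIsomorphic (moebiusQuadric 2) X ∧
        ∀ X' : Set (CP 8),
          IsDoubleSegre X' → CP.HasRealPoint X' → X' ⊆ quadric A →
            AutZeroSubset X' (quadric A) → EquivalentIn (quadric A) X X') := by
  refine ⟨fun hA => ?_, fun hA => ?_⟩
  · have hpos : sigPos A.toQuadraticForm' ≠ 0 := by rw [hA.2.2.1]; decide
    have hneg : sigNeg A.toQuadraticForm' ≠ 0 := by rw [hA.2.2.2]; decide
    -- The frame of real matrices has five positive and four negative norms, so (4,5) is the
    -- signature of the negative of the invariant form.
    obtain ⟨P, hP, hPA⟩ := isRealFrame_one_one.exists_param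
      (isRealStructure_twistedConj (Or.inl rfl) (Or.inl rfl)) (A := A) hA
    have hk : ((-1 : ℝ) : ℂ) ≠ 0 := by simp
    have hX := isParam_segreSurface P
    have hreal := isReal_segreSurface_of_conj hP
    refine ⟨segreSurface P, ⟨hX.isDoubleSegre hreal, hX.subset_quadric hk hPA,
      hX.autZeroSubset hreal hk hPA⟩, realIsomorphicProd_segreSurface hP,
      fun X' hX' _ haut => ?_⟩
    obtain ⟨P', hP', ⟨k, hk0, hkA⟩, h | h | h | h⟩ :=
      hX'.exists_cform_eq hA.1 hpos hneg haut
    · exact hX.equivalentIn hP' hP h (neg_ne_zero.2 one_ne_zero) hk0 hPA hkA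
    -- The other real structures give (3,6), (9,0) and (6,3), and none of these is (4,5), even after
    -- a change of sign.
    · have hs := isRealFrame_quat_one.signature h hk0 hkA
      rw [hA.2.2.1, hA.2.2.2] at hs
      exact absurd hs (by decide)
    · have hs := isRealFrame_quat_quat.signature h hk0 hkA
      rw [hA.2.2.1, hA.2.2.2] at hs
      exact absurd hs (by decide)
    · have hs := isRealFrame_swapConj.signature h hk0 hkA
      rw [hA.2.2.1, hA.2.2.2] at hs
      exact absurd hs (by decide)
  · have hpos : sigPos A.toQuadraticForm' ≠ 0 := by rw [hA.2.2.1]; decide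
    have hneg : sigNeg A.toQuadraticForm' ≠ 0 := by rw [hA.2.2.2]; decide
    obtain ⟨P, hP, hPA⟩ := isRealFrame_swapConj.exists_param isRealStructure_swapConj (A := A) hA
    have hk : ((-1 : ℝ) : ℂ) ≠ 0 := by simp
    have hX := isParam_segreSurface P
    have hreal := isReal_segreSurface_of_swap hP
    refine ⟨segreSurface P, ⟨hX.isDoubleSegre hreal, hasRealPoint_segreSurface_of_swap hP,
      hX.subset_quadric hk hPA, hX.autZeroSubset hreal hk hPA⟩,
      realIsomorphic_segreSurface hP, fun X' hX' hpt _ haut => ?_⟩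
    obtain ⟨P', hP', ⟨k, hk0, hkA⟩, h | h | h | h⟩ :=
      hX'.exists_cform_eq hA.1 hpos hneg haut
    -- Real matrices give (5,4) or (4,5), never (3,6).
    · have hs := isRealFrame_one_one.signature h hk0 hkA
      rw [hA.2.2.1, hA.2.2.2] at hs
      exact absurd hs (by decide)
    -- The signature alone does not exclude this case, since `twistedConj quat 1` also gives (3,6);
    -- the real point does.
    · exact absurd hpt (hP'.not_hasRealPoint (Or.inl rfl) h)
    · exact absurd hpt (hP'.not_hasRealPoint (Or.inr rfl) h)
    · exact hX.equivalentIn hP' hP h (neg_ne_zero.2 one_ne_zero) hk0 hPA hkA
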